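/- Let $k$ be a field. For a finite set $\mathcal B=\{b_1,\dots,b_r\}\subset\mathbb N^m$ of nonzero vectors, the toric ideal $I_{\mathcal B}$ is the kernel of the $k$-algebra homomorphism $k[x_1,\dots,x_r]\to k[t_1,\dots,t_m]$, $x_i\mapsto t_1^{b_{i1}}\cdots t_m^{b_{im}}$; it is a complete intersection if its minimal number of generators equals its height. For a finite nonempty set $\mathcal A$ of positive integers with maximum $D$, put $\mathcal A^\star=\{(a,D-a): a\in\mathcal A\}\cup\{(0,D)\}\subset\mathbb N^2$; $I_{\mathcal A^\star}$ is the toric ideal of the projective monomial curve of $\mathcal A$. The set $\mathcal B_{red}$ is obtained from $\mathcal B$ by applying the following steps as long as possible: remove an element $b\in\mathcal B$ that does not lie in the $\mathbb Q$-span of $\mathcal B\setminus\{b\}$; remove an element $b$ that is an $\mathbb N$-linear combination of $\mathcal B\setminus\{b\}$; replace an element $b$ that lies in the $\mathbb Q$-span of $\mathcal B\setminus\{b\}$ by $cb$, where $c$ is the least positive integer such that $cb$ is a $\mathbb Z$-linear combination of $\mathcal B\setminus\{b\}$. The process ends when every remaining element is a $\mathbb Z$-linear but not an $\mathbb N$-linear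 combination of the others (in particular when no element remains); the resulting set $\mathcal B_{red}$ does not depend on the choices made. A sequence $a_1,\dots,a_s$ of positive integers is a generalized arithmetic sequence if there is a positive integer $h$ such that $ha_1,a_2,\dots,a_s$ is an increasing arithmetic sequence. **Theorem.** Let $n\ge 4$ and let $\mathcal A=\{d_1,\dots,d_n\}$ be a set of $n$ distinct positive integers with $\gcd(d_1,\dots,d_n)=1$ such that $d_1,\dots,d_{n-1}$ is a generalized arithmetic sequence and $d_n,d_2,\dots,d_{n-1}$ is not an increasing arithmetic sequence. Then $I_{\mathcal A^\star}$ is a complete intersection if and only if $n=4$, $d_1,d_2,d_3$ is an (increasing) arithmetic sequence and one of the following holds: 1. $d_1/\gcd(d_1,d_2)$ is even and there are $\beta_1,\beta_2,\beta_3\in\mathbb N$ with $\gcd(d_1,d_2)\,d_4=\beta_1d_1+\beta_2d_2+\beta_3d_3$ and $\beta_1+\beta_2+\beta_3\le\gcd(d_1,d_2)$; or 2. $d_1$ and $d_4$ are even and $\mathcal C^\star_{red}=\emptyset$, where $\mathcal C=\{d_1,d_3,d_4\}$. -/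

import Mathlib

noncomputable section

namespace ToricCI

/-- A finite sequence of natural numbers is an increasing arithmetic sequence. -/
def IsArithSeq {m : ℕ} (a : Fin m → ℕ) : Prop :=
  ∃ r : ℕ, 0 < r ∧ ∀ i j : Fin m, j.val = i.val + 1 → a j = a i + r

/-- `a₁, …, aₘ` is a generalized arithmetic sequence: for some positive integer `h` the sequence
`h a₁, a₂, …, aₘ` is an increasing arithmetic sequence. -/
def IsGenArithSeq {m : ℕ} (a : Fin m → ℕ) : Prop :=
  ∃ h : ℕ, 0 < h ∧ IsArithSeq (fun i => if i.val = 0 then h * a i else a i)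

/-- The toric ideal of a finite set `B ⊆ ℕᵐ`: the kernel of the `k`-algebra homomorphism
`k[x_b : b ∈ B] → k[t₁, …, tₘ]`, `x_b ↦ t₁ ^ b₁ ⋯ tₘ ^ bₘ`. -/
def toricIdeal (k : Type*) [Field k] {m : ℕ} (B : Finset (Fin m → ℕ)) :
    Ideal (MvPolynomial B k) :=
  RingHom.ker
    (MvPolynomial.aeval (R := k)
      (fun b : B => ∏ j : Fin m, (MvPolynomial.X j : MvPolynomial (Fin m) k) ^ b.1 j))

/-- `I` is a complete intersection: its minimal number of generators equals its height. -/
def IsCompleteIntersection {R : Type*} [CommRing R] (I : Ideal R) : Prop :=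
  Cardinal.toENat (Submodule.spanRank I) = I.height

/-- For a finite set `A` of positive integers with maximum `D`, the set
`A⋆ = {(a, D - a) : a ∈ A} ∪ {(0, D)} ⊆ ℕ²`. -/
def star (A : Finset ℕ) : Finset (Fin 2 → ℕ) :=
  insert ![0, A.sup id] (A.image fun a => ![a, A.sup id - a])

/-- The set of `ℕ`-linear combinations of the elements of `B`. -/
def natSpan {m : ℕ} (B : Finset (Fin m → ℕ)) : Submodule ℕ (Fin m → ℕ) :=
  Submodule.span ℕ (B : Set (Fin m → ℕ))

/-- The subgroup of `ℤᵐ` generated by `B`. -/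
def intSpan {m : ℕ} (B : Finset (Fin m → ℕ)) : Submodule ℤ (Fin m → ℤ) :=
  Submodule.span ℤ ((fun (v : Fin m → ℕ) (j : Fin m) => (v j : ℤ)) '' (B : Set (Fin m → ℕ)))

/-- The subspace of `ℚᵐ` generated by `B`. -/
def ratSpan {m : ℕ} (B : Finset (Fin m → ℕ)) : Submodule ℚ (Fin m → ℚ) :=
  Submodule.span ℚ ((fun (v : Fin m → ℕ) (j : Fin m) => (v j : ℚ)) '' (B : Set (Fin m → ℕ)))

/-- One step of the reduction process on finite subsets of `ℕᵐ`. -/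
inductive ReductionStep {m : ℕ} : Finset (Fin m → ℕ) → Finset (Fin m → ℕ) → Prop
  /-- remove an element that is not in the rational span of the others -/
  | remove_free (B : Finset (Fin m → ℕ)) (b : Fin m → ℕ) (hb : b ∈ B)
      (h : (fun j => (b j : ℚ)) ∉ ratSpan (B.erase b)) :
      ReductionStep B (B.erase b)
  /-- remove an element that is an `ℕ`-combination of the others -/
  | remove_redundant (B : Finset (Fin m → ℕ)) (b : Fin m → ℕ) (hb : b ∈ B)
      (h : b ∈ natSpan (B.erase b)) :
      ReductionStep B (B.erase b)
  /-- replace `b`, an element of the rational span of the others, by `c b`, where `c` is the least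
  positive integer such that `c b` is a `ℤ`-combination of the others -/
  | scale (B : Finset (Fin m → ℕ)) (b : Fin m → ℕ) (hb : b ∈ B)
      (hQ : (fun j => (b j : ℚ)) ∈ ratSpan (B.erase b)) (c : ℕ)
      (hc : IsLeast
        {c : ℕ | 0 < c ∧ (fun j => (c : ℤ) * (b j : ℤ)) ∈ intSpan (B.erase b)} c) :
      ReductionStep B (insert (c • b) (B.erase b))

/-- `R` is the reduced set `B_red`: it is obtained from `B` by finitely many reduction steps, and
each of its elements is a `ℤ`-combination, but not an `ℕ`-combination, of the others
(which holds in particular when `R` is empty). -/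
def IsRed {m : ℕ} (B R : Finset (Fin m → ℕ)) : Prop :=
  Relation.ReflTransGen ReductionStep B R ∧
    ∀ b ∈ R, (fun j => (b j : ℤ)) ∈ intSpan (R.erase b) ∧ b ∉ natSpan (R.erase b)

end ToricCI

end

/-! Write `x_i` for the variable of weight `d i` (indices start at `0`), `y` for the variable of
`(0, D)`, which has weight zero, and `p` for the index of the largest weight. The toric ideal `I` is
the kernel of `x_i ↦ s t ^ (d i)`, `y ↦ s`, and its height is `n - 1`.

Necessity. For `i ≠ p` let `c i` be the least positive exponent for which `x_i ^ c i` has the degree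
of a monomial without `x_i`. By minimality `x_i ^ c i` shares no variable with the other monomials
of its degree, so the `n - 1` critical binomials are independent in `I / m I`, where `m` is the
ideal of all variables. A complete intersection leaves no room for further minimal generators. The
consequences are collected in `IsCritical`. The critical binomials generate the lattice of relations
(`lattice`). In a nontrivial relation without pure powers each side properly contains a monomial of
critical degree (`move`). In every nonempty set `T` of variables other than `x_p` and `y`, some
member has critical relations free of `T` on the other side (`avoid`); otherwise `#T` minimal
generators would lie in the ideal of the variables of `T`, contradicting the height.

What remains is arithmetic. Interlocking quadrics violate `avoid`, so `n ≤ 5`, and `n = 4` if `h =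
1`. If `h ≥ 2`, `move` is applied to `x_0 ^ h x_q = x_u x_w y ^ (h - 1)`; either this fails at once
or it makes the lattice triangular, which contradicts `gcd = 1` (`false_of_elimination`). If `n = 4`
and `h = 1`, the quadric `x_1 ^ 2 = x_0 x_2` is critical and the lattice is again triangular; the
place of the quadric in the elimination order decides between the two alternatives.

Sufficiency. If `c • b` is an `ℕ`-combination of `B` and every relation fixes the exponent of `x_b`
modulo `c`, adjoining `b` to `B` costs one relation. Undoing reduction steps in this way yields `#B
- rank B` relations when `B_red` is empty (`HasCIPairs.of_step`). Both alternatives thus give `n -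
1` generators, and Krull's height theorem excludes fewer. -/

namespace ToricCI

/-! ### Minimal generators and heights via Nakayama's lemma. -/

/-- Steinitz exchange: a linearly independent family in the span of `g` replaces as many members
of `g`. -/
theorem exists_finset_exchange {K V ι κ : Type*} [Field K] [AddCommGroup V] [Module K V]
    [Fintype ι] [Fintype κ] (f : ι → V) (g : κ → V) (hf : LinearIndependent K f)
    (hfg : ∀ i, f i ∈ Submodule.span K (Set.range g)) :
    ∃ S : Finset κ, Fintype.card ι + S.card ≤ Fintype.card κ ∧
      ∀ j, g j ∈ Submodule.span K (Set.range f ∪ g '' S) := by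
  classical
  let v : ι ⊕ κ → V := Sum.elim f g
  have hs : LinearIndepOn K v (Set.range Sum.inl) := by
    rw [linearIndepOn_range_iff Sum.inl_injective]
    exact hf
  -- Extend `f` inside the joint family to a basis of the span; as `f` lies in the span of `g`, the
  -- basis has at most `card κ` members.
  obtain ⟨b, -, hsb, hspan, hb⟩ := exists_linearIndepOn_extension hs (Set.subset_univ _)
  refine ⟨Finset.univ.filter fun j => Sum.inr j ∈ b, ?_, fun j => ?_⟩
  · have hle : Submodule.span K (v '' b) ≤ Submodule.span K (Set.range g) := by
      rw [Submodule.span_le]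
      rintro _ ⟨x, -, rfl⟩
      rcases x with i | j
      · exact hfg i
      · exact Submodule.subset_span ⟨j, rfl⟩
    have h1 : Fintype.card b ≤ Fintype.card κ := by
      have hb' : LinearIndependent K (fun x : b => v x) := hb
      have h2 := finrank_span_eq_card hb'
      have h3 : Set.range (fun x : b => v x) = v '' b := by
        ext x; simp
      rw [h3] at h2
      rw [← h2]
      have := FiniteDimensional.span_of_finite K (Set.finite_range g)
      exact (Submodule.finrank_mono hle).trans (finrank_range_le_card g)
    refine le_trans ?_ h1
    rw [← Finset.card_univ (α := ι), ← Finset.card_disjSum, ← Set.toFinset_card]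
    refine Finset.card_le_card ?_
    rintro (i | j) hx
    · simpa using hsb ⟨i, rfl⟩
    · simpa using hx
  · have : g j ∈ Submodule.span K (v '' b) := hspan ⟨Sum.inr j, trivial, rfl⟩
    refine Submodule.span_mono ?_ this
    rintro _ ⟨x, hx, rfl⟩
    rcases x with i | j
    · exact Or.inl ⟨i, rfl⟩
    · exact Or.inr ⟨j, by simpa using hx, rfl⟩

section Exchange

variable {k R ι κ : Type*} [Field k] [CommRing R] [Algebra k R] [Fintype ι] [Fintype κ]
  [DecidableEq ι]

/-- Elements of an ideal `I` which are separated by functionals vanishing on `m * I` can be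
completed to generators of `I` up to `m * I`. -/
theorem exists_finset_le_sup_mul (m I : Ideal R)
    (hm : ∀ x : R, ∃ c : k, x - algebraMap k R c ∈ m) (g : κ → R)
    (hg : Ideal.span (Set.range g) = I) (f : ι → R) (hf : ∀ i, f i ∈ I) (φ : ι → R →ₗ[k] k)
    (hφ : ∀ i, ∀ x ∈ m * I, φ i x = 0) (hφf : ∀ i j, φ i (f j) = if i = j then 1 else 0) :
    ∃ S : Finset κ, Fintype.card ι + S.card ≤ Fintype.card κ ∧
      I ≤ Ideal.span (Set.range f ∪ g '' S) ⊔ m * I := by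
  classical
  let N : Submodule k R := (m * I).restrictScalars k
  -- As `R = k + m`, a ring element acts on `I / m I` through its constant part, so `R`-generators
  -- of `I` span this quotient over `k`.
  have key : ∀ (A : Set R), A ⊆ I → ∀ x, x ∈ Ideal.span A →
      N.mkQ x ∈ Submodule.span k (N.mkQ '' A) := by
    intro A hA x hx
    induction hx using Submodule.span_induction with
    | mem x hx => exact Submodule.subset_span ⟨x, hx, rfl⟩
    | zero => simp
    | add x y _ _ hx hy => rw [map_add]; exact add_mem hx hy
    | smul a x hxA hx =>
      obtain ⟨c, hc⟩ := hm a
      have hxI : x ∈ I := (Ideal.span_le.2 hA) hxA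
      have : N.mkQ (a • x) = c • N.mkQ x := by
        rw [← map_smul, ← sub_eq_zero, ← map_sub, Submodule.mkQ_apply,
          Submodule.Quotient.mk_eq_zero]
        change a • x - c • x ∈ m * I
        rw [Algebra.smul_def c x, smul_eq_mul, ← sub_mul]
        exact Ideal.mul_mem_mul hc hxI
      rw [this]
      exact Submodule.smul_mem _ _ hx
  -- The functionals vanish on `m * I` and form a dual system to the `f i`, so the classes of the `f
  -- i` are independent.
  have hli : LinearIndependent k (fun i => N.mkQ (f i)) := by
    rw [Fintype.linearIndependent_iff]
    intro c hc i
    have h1 : ∑ j, c j • f j ∈ m * I := by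
      have : N.mkQ (∑ j, c j • f j) = 0 := by simpa using hc
      rwa [Submodule.mkQ_apply, Submodule.Quotient.mk_eq_zero] at this
    have h2 := hφ i _ h1
    simpa [hφf] using h2
  have hgI : ∀ j, g j ∈ I := fun j => hg ▸ Ideal.subset_span ⟨j, rfl⟩
  obtain ⟨S, hS, hspan⟩ := exists_finset_exchange (fun i => N.mkQ (f i)) (fun j => N.mkQ (g j)) hli
    (by
      intro i
      have := key (Set.range g) (by rintro _ ⟨j, rfl⟩; exact hgI j) (f i) (by rw [hg]; exact hf i)
      rwa [← Set.range_comp] at this)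
  refine ⟨S, hS, ?_⟩
  rw [← hg, Ideal.span_le, hg]
  rintro _ ⟨j, rfl⟩
  have h1 := hspan j
  have h2 : (Set.range fun i => N.mkQ (f i)) ∪ (fun j => N.mkQ (g j)) '' S
      = N.mkQ '' (Set.range f ∪ g '' S) := by
    rw [Set.image_union, ← Set.range_comp, Set.image_image]; rfl
  rw [h2, ← Submodule.map_span] at h1
  obtain ⟨z, hz, hzg⟩ := h1
  have h3 : g j - z ∈ m * I := by
    have : N.mkQ (g j - z) = 0 := by rw [map_sub, sub_eq_zero]; exact hzg.symm
    rwa [Submodule.mkQ_apply, Submodule.Quotient.mk_eq_zero] at this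
  have h4 : z ∈ Ideal.span (Set.range f ∪ g '' S) :=
    Submodule.span_le_restrictScalars k R _ hz
  have h5 : g j = z + (g j - z) := by ring
  rw [h5]
  exact Submodule.add_mem_sup h4 h3

theorem card_le_of_separated (m I : Ideal R)
    (hm : ∀ x : R, ∃ c : k, x - algebraMap k R c ∈ m) (g : κ → R)
    (hg : Ideal.span (Set.range g) = I) (f : ι → R) (hf : ∀ i, f i ∈ I) (φ : ι → R →ₗ[k] k)
    (hφ : ∀ i, ∀ x ∈ m * I, φ i x = 0) (hφf : ∀ i j, φ i (f j) = if i = j then 1 else 0) :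
    Fintype.card ι ≤ Fintype.card κ := by
  obtain ⟨S, hS, -⟩ := exists_finset_le_sup_mul m I hm g hg f hf φ hφ hφf
  omega

/-- If part of a minimal system of generators of a prime ideal `I` lies in an ideal `(X)` that is
not contained in `I`, then the height of `I` is small. -/
theorem height_add_card_lt_of_separated [IsNoetherianRing R] (m I : Ideal R) [m.IsPrime] [I.IsPrime]
    (hm : ∀ x : R, ∃ c : k, x - algebraMap k R c ∈ m) (hIm : I ≤ m) (g : κ → R)
    (hg : Ideal.span (Set.range g) = I) (f : ι → R) (hf : ∀ i, f i ∈ I) (φ : ι → R →ₗ[k] k)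
    (hφ : ∀ i, ∀ x ∈ m * I, φ i x = 0) (hφf : ∀ i j, φ i (f j) = if i = j then 1 else 0)
    (X : Finset R) (hXm : ∀ x ∈ X, x ∈ m) (hfX : ∀ i, f i ∈ Ideal.span (X : Set R))
    (hXI : ∃ x ∈ X, x ∉ I) :
    I.height + 1 + Fintype.card ι ≤ X.card + Fintype.card κ := by
  classical
  obtain ⟨S, hS, hle⟩ := exists_finset_le_sup_mul m I hm g hg f hf φ hφ hφf
  have hgI : ∀ j, g j ∈ I := fun j => hg ▸ Ideal.subset_span ⟨j, rfl⟩
  -- Nakayama without localizing: some `r ≡ 1` modulo `m` carries `I` into the ideal of the new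
  -- generators. A prime `Q ≤ m` does not contain `r`, so it contains `I` as soon as it contains
  -- those generators.
  obtain ⟨r, hr, hrI⟩ := Submodule.exists_sub_one_mem_and_smul_le_of_fg_of_le_sup
    (IsNoetherian.noetherian I) le_rfl hle
  let Y : Finset R := X ∪ S.image g
  have hYm : Ideal.span (Y : Set R) ≤ m := by
    rw [Ideal.span_le]
    intro x hx
    rcases Finset.mem_union.1 hx with h | h
    · exact hXm x h
    · obtain ⟨j, -, rfl⟩ := Finset.mem_image.1 h
      exact hIm (hgI j)
  obtain ⟨Q, hQ, hQm⟩ := Ideal.exists_minimalPrimes_le hYm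
  have hQp : Q.IsPrime := hQ.1.1
  have hYQ : Ideal.span (Y : Set R) ≤ Q := hQ.1.2
  have hJQ : Ideal.span (Set.range f ∪ g '' S) ≤ Q := by
    refine le_trans ?_ hYQ
    rw [Ideal.span_le]
    rintro x (⟨i, rfl⟩ | ⟨j, hj, rfl⟩)
    · exact Ideal.span_mono (by intro x hx; exact Finset.mem_union_left _ hx) (hfX i)
    · exact Ideal.subset_span (Finset.mem_union_right _ (Finset.mem_image_of_mem _ hj))
  have hrm : r ∉ m := by
    intro h
    have h1 : (1 : R) ∈ m := by
      have := m.sub_mem h hr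
      simpa using this
    exact ‹m.IsPrime›.ne_top ((Ideal.eq_top_iff_one m).2 h1)
  have hIQ : I ≤ Q := by
    intro x hx
    have h1 : r * x ∈ Q := hJQ (hrI (Submodule.smul_mem_pointwise_smul x r I hx))
    exact (hQp.mem_or_mem h1).resolve_left fun h => hrm (hQm h)
  -- `Q` is minimal over the elements of `Y`, so Krull bounds its height by `Y.card`; being strictly
  -- larger than `I`, it forces `I` to have smaller height still.
  have hlt : I < Q := by
    refine lt_of_le_of_ne hIQ ?_
    rintro rfl
    obtain ⟨x, hx, hxI⟩ := hXI
    exact hxI (hYQ (Ideal.subset_span (Finset.mem_union_left _ hx)))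
  have h1 : I.height + 1 ≤ Q.height := Ideal.height_add_one_le_of_lt_of_isPrime hlt
  have h2 : Q.height ≤ Y.card := Ideal.height_le_card_of_mem_minimalPrimes_span_finset hQ
  have h3 : Y.card ≤ X.card + S.card :=
    (Finset.card_union_le _ _).trans (Nat.add_le_add_left Finset.card_image_le _)
  calc I.height + 1 + Fintype.card ι ≤ (Y.card : ℕ∞) + Fintype.card ι := by
        gcongr; exact h1.trans h2
    _ ≤ X.card + Fintype.card κ := by
        norm_cast; omega

end Exchange

end ToricCI

/-! ### Toric ideals as kernels of monomial maps, and functionals on `I / m I`. -/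

noncomputable section

namespace ToricCI

open MvPolynomial

section MonoKer

variable (k : Type*) [Field k] {σ ι : Type*}

/-- The degree of a monomial, where `xᵢ` has degree `u i`. -/
abbrev expDeg (u : σ → ι →₀ ℕ) : (σ →₀ ℕ) →ₗ[ℕ] (ι →₀ ℕ) := Finsupp.linearCombination ℕ u

/-- The homomorphism `xᵢ ↦ t ^ (u i)`. -/
abbrev monoHom (u : σ → ι →₀ ℕ) : MvPolynomial σ k →ₐ[k] MvPolynomial ι k :=
  aeval fun i => monomial (u i) (1 : k)

/-- The kernel of the homomorphism `xᵢ ↦ t ^ (u i)`. -/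
abbrev monoKer (u : σ → ι →₀ ℕ) : Ideal (MvPolynomial σ k) := RingHom.ker (monoHom k u)

variable {k}

theorem monoHom_monomial (u : σ → ι →₀ ℕ) (α : σ →₀ ℕ) (c : k) :
    monoHom k u (monomial α c) = monomial (expDeg u α) c := by
  rw [aeval_monomial, Finsupp.linearCombination_apply, monomial_finsupp_sum_index]
  simp [monomial_pow, algebraMap_eq]

instance isPrime_monoKer (u : σ → ι →₀ ℕ) : (monoKer k u).IsPrime := RingHom.ker_isPrime _

theorem binomial_mem_monoKer_iff (u : σ → ι →₀ ℕ) (α β : σ →₀ ℕ) :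
    monomial α 1 - monomial β 1 ∈ monoKer k u ↔ expDeg u α = expDeg u β := by
  rw [RingHom.mem_ker, map_sub, sub_eq_zero, monoHom_monomial, monoHom_monomial,
    monomial_eq_monomial_iff]
  simp

/-- An ideal containing the binomials of the toric ideal contains the toric ideal. -/
theorem monoKer_le_of_forall_binomial (u : σ → ι →₀ ℕ) (J : Ideal (MvPolynomial σ k))
    (hJ : ∀ α β, expDeg u α = expDeg u β → monomial α 1 - monomial β 1 ∈ J) :
    monoKer k u ≤ J := by
  classical
  -- Choose one monomial in each degree. Modulo `J` every monomial equals the chosen one of its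
  -- degree, so the quotient map by `J` factors linearly through `monoHom`.
  let s : (ι →₀ ℕ) → MvPolynomial σ k ⧸ J := fun δ =>
    Ideal.Quotient.mk J (monomial (Function.invFun (expDeg u) δ) 1)
  let ρ : MvPolynomial ι k →ₗ[k] MvPolynomial σ k ⧸ J := (basisMonomials ι k).constr k s
  have h : ρ ∘ₗ (monoHom k u).toLinearMap = (Ideal.Quotient.mkₐ k J).toLinearMap := by
    refine (basisMonomials σ k).ext fun α => ?_
    have h1 : ρ (monomial (expDeg u α) 1) = s (expDeg u α) := by
      have := (basisMonomials ι k).constr_basis k s (expDeg u α)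
      simpa using this
    simp only [LinearMap.comp_apply, AlgHom.toLinearMap_apply, coe_basisMonomials,
      monoHom_monomial, h1]
    refine Ideal.Quotient.eq.2 (hJ _ _ ?_)
    exact Function.invFun_eq (f := expDeg u) ⟨α, rfl⟩
  intro f hf
  rw [← Ideal.Quotient.eq_zero_iff_mem]
  have h2 := LinearMap.congr_fun h f
  simp only [LinearMap.comp_apply, AlgHom.toLinearMap_apply] at h2
  rw [RingHom.mem_ker.1 hf, map_zero] at h2
  exact h2.symm

theorem monoKer_eq_span (u : σ → ι →₀ ℕ) :
    monoKer k u = Ideal.span {p | ∃ α β, expDeg u α = expDeg u β ∧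
      p = monomial α 1 - monomial β 1} := by
  refine le_antisymm (monoKer_le_of_forall_binomial u _ fun α β h =>
    Ideal.subset_span ⟨α, β, h, rfl⟩) ?_
  rw [Ideal.span_le]
  rintro _ ⟨α, β, h, rfl⟩
  exact (binomial_mem_monoKer_iff u α β).2 h

theorem monoKer_le_monoKer {ι' : Type*} (u : σ → ι →₀ ℕ) (u' : σ → ι' →₀ ℕ)
    (h : ∀ α β, expDeg u α = expDeg u β → expDeg u' α = expDeg u' β) :
    monoKer k u ≤ monoKer k u' :=
  monoKer_le_of_forall_binomial u _ fun α β hαβ =>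
    (binomial_mem_monoKer_iff u' α β).2 (h α β hαβ)

/-- The sum of the coefficients of the monomials in `C`. -/
def sumOn (C : Set (σ →₀ ℕ)) : MvPolynomial σ k →ₗ[k] k := by
  classical
  exact (basisMonomials σ k).constr k fun α => if α ∈ C then 1 else 0

open Classical in
theorem sumOn_monomial (C : Set (σ →₀ ℕ)) (α : σ →₀ ℕ) (c : k) :
    sumOn C (monomial α c) = if α ∈ C then c else 0 := by
  have h : monomial α c = c • (basisMonomials σ k) α := by simp [smul_monomial]
  rw [h, map_smul, sumOn, Module.Basis.constr_basis]
  split_ifs <;> simp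

/-- `C` is a union of connected components of the fibers of the degree map, where two monomials
of the same degree are adjacent if they have a variable in common. -/
def IsShareClosed (u : σ → ι →₀ ℕ) (C : Set (σ →₀ ℕ)) : Prop :=
  ∀ α ∈ C, ∀ β, expDeg u α = expDeg u β → (∃ i, α i ≠ 0 ∧ β i ≠ 0) → β ∈ C

/-- Once a binomial of the toric ideal is multiplied by a variable, its two terms share that
variable; they lie both inside or both outside `C`, and their coefficients cancel. -/
theorem sumOn_eq_zero_of_mem_mul (u : σ → ι →₀ ℕ) (C : Set (σ →₀ ℕ)) (hC : IsShareClosed u C) :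
    ∀ x ∈ idealOfVars σ k * monoKer k u, sumOn C x = 0 := by
  classical
  have h1 : ∀ b ∈ monoKer k u, ∀ i, ∀ a, sumOn C (a * X i * b) = 0 := by
    intro b hb i
    rw [monoKer_eq_span] at hb
    induction hb using Submodule.span_induction with
    | zero => simp
    | add x y _ _ hx hy => intro a; rw [mul_add, map_add, hx, hy, add_zero]
    | smul c x _ hx =>
      intro a
      have : a * X i * c • x = (a * c) * X i * x := by rw [smul_eq_mul]; ring
      rw [this, hx]
    | mem x hx =>
      obtain ⟨α, β, h, rfl⟩ := hx
      intro a
      induction a using MvPolynomial.induction_on' with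
      | add p q hp hq => rw [add_mul, add_mul, map_add, hp, hq, add_zero]
      | monomial γ c =>
        have h3 : ∀ δ : σ →₀ ℕ, (monomial γ c * X i * monomial δ 1 : MvPolynomial σ k)
            = monomial (γ + Finsupp.single i 1 + δ) c := by
          intro δ
          rw [X, monomial_mul, monomial_mul]; simp
        rw [mul_sub, map_sub, h3, h3, sumOn_monomial, sumOn_monomial, sub_eq_zero]
        have h4 : ∀ α β : σ →₀ ℕ, expDeg u α = expDeg u β →
            γ + Finsupp.single i 1 + α ∈ C → γ + Finsupp.single i 1 + β ∈ C := by
          intro α β h hα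
          refine hC _ hα _ (by rw [map_add, map_add _ _ β, h]) ⟨i, ?_, ?_⟩ <;> simp
        have h5 : γ + Finsupp.single i 1 + α ∈ C ↔ γ + Finsupp.single i 1 + β ∈ C :=
          ⟨h4 _ _ h, h4 _ _ h.symm⟩
        simp [h5]
  have h2 : ∀ a ∈ idealOfVars σ k, ∀ b ∈ monoKer k u, sumOn C (a * b) = 0 := by
    intro a ha
    rw [idealOfVars] at ha
    induction ha using Submodule.span_induction with
    | zero => simp
    | add x y _ _ hx hy => intro b hb; rw [add_mul, map_add, hx b hb, hy b hb, add_zero]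
    | smul c x _ hx =>
      intro b hb
      have : c • x * b = x * (c * b) := by rw [smul_eq_mul]; ring
      rw [this, hx _ (Ideal.mul_mem_left _ _ hb)]
    | mem x hx =>
      obtain ⟨i, rfl⟩ := hx
      intro b hb
      simpa using h1 b hb i 1
  intro x hx
  induction hx using Submodule.mul_induction_on' with
  | mem_mul_mem m hm n hn => exact h2 m hm n hn
  | add x _ y _ hx hy => rw [map_add, hx, hy, add_zero]

theorem exists_sub_algebraMap_mem_idealOfVars (x : MvPolynomial σ k) :
    ∃ c : k, x - algebraMap k _ c ∈ idealOfVars σ k := by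
  induction x using MvPolynomial.induction_on with
  | C a => exact ⟨a, by simp [algebraMap_eq]⟩
  | add p q hp hq =>
    obtain ⟨c, hc⟩ := hp
    obtain ⟨d, hd⟩ := hq
    refine ⟨c + d, ?_⟩
    have : p + q - algebraMap k (MvPolynomial σ k) (c + d)
        = (p - algebraMap k _ c) + (q - algebraMap k _ d) := by rw [map_add]; ring
    rw [this]
    exact add_mem hc hd
  | mul_X p i _ =>
    refine ⟨0, ?_⟩
    rw [map_zero, sub_zero]
    exact Ideal.mul_mem_left _ _ (Ideal.subset_span ⟨i, rfl⟩)

theorem idealOfVars_eq_ker : idealOfVars σ k = RingHom.ker (constantCoeff (R := k) (σ := σ)) := by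
  refine le_antisymm ?_ fun x hx => ?_
  · rw [idealOfVars, Ideal.span_le]
    rintro _ ⟨i, rfl⟩
    simp [RingHom.mem_ker]
  · obtain ⟨c, hc⟩ := exists_sub_algebraMap_mem_idealOfVars x
    have h1 : idealOfVars σ k ≤ RingHom.ker (constantCoeff (R := k) (σ := σ)) := by
      rw [idealOfVars, Ideal.span_le]
      rintro _ ⟨i, rfl⟩
      simp [RingHom.mem_ker]
    have h2 := h1 hc
    rw [RingHom.mem_ker, map_sub, RingHom.mem_ker.1 hx, zero_sub, neg_eq_zero, algebraMap_eq,
      constantCoeff_C] at h2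
    simpa [h2] using hc

instance isPrime_idealOfVars : (idealOfVars σ k).IsPrime := by
  rw [idealOfVars_eq_ker]
  exact RingHom.ker_isPrime _

end MonoKer

/-! ### The height of the ideal of a projective monomial curve. -/

section Curve

variable {k : Type*} [Field k] {σ : Type*}

/-- The degrees of the variables of a projective monomial curve: `xᵢ ↦ s t ^ (δ i)`. -/
def curveDeg (δ : σ → ℕ) (i : σ) : Fin 2 →₀ ℕ := Finsupp.single 0 1 + Finsupp.single 1 (δ i)

theorem sum_single_mul [Fintype σ] (j : σ) (c : ℕ) (g : σ → ℕ) :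
    ∑ i, Finsupp.single j c i * g i = c * g j := by
  classical
  simp [Finsupp.single_apply]

theorem sum_single [Fintype σ] (j : σ) (c : ℕ) : ∑ i, Finsupp.single j c i = c := by
  classical
  simp [Finsupp.single_apply]

theorem expDeg_curveDeg_zero [Fintype σ] (δ : σ → ℕ) (α : σ →₀ ℕ) :
    expDeg (curveDeg δ) α 0 = ∑ i, α i := by
  rw [Finsupp.linearCombination_apply, Finsupp.sum_fintype _ _ (by simp), Finsupp.finsetSum_apply]
  simp [curveDeg]

theorem expDeg_curveDeg_one [Fintype σ] (δ : σ → ℕ) (α : σ →₀ ℕ) :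
    expDeg (curveDeg δ) α 1 = ∑ i, α i * δ i := by
  rw [Finsupp.linearCombination_apply, Finsupp.sum_fintype _ _ (by simp), Finsupp.finsetSum_apply]
  simp [curveDeg]

theorem expDeg_curveDeg_eq_iff [Fintype σ] (δ : σ → ℕ) (α β : σ →₀ ℕ) :
    expDeg (curveDeg δ) α = expDeg (curveDeg δ) β ↔
      ∑ i, α i = ∑ i, β i ∧ ∑ i, α i * δ i = ∑ i, β i * δ i := by
  rw [Finsupp.ext_iff, Fin.forall_fin_two, expDeg_curveDeg_zero, expDeg_curveDeg_zero,
    expDeg_curveDeg_one, expDeg_curveDeg_one]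

variable [Fintype σ]

theorem monoKer_curveDeg_le_idealOfVars (δ : σ → ℕ) :
    monoKer k (curveDeg δ) ≤ idealOfVars σ k := by
  refine monoKer_le_of_forall_binomial _ _ fun α β h => ?_
  rw [expDeg_curveDeg_eq_iff] at h
  rw [idealOfVars_eq_ker, RingHom.mem_ker, map_sub]
  have h0 : ∀ α : σ →₀ ℕ, 0 = α ↔ ∑ i, α i = 0 := by
    intro α
    rw [eq_comm, Finset.sum_eq_zero_iff, Finsupp.ext_iff]
    simp
  classical
  simp only [constantCoeff_monomial]
  have h1 : α = 0 ↔ β = 0 := by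
    rw [eq_comm, h0, eq_comm (a := β), h0, h.1]
  simp [h1]

/-- Setting `t = 0` gives a prime `P` strictly between the toric ideal and the ideal of all
variables: `X p` lies in `P` but not in the toric ideal, and `X y` does not lie in `P`. The whole
ring has dimension `Fintype.card σ`. -/
theorem height_monoKer_curveDeg_le (δ : σ → ℕ) (y p : σ) (hy : δ y = 0) (hp : δ p ≠ 0) :
    (monoKer k (curveDeg δ)).height + 2 ≤ Fintype.card σ := by
  let ψ : MvPolynomial (Fin 2) k →ₐ[k] Polynomial k := aeval ![Polynomial.X, 0]
  let P : Ideal (MvPolynomial σ k) := RingHom.ker (ψ.comp (monoHom k (curveDeg δ)))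
  have hP : P.IsPrime := RingHom.ker_isPrime _
  have hX : ∀ i, ψ.comp (monoHom k (curveDeg δ)) (X i) = Polynomial.X * 0 ^ δ i := by
    intro i
    rw [AlgHom.comp_apply, aeval_X, aeval_monomial, curveDeg]
    rw [Finsupp.prod_fintype _ _ (by simp)]
    simp
  have hIP : monoKer k (curveDeg δ) < P := by
    refine lt_of_le_of_ne (fun x hx => ?_) fun h => ?_
    · rw [RingHom.mem_ker, AlgHom.comp_apply, RingHom.mem_ker.1 hx, map_zero]
    · have h1 : X p ∈ P := by rw [RingHom.mem_ker, hX]; simp [hp]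
      rw [← h, RingHom.mem_ker, aeval_X, monomial_eq_zero] at h1
      exact one_ne_zero h1
  have hPm : P < idealOfVars σ k := by
    refine lt_of_le_of_ne (fun x hx => ?_) fun h => ?_
    · rw [idealOfVars_eq_ker]
      have h1 : ((Polynomial.aeval (0 : k)).comp (ψ.comp (monoHom k (curveDeg δ)))) =
          (aeval (fun _ => (0 : k)) : MvPolynomial σ k →ₐ[k] k) := by
        refine algHom_ext fun i => ?_
        rw [AlgHom.comp_apply, hX]
        simp
      have h2 := AlgHom.congr_fun h1 x
      rw [AlgHom.comp_apply, RingHom.mem_ker.1 hx, map_zero] at h2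
      have h3 := aeval_zero' (S₁ := k) (σ := σ) x
      rw [← h2] at h3
      rw [RingHom.mem_ker]
      simpa using h3.symm
    · have h1 : X y ∈ P := by rw [h]; exact Ideal.subset_span ⟨y, rfl⟩
      rw [RingHom.mem_ker, hX, hy] at h1
      simp at h1
  have h1 := Ideal.height_add_one_le_of_lt_of_isPrime hIP
  have h2 := Ideal.height_add_one_le_of_lt_of_isPrime hPm
  have h3 := Ideal.height_le_ringKrullDim_of_isPrime (I := idealOfVars σ k)
  rw [MvPolynomial.ringKrullDim_of_isNoetherianRing, ringKrullDim_eq_zero_of_field, zero_add,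
    Nat.card_eq_fintype_card] at h3
  have h4 : (idealOfVars σ k).height ≤ (Fintype.card σ : ℕ∞) := by exact_mod_cast h3
  calc (monoKer k (curveDeg δ)).height + 2 = (monoKer k (curveDeg δ)).height + 1 + 1 := by
        rw [add_assoc]; rfl
    _ ≤ P.height + 1 := by gcongr
    _ ≤ _ := h2
    _ ≤ _ := h4

/-- The grading of `curveDeg` refined by the degrees in the variables of `S`. -/
def refinedDeg [DecidableEq σ] (δ : σ → ℕ) (S : Finset σ) (i : σ) : Fin 2 ⊕ σ →₀ ℕ :=
  (curveDeg δ i).mapDomain Sum.inl + if i ∈ S then Finsupp.single (Sum.inr i) 1 else 0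

theorem expDeg_refinedDeg_eq_iff [DecidableEq σ] (δ : σ → ℕ) (S : Finset σ) (α β : σ →₀ ℕ) :
    expDeg (refinedDeg δ S) α = expDeg (refinedDeg δ S) β ↔
      expDeg (curveDeg δ) α = expDeg (curveDeg δ) β ∧ ∀ i ∈ S, α i = β i := by
  have h1 : ∀ (α : σ →₀ ℕ) (j : Fin 2),
      expDeg (refinedDeg δ S) α (Sum.inl j) = expDeg (curveDeg δ) α j := by
    intro α j
    rw [Finsupp.linearCombination_apply, Finsupp.linearCombination_apply,
      Finsupp.sum_fintype _ _ (by simp), Finsupp.sum_fintype _ _ (by simp),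
      Finsupp.finsetSum_apply, Finsupp.finsetSum_apply]
    refine Finset.sum_congr rfl fun i _ => ?_
    rw [Finsupp.smul_apply, Finsupp.smul_apply, refinedDeg, Finsupp.add_apply,
      Finsupp.mapDomain_apply Sum.inl_injective]
    split_ifs <;> simp
  have h2 : ∀ (α : σ →₀ ℕ) (j : σ),
      expDeg (refinedDeg δ S) α (Sum.inr j) = if j ∈ S then α j else 0 := by
    intro α j
    rw [Finsupp.linearCombination_apply, Finsupp.sum_fintype _ _ (by simp),
      Finsupp.finsetSum_apply]
    have h3 : ∀ i, (α i • refinedDeg δ S i) (Sum.inr j) =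
        if i = j then (if j ∈ S then α j else 0) else 0 := by
      intro i
      rw [Finsupp.smul_apply, refinedDeg, Finsupp.add_apply, Finsupp.mapDomain_of_notMem_range _ _
        (by simp)]
      by_cases hij : i = j
      · subst hij; split_ifs <;> simp_all
      · split_ifs <;> simp [hij]
    rw [Finset.sum_congr rfl fun i _ => h3 i]
    simp
  rw [Finsupp.ext_iff, Finsupp.ext_iff]
  constructor
  · intro h
    refine ⟨fun j => by rw [← h1, ← h1, h], fun i hi => ?_⟩
    have := h (Sum.inr i)
    simpa [h2, hi] using this
  · rintro ⟨h, h'⟩ (j | j)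
    · rw [h1, h1, h]
    · rw [h2, h2]
      split_ifs with hj
      · exact h' j hj
      · rfl

/-- Let the grading remember the exponents of all variables except `y` and `p`, then forget them one
at a time. This gives a chain of primes; when `j` is forgotten, the new element is `x_j ^ δ p - x_p
^ δ j * y ^ (δ p - δ j)`. -/
theorem le_height_monoKer_curveDeg (δ : σ → ℕ) (y p : σ) (hy : δ y = 0) (hp : δ p ≠ 0)
    (hmax : ∀ i, δ i ≤ δ p) :
    (Fintype.card σ : ℕ∞) ≤ (monoKer k (curveDeg δ)).height + 2 := by
  classical
  have hyp : y ≠ p := by rintro rfl; exact hp hy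
  let N : Finset σ := Finset.univ \ {y, p}
  have hN : N.card + 2 = Fintype.card σ := by
    have := Finset.card_sdiff_add_card_eq_card (Finset.subset_univ ({y, p} : Finset σ))
    rwa [Finset.card_pair hyp] at this
  have key : ∀ S : Finset σ, S ⊆ N → (S.card : ℕ∞) ≤ (monoKer k (refinedDeg δ (N \ S))).height := by
    intro S
    induction S using Finset.induction_on with
    | empty => simp
    | insert j S hj ih =>
      intro hS
      have ih' := ih ((Finset.subset_insert _ _).trans hS)
      have hjN : j ∈ N := hS (Finset.mem_insert_self _ _)
      have hjy : j ≠ y ∧ j ≠ p := by simpa [N] using hjN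
      have hlt : monoKer k (refinedDeg δ (N \ S)) < monoKer k (refinedDeg δ (N \ insert j S)) := by
        refine lt_of_le_of_ne (monoKer_le_monoKer _ _ fun α β h => ?_) fun h => ?_
        · rw [expDeg_refinedDeg_eq_iff] at h ⊢
          exact ⟨h.1, fun i hi => h.2 i (Finset.sdiff_subset_sdiff le_rfl
            (Finset.subset_insert _ _) hi)⟩
        · let α : σ →₀ ℕ := Finsupp.single j (δ p)
          let β : σ →₀ ℕ := Finsupp.single p (δ j) + Finsupp.single y (δ p - δ j)
          have h1 : (monomial α 1 - monomial β 1 : MvPolynomial σ k) ∈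
              monoKer k (refinedDeg δ (N \ insert j S)) := by
            rw [binomial_mem_monoKer_iff, expDeg_refinedDeg_eq_iff, expDeg_curveDeg_eq_iff]
            refine ⟨⟨?_, ?_⟩, fun i hi => ?_⟩
            · simp only [α, β, Finsupp.add_apply, Finset.sum_add_distrib, sum_single]
              have := hmax j
              omega
            · simp only [α, β, Finsupp.add_apply, add_mul, Finset.sum_add_distrib,
                sum_single_mul, hy, mul_zero, add_zero]
              exact Nat.mul_comm _ _
            · have : i ≠ j ∧ i ≠ y ∧ i ≠ p := by
                simp [N] at hi; tauto
              simp [α, β, this.1.symm, this.2.1.symm, this.2.2.symm]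
          rw [← h, binomial_mem_monoKer_iff, expDeg_refinedDeg_eq_iff] at h1
          have h2 := h1.2 j (by simp [hjN, hj])
          simp [α, β, hjy.1.symm, hjy.2.symm] at h2
          exact hp h2
      have h1 := Ideal.height_add_one_le_of_lt_of_isPrime hlt
      rw [Finset.card_insert_of_notMem hj]
      push_cast
      exact (add_le_add_left ih' 1).trans h1
  have h1 := key N le_rfl
  have h2 : monoKer k (refinedDeg δ (N \ N)) ≤ monoKer k (curveDeg δ) :=
    monoKer_le_monoKer _ _ fun α β h => ((expDeg_refinedDeg_eq_iff _ _ _ _).1 h).1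
  rw [← hN]
  push_cast
  exact add_le_add_left (h1.trans (Ideal.height_mono h2)) 2

end Curve

end ToricCI

end

/-! ### Critical exponents and what a complete intersection implies for them. -/

noncomputable section

namespace ToricCI

open MvPolynomial

section Critical

variable {σ : Type*}

/-- Two monomials of a projective monomial curve have the same degree. -/
def SameDeg (δ : σ → ℕ) (α β : σ →₀ ℕ) : Prop :=
  expDeg (curveDeg δ) α = expDeg (curveDeg δ) β

theorem SameDeg.symm {δ : σ → ℕ} {α β : σ →₀ ℕ} (h : SameDeg δ α β) : SameDeg δ β α := Eq.symm h

theorem SameDeg.trans {δ : σ → ℕ} {α β γ : σ →₀ ℕ} (h : SameDeg δ α β) (h' : SameDeg δ β γ) :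
    SameDeg δ α γ := Eq.trans h h'

theorem sameDeg_add_left_iff {δ : σ → ℕ} {α β γ : σ →₀ ℕ} :
    SameDeg δ (γ + α) (γ + β) ↔ SameDeg δ α β := by
  rw [SameDeg, SameDeg, map_add, map_add, add_right_inj]

theorem sameDeg_iff [Fintype σ] {δ : σ → ℕ} {α β : σ →₀ ℕ} : SameDeg δ α β ↔
    ∑ i, α i = ∑ i, β i ∧ ∑ i, α i * δ i = ∑ i, β i * δ i :=
  expDeg_curveDeg_eq_iff δ α β

/-- The least positive `c` such that `xᵢ ^ c` has the degree of a monomial without `xᵢ`. -/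
def crit (δ : σ → ℕ) (i : σ) : ℕ :=
  sInf {c | 0 < c ∧ ∃ M : σ →₀ ℕ, M i = 0 ∧ SameDeg δ (Finsupp.single i c) M}

theorem crit_le {δ : σ → ℕ} {i : σ} {c : ℕ} (hc : 0 < c) {M : σ →₀ ℕ} (hM : M i = 0)
    (h : SameDeg δ (Finsupp.single i c) M) : crit δ i ≤ c :=
  Nat.sInf_le ⟨hc, M, hM, h⟩

/-- The standing hypotheses: the weights are distinct, `y` has weight zero and `p` has the
largest weight. -/
structure IsCurve (δ : σ → ℕ) (y p : σ) : Prop where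
  inj : Function.Injective δ
  zero : δ y = 0
  ne : δ p ≠ 0
  le : ∀ i, δ i ≤ δ p

variable {δ : σ → ℕ} {y p : σ}

/-- The set defining `crit` contains `δ p`, by `x_i ^ δ p = x_p ^ δ i * y ^ (δ p - δ i)`, so its
infimum is attained rather than the default `0`. -/
theorem crit_spec [Fintype σ] (h : IsCurve δ y p) {i : σ} (hy : i ≠ y) (hp : i ≠ p) :
    0 < crit δ i ∧ ∃ M : σ →₀ ℕ, M i = 0 ∧ SameDeg δ (Finsupp.single i (crit δ i)) M := by
  refine Nat.sInf_mem (s := {c | 0 < c ∧ ∃ M : σ →₀ ℕ, M i = 0 ∧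
    SameDeg δ (Finsupp.single i c) M}) ⟨δ p, Nat.pos_of_ne_zero h.ne,
    Finsupp.single p (δ i) + Finsupp.single y (δ p - δ i), ?_, ?_⟩
  · simp [hy.symm, hp.symm]
  · rw [sameDeg_iff]
    constructor
    · simp only [Finsupp.add_apply, Finset.sum_add_distrib, sum_single]
      have := h.le i
      omega
    · simp only [Finsupp.add_apply, add_mul, Finset.sum_add_distrib, sum_single_mul, h.zero,
        mul_zero, add_zero]
      exact Nat.mul_comm _ _

theorem eq_zero_of_sameDeg_zero [Fintype σ] {α : σ →₀ ℕ} (h : SameDeg δ 0 α) : α = 0 := by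
  have := (sameDeg_iff.1 h).1
  simp only [Finsupp.coe_zero, Pi.zero_apply, Finset.sum_const_zero] at this
  ext i
  exact Finset.sum_eq_zero_iff.1 this.symm i (Finset.mem_univ i)

/-- Cancelling the common power of `x_i` would leave a smaller admissible exponent. So the critical
power is alone in its connected component. -/
theorem apply_eq_zero_of_sameDeg_crit [Fintype σ] {i : σ} {M : σ →₀ ℕ}
    (hM : SameDeg δ (Finsupp.single i (crit δ i)) M) (hne : M ≠ Finsupp.single i (crit δ i)) :
    M i = 0 := by
  by_contra h0
  let M' := M.erase i
  have hMM : M = Finsupp.single i (M i) + M' := (Finsupp.single_add_erase i M).symm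
  have hle : M i ≤ crit δ i := by
    have h1 := (sameDeg_iff.1 hM).1
    rw [sum_single] at h1
    rw [h1]
    exact Finset.single_le_sum (f := fun j => M j) (fun _ _ => Nat.zero_le _) (Finset.mem_univ i)
  have h2 : SameDeg δ (Finsupp.single i (crit δ i - M i)) M' := by
    rw [← sameDeg_add_left_iff (γ := Finsupp.single i (M i)), ← hMM, ← Finsupp.single_add]
    rwa [Nat.add_sub_cancel' hle]
  rcases Nat.eq_zero_or_pos (crit δ i - M i) with h3 | h3
  · rw [h3, Finsupp.single_zero] at h2
    have h4 := eq_zero_of_sameDeg_zero h2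
    rw [h4, add_zero] at hMM
    have : M i = crit δ i := by omega
    rw [this] at hMM
    exact hne hMM
  · have := crit_le h3 (by simp [M']) h2
    omega

theorem eq_of_sameDeg_single [Fintype σ] (h : IsCurve δ y p) {i j : σ} {c c' : ℕ} (hc : 0 < c)
    (hij : SameDeg δ (Finsupp.single i c) (Finsupp.single j c')) : i = j := by
  have h1 := sameDeg_iff.1 hij
  rw [sum_single, sum_single, sum_single_mul, sum_single_mul] at h1
  obtain ⟨rfl, h2⟩ := h1
  exact h.inj (Nat.eq_of_mul_eq_mul_left hc h2)

/-- Two monomials of the same degree have a variable in common. -/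
def ShareStep (δ : σ → ℕ) (α β : σ →₀ ℕ) : Prop := SameDeg δ α β ∧ ∃ i, α i ≠ 0 ∧ β i ≠ 0

/-- Two monomials are connected by steps that keep a variable. -/
abbrev Conn (δ : σ → ℕ) : (σ →₀ ℕ) → (σ →₀ ℕ) → Prop := Relation.ReflTransGen (ShareStep δ)

theorem Conn.sameDeg {α β : σ →₀ ℕ} (h : Conn δ α β) : SameDeg δ α β := by
  induction h with
  | refl => rfl
  | tail _ h1 ih => exact ih.trans h1.1

theorem Conn.symm {α β : σ →₀ ℕ} (h : Conn δ α β) : Conn δ β α := by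
  induction h with
  | refl => exact Relation.ReflTransGen.refl
  | tail _ h1 ih =>
    obtain ⟨h2, i, h3, h4⟩ := h1
    exact Relation.ReflTransGen.head ⟨h2.symm, i, h4, h3⟩ ih

theorem isShareClosed_conn (α : σ →₀ ℕ) : IsShareClosed (curveDeg δ) {γ | Conn δ α γ} :=
  fun _ hβ _ h h' => Relation.ReflTransGen.tail hβ ⟨h, h'⟩

theorem isShareClosed_single [Fintype σ] (i : σ) :
    IsShareClosed (curveDeg δ) {Finsupp.single i (crit δ i)} := by
  rintro _ rfl β h ⟨j, hj, hβ⟩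
  rw [Set.mem_singleton_iff]
  by_contra hne
  have hij : i = j := by
    by_contra hij
    simp [hij] at hj
  subst hij
  exact hβ (apply_eq_zero_of_sameDeg_crit h hne)

theorem eq_of_conn_single [Fintype σ] {i : σ} {α : σ →₀ ℕ}
    (h : Conn δ (Finsupp.single i (crit δ i)) α) : α = Finsupp.single i (crit δ i) := by
  induction h with
  | refl => rfl
  | tail _ h1 ih =>
    subst ih
    exact isShareClosed_single i _ rfl _ h1.1 h1.2

variable {k : Type*} [Field k]

theorem monomial_mem_span_X {α : σ →₀ ℕ} {j : σ} (hj : α j ≠ 0) (X' : Set (MvPolynomial σ k))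
    (hX : X j ∈ X') : monomial α 1 ∈ Ideal.span X' := by
  have h1 : α = (α - Finsupp.single j 1) + Finsupp.single j 1 := by
    rw [tsub_add_cancel_of_le]
    rw [Finsupp.single_le_iff]
    omega
  have h2 : (monomial α 1 : MvPolynomial σ k) = monomial (α - Finsupp.single j 1) 1 * X j := by
    conv_lhs => rw [h1]
    rw [X, monomial_mul, one_mul]
  rw [h2]
  exact Ideal.mul_mem_left _ _ (Ideal.subset_span hX)

variable (k) in
/-- The toric ideal of the curve has as many generators as its height. -/
def HasCIGenerators (δ : σ → ℕ) : Prop :=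
  ∃ (r : ℕ) (g : Fin r → MvPolynomial σ k),
    Ideal.span (Set.range g) = monoKer k (curveDeg δ) ∧
      (r : ℕ∞) = (monoKer k (curveDeg δ)).height

-- Coefficients at critical powers are dual to the critical binomials: distinct weights prevent
-- powers of two different variables from having the same degree.
open Classical in
theorem sumOn_single_binomial [Fintype σ] (h : IsCurve δ y p) {i j : σ} (hj : 0 < crit δ j)
    {M : σ →₀ ℕ}
    (hM : SameDeg δ (Finsupp.single j (crit δ j)) M) (hne : M ≠ Finsupp.single j (crit δ j)) :
    sumOn {Finsupp.single i (crit δ i)}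
      (monomial (Finsupp.single j (crit δ j)) 1 - monomial M 1 : MvPolynomial σ k) =
      if i = j then 1 else 0 := by
  rw [map_sub, sumOn_monomial, sumOn_monomial]
  by_cases hij : i = j
  · subst hij
    simp [hne]
  · rw [if_neg, if_neg, if_neg hij, sub_zero]
    · rw [Set.mem_singleton_iff]
      rintro rfl
      exact hij (eq_of_sameDeg_single h hj hM).symm
    · rw [Set.mem_singleton_iff]
      intro h1
      have : SameDeg δ (Finsupp.single j (crit δ j)) (Finsupp.single i (crit δ i)) := by
        rw [h1]; rfl
      exact hij (eq_of_sameDeg_single h hj this).symm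

/-- If every `i ∈ T` had a critical binomial with a variable of `T` in its other term, these
binomials would lie in the ideal of the variables of `T`, which is not inside the toric ideal;
`height_add_card_lt_of_separated` would make the height smaller than `r`. -/
theorem exists_mem_forall_avoid [Fintype σ] (h : IsCurve δ y p) (hCI : HasCIGenerators k δ)
    (T : Finset σ)
    (hT : T.Nonempty) (hTi : ∀ i ∈ T, i ≠ y ∧ i ≠ p) :
    ∃ i ∈ T, ∀ M, SameDeg δ (Finsupp.single i (crit δ i)) M →
      M ≠ Finsupp.single i (crit δ i) → ∀ j ∈ T, M j = 0 := by
  classical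
  by_contra hcon
  push Not at hcon
  choose! M hM hne j hj hMj using hcon
  obtain ⟨r, g, hg, hr⟩ := hCI
  have hpos : ∀ i ∈ T, 0 < crit δ i := fun i hi => (crit_spec h (hTi i hi).1 (hTi i hi).2).1
  obtain ⟨i₀, hi₀⟩ := hT
  have key := height_add_card_lt_of_separated (k := k) (ι := T) (idealOfVars σ k)
    (monoKer k (curveDeg δ)) exists_sub_algebraMap_mem_idealOfVars
    (monoKer_curveDeg_le_idealOfVars δ) g hg
    (fun i => monomial (Finsupp.single i.1 (crit δ i.1)) 1 - monomial (M i.1) 1)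
    (fun i => (binomial_mem_monoKer_iff _ _ _).2 (hM i.1 i.2))
    (fun i => sumOn {Finsupp.single i.1 (crit δ i.1)})
    (fun i => sumOn_eq_zero_of_mem_mul _ _ (isShareClosed_single i.1))
    (fun i i' => by
      rw [sumOn_single_binomial h (hpos _ i'.2) (hM _ i'.2) (hne _ i'.2)]
      exact if_congr Subtype.ext_iff.symm rfl rfl)
    (T.image X)
    (fun x hx => by
      obtain ⟨i, -, rfl⟩ := Finset.mem_image.1 hx
      exact Ideal.subset_span ⟨i, rfl⟩)
    (fun i => by
      refine sub_mem (monomial_mem_span_X (j := i.1) ?_ _ ?_)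
        (monomial_mem_span_X (j := j i.1) (hMj _ i.2) _ ?_)
      · simp [(hpos _ i.2).ne']
      · exact Finset.mem_coe.2 (Finset.mem_image_of_mem _ i.2)
      · exact Finset.mem_coe.2 (Finset.mem_image_of_mem _ (hj _ i.2)))
    ⟨X i₀, Finset.mem_image_of_mem _ hi₀, fun h1 => by
      rw [RingHom.mem_ker, aeval_X, monomial_eq_zero] at h1
      exact one_ne_zero h1⟩
  rw [← hr, Fintype.card_coe, Fintype.card_fin] at key
  have h1 : (T.image (X : σ → MvPolynomial σ k)).card ≤ T.card := Finset.card_image_le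
  norm_cast at key
  omega

/-- Otherwise the binomial of `α`, `β` and one critical binomial for each variable except `y`, `p`
would be independent modulo `m I`. That is one generator more than the height permits. -/
theorem conn_or_eq_single [Fintype σ] (h : IsCurve δ y p) (hCI : HasCIGenerators k δ) {α β : σ →₀ ℕ}
    (hαβ : SameDeg δ α β) (hconn : ¬ Conn δ α β) :
    ∃ i, i ≠ y ∧ i ≠ p ∧ (α = Finsupp.single i (crit δ i) ∨ β = Finsupp.single i (crit δ i)) := by
  classical
  by_contra hcon
  push Not at hcon
  obtain ⟨r, g, hg, hr⟩ := hCI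
  let N := {i : σ // i ≠ y ∧ i ≠ p}
  have hspec : ∀ i : N, 0 < crit δ i.1 ∧ ∃ M : σ →₀ ℕ, M i.1 = 0 ∧
      SameDeg δ (Finsupp.single i.1 (crit δ i.1)) M := fun i => crit_spec h i.2.1 i.2.2
  choose hpos M₀ hM₀ hM₀' using hspec
  -- In the degree of `α` the second term must avoid the component of `α`, so `β` is taken there;
  -- then the functional of that component vanishes on every critical binomial.
  let M : N → σ →₀ ℕ := fun i =>
    if SameDeg δ (Finsupp.single i.1 (crit δ i.1)) α then β else M₀ i
  have hM : ∀ i : N, SameDeg δ (Finsupp.single i.1 (crit δ i.1)) (M i) := by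
    intro i
    by_cases h1 : SameDeg δ (Finsupp.single i.1 (crit δ i.1)) α
    · simp only [M, if_pos h1]; exact h1.trans hαβ
    · simp only [M, if_neg h1]; exact hM₀' i
  have hne : ∀ i : N, M i ≠ Finsupp.single i.1 (crit δ i.1) := by
    intro i
    by_cases h1 : SameDeg δ (Finsupp.single i.1 (crit δ i.1)) α
    · simp only [M, if_pos h1]; exact (hcon i.1 i.2.1 i.2.2).2
    · simp only [M, if_neg h1]
      intro h2
      have h3 := hM₀ i
      rw [h2, Finsupp.single_eq_same] at h3
      exact (hpos i).ne' h3
  have h1 : ∀ i : N, ¬ Conn δ α (Finsupp.single i.1 (crit δ i.1)) := fun i hc =>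
    (hcon i.1 i.2.1 i.2.2).1 (eq_of_conn_single hc.symm)
  have h2 : ∀ i : N, ¬ Conn δ α (M i) := by
    intro i hc
    by_cases h1 : SameDeg δ (Finsupp.single i.1 (crit δ i.1)) α
    · simp only [M, if_pos h1] at hc; exact hconn hc
    · exact h1 ((hM i).trans hc.sameDeg.symm)
  let f : Option N → MvPolynomial σ k := fun o => o.elim (monomial α 1 - monomial β 1)
    fun i => monomial (Finsupp.single i.1 (crit δ i.1)) 1 - monomial (M i) 1
  let φ : Option N → MvPolynomial σ k →ₗ[k] k := fun o => o.elim (sumOn {γ | Conn δ α γ})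
    fun i => sumOn {Finsupp.single i.1 (crit δ i.1)}
  have key := card_le_of_separated (k := k) (ι := Option N) (idealOfVars σ k)
    (monoKer k (curveDeg δ)) exists_sub_algebraMap_mem_idealOfVars g hg f
    (by
      rintro (_ | i)
      · exact (binomial_mem_monoKer_iff _ _ _).2 hαβ
      · exact (binomial_mem_monoKer_iff _ _ _).2 (hM i))
    φ
    (by
      rintro (_ | i)
      · exact sumOn_eq_zero_of_mem_mul _ _ (isShareClosed_conn α)
      · exact sumOn_eq_zero_of_mem_mul _ _ (isShareClosed_single i.1))
    (by
      rintro (_ | i) (_ | j)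
      · simp only [f, φ, Option.elim, map_sub, sumOn_monomial, Set.mem_ofPred_eq]
        rw [if_pos Relation.ReflTransGen.refl, if_neg hconn]
        simp
      · simp only [f, φ, Option.elim, map_sub, sumOn_monomial, Set.mem_ofPred_eq]
        rw [if_neg (h1 j), if_neg (h2 j)]
        simp
      · have h3 := hcon i.1 i.2.1 i.2.2
        simp only [f, φ, Option.elim, map_sub, sumOn_monomial, Set.mem_singleton_iff]
        rw [if_neg h3.1, if_neg h3.2]
        simp
      · simp only [f, φ, Option.elim]
        rw [sumOn_single_binomial h (hpos j) (hM j) (hne j)]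
        exact if_congr ((Option.some_inj.trans Subtype.ext_iff).symm) rfl rfl)
  have hyp : y ≠ p := by rintro rfl; exact h.ne h.zero
  have hN : Fintype.card N + 2 = Fintype.card σ := by
    have h3 : Fintype.card N = (Finset.univ \ {y, p} : Finset σ).card := by
      rw [Fintype.card_subtype]
      congr 1
      ext i
      simp
    have := Finset.card_sdiff_add_card_eq_card (Finset.subset_univ ({y, p} : Finset σ))
    rw [Finset.card_pair hyp] at this
    rw [h3, this]; rfl
  have h3 := height_monoKer_curveDeg_le (k := k) δ y p h.zero h.ne
  rw [← hr] at h3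
  norm_cast at h3
  rw [Fintype.card_option, Fintype.card_fin] at key
  omega

/-- A connection between different monomials yields, after cancelling a variable, different
monomials of the same degree. -/
theorem Conn.exists_cancel {α β : σ →₀ ℕ} (h : Conn δ α β) (hne : α ≠ β) :
    ∃ j α' β', α = Finsupp.single j 1 + α' ∧ SameDeg δ α' β' ∧ α' ≠ β' := by
  have h1 : ∃ γ, ShareStep δ α γ ∧ α ≠ γ := by
    by_contra hcon
    push Not at hcon
    have : ∀ γ, Conn δ α γ → α = γ := by
      intro γ hγ
      induction hγ with
      | refl => rfl
      | tail _ h1 ih => subst ih; exact hcon _ h1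
    exact hne (this β h)
  obtain ⟨γ, ⟨h2, j, hj, hγ⟩, hαγ⟩ := h1
  have h3 : ∀ γ : σ →₀ ℕ, γ j ≠ 0 → γ = Finsupp.single j 1 + (γ - Finsupp.single j 1) := by
    intro γ hγ
    rw [add_tsub_cancel_of_le]
    rw [Finsupp.single_le_iff]
    omega
  refine ⟨j, α - Finsupp.single j 1, γ - Finsupp.single j 1, h3 α hj, ?_, fun h4 => hαγ ?_⟩
  · rwa [← sameDeg_add_left_iff (γ := Finsupp.single j 1), ← h3 α hj, ← h3 γ hγ]
  · rw [h3 α hj, h3 γ hγ, h4]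

/-- Induction on the degree: a connected pair yields a smaller relation by cancelling a variable,
and in an unconnected pair one monomial is a critical power, whose degree `α` shares. -/
theorem exists_le_sameDeg_crit [Fintype σ] (h : IsCurve δ y p) (hCI : HasCIGenerators k δ)
    {α β : σ →₀ ℕ}
    (hαβ : SameDeg δ α β) (hne : α ≠ β) :
    ∃ i γ, i ≠ y ∧ i ≠ p ∧ γ ≤ α ∧ SameDeg δ (Finsupp.single i (crit δ i)) γ := by
  induction hn : ∑ i, α i using Nat.strong_induction_on generalizing α β with
  | _ n ih =>
    by_cases hc : Conn δ α β
    · obtain ⟨j, α', β', rfl, h1, h2⟩ := hc.exists_cancel hne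
      have h3 : ∑ i, α' i < n := by
        rw [← hn]
        simp only [Finsupp.add_apply, Finset.sum_add_distrib, sum_single]
        omega
      obtain ⟨i, γ, hy, hp, hle, hγ⟩ := ih _ h3 h1 h2 rfl
      exact ⟨i, γ, hy, hp, hle.trans (le_add_of_nonneg_left zero_le), hγ⟩
    · obtain ⟨i, hy, hp, rfl | rfl⟩ := conn_or_eq_single h hCI hαβ hc
      · exact ⟨i, _, hy, hp, le_rfl, rfl⟩
      · exact ⟨i, _, hy, hp, le_rfl, hαβ.symm⟩

/-- With pure powers excluded only the connected case occurs, and there a variable really is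
cancelled. -/
theorem exists_lt_sameDeg_crit [Fintype σ] (h : IsCurve δ y p) (hCI : HasCIGenerators k δ)
    {α β : σ →₀ ℕ}
    (hαβ : SameDeg δ α β) (hne : α ≠ β) (hα : ∀ i c, α ≠ Finsupp.single i c)
    (hβ : ∀ i c, β ≠ Finsupp.single i c) :
    ∃ i γ, i ≠ y ∧ i ≠ p ∧ γ < α ∧ SameDeg δ (Finsupp.single i (crit δ i)) γ := by
  by_cases hc : Conn δ α β
  · obtain ⟨j, α', β', rfl, h1, h2⟩ := hc.exists_cancel hne
    obtain ⟨i, γ, hy, hp, hle, hγ⟩ := exists_le_sameDeg_crit h hCI h1 h2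
    refine ⟨i, γ, hy, hp, hle.trans_lt ?_, hγ⟩
    refine lt_of_le_of_ne (le_add_of_nonneg_left zero_le) fun h3 => ?_
    have := DFunLike.congr_fun h3 j
    simp at this
  · obtain ⟨i, hy, hp, h1 | h1⟩ := conn_or_eq_single h hCI hαβ hc
    · exact absurd h1 (hα _ _)
    · exact absurd h1 (hβ _ _)

/-- The integer vector of the binomial `xᵢ ^ cᵢ - x ^ M`. -/
def critVec (δ : σ → ℕ) (i : σ) (M : σ →₀ ℕ) (j : σ) : ℤ :=
  (Finsupp.single i (crit δ i) j : ℤ) - M j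

/-- The critical binomials generate the lattice of relations. -/
theorem sub_mem_span_critVec [Fintype σ] (h : IsCurve δ y p) (hCI : HasCIGenerators k δ)
    (M : σ → σ →₀ ℕ)
    (hM : ∀ i, i ≠ y → i ≠ p → SameDeg δ (Finsupp.single i (crit δ i)) (M i) ∧
      M i ≠ Finsupp.single i (crit δ i)) {α β : σ →₀ ℕ} (hαβ : SameDeg δ α β) :
    (fun j => (α j : ℤ) - β j) ∈ Submodule.span ℤ
      (Set.range fun i : {i // i ≠ y ∧ i ≠ p} => critVec δ i.1 (M i.1)) := by
  set Λ := Submodule.span ℤ (Set.range fun i : {i // i ≠ y ∧ i ≠ p} => critVec δ i.1 (M i.1))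
  have htrans : ∀ α β γ : σ →₀ ℕ, (fun j => (α j : ℤ) - β j) ∈ Λ →
      (fun j => (β j : ℤ) - γ j) ∈ Λ → (fun j => (α j : ℤ) - γ j) ∈ Λ := by
    intro α β γ h1 h2
    convert! add_mem h1 h2 using 1
    ext j
    simp
  have hsymm : ∀ α β : σ →₀ ℕ, (fun j => (α j : ℤ) - β j) ∈ Λ →
      (fun j => (β j : ℤ) - α j) ∈ Λ := by
    intro α β h1
    convert! neg_mem h1 using 1
    ext j
    simp
  induction hn : ∑ i, α i using Nat.strong_induction_on generalizing α β with
  | _ n ih =>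
    -- Consecutive monomials of a connection share a variable; cancelling it leaves their difference
    -- unchanged and lowers the degree.
    have hconn : ∀ α β : σ →₀ ℕ, ∑ i, α i = n → Conn δ α β →
        (fun j => (α j : ℤ) - β j) ∈ Λ := by
      intro α β hα hc
      induction hc with
      | refl => simp only [sub_self]; exact zero_mem Λ
      | @tail b c hab hbc ih' =>
        refine htrans _ _ _ ih' ?_
        obtain ⟨h2, j, hj, hγ⟩ := hbc
        have h3 : ∀ γ : σ →₀ ℕ, γ j ≠ 0 →
            γ = Finsupp.single j 1 + (γ - Finsupp.single j 1) := by
          intro γ hγ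
          rw [add_tsub_cancel_of_le]
          rw [Finsupp.single_le_iff]
          omega
        have h4 : SameDeg δ (b - Finsupp.single j 1) (c - Finsupp.single j 1) := by
          rwa [← sameDeg_add_left_iff (γ := Finsupp.single j 1), ← h3 b hj, ← h3 c hγ]
        have h5 : ∑ i, (b - Finsupp.single j 1 : σ →₀ ℕ) i < n := by
          have h6 := (sameDeg_iff.1 (Conn.sameDeg hab)).1
          rw [h3 b hj] at h6
          simp only [Finsupp.add_apply, Finset.sum_add_distrib, sum_single] at h6
          omega
        have h6 := ih _ h5 h4 rfl
        convert! h6 using 1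
        ext i
        conv_lhs => rw [h3 b hj, h3 c hγ]
        simp only [Finsupp.add_apply]
        push_cast
        ring
    have hsingle : ∀ i : σ, i ≠ y → i ≠ p → ∀ β : σ →₀ ℕ, ∑ i, β i = n →
        SameDeg δ (Finsupp.single i (crit δ i)) β →
        (fun j => ((Finsupp.single i (crit δ i) : σ →₀ ℕ) j : ℤ) - β j) ∈ Λ := by
      intro i hy hp β hβn hβ
      by_cases hβ1 : β = Finsupp.single i (crit δ i)
      · rw [hβ1]; simp only [sub_self]; exact zero_mem Λ
      obtain ⟨hM1, hM2⟩ := hM i hy hp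
      refine htrans _ (M i) _ (Submodule.subset_span ⟨⟨i, hy, hp⟩, rfl⟩) ?_
      have hpos := (crit_spec h hy hp).1
      have hMβ := hM1.symm.trans hβ
      -- `M i` and `β` have the degree of `x_i ^ c_i` and are not critical powers themselves, so
      -- they are connected.
      refine hconn _ _ (by rw [(sameDeg_iff.1 hMβ).1, hβn]) ?_
      by_contra hc
      obtain ⟨l, hly, hlp, h1⟩ := conn_or_eq_single h hCI hMβ hc
      have hil : i = l := by
        rcases h1 with h1 | h1
        · exact eq_of_sameDeg_single h hpos (h1 ▸ hM1)
        · exact eq_of_sameDeg_single h hpos (h1 ▸ hβ)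
      subst hil
      exact h1.elim hM2 hβ1
    by_cases hc : Conn δ α β
    · exact hconn α β hn hc
    · obtain ⟨i, hy, hp, h1 | h1⟩ := conn_or_eq_single h hCI hαβ hc
      · rw [h1]
        exact hsingle i hy hp β (by rw [← (sameDeg_iff.1 hαβ).1, hn]) (h1 ▸ hαβ)
      · rw [h1]
        exact hsymm _ _ (hsingle i hy hp α hn (h1 ▸ hαβ.symm))

end Critical

end ToricCI

end

/-! ### The numerical form of the criticality conditions. -/

noncomputable section

namespace ToricCI

variable {n : ℕ}

/-- `xᵢ ^ cᵢ = x ^ M y ^ (cᵢ - ∑ M)` holds on the projective monomial curve of `d`. -/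
structure CritRel (d c : Fin n → ℕ) (i : Fin n) (M : Fin n → ℕ) : Prop where
  self : M i = 0
  sum_le : ∑ j, M j ≤ c i
  wt : ∑ j, M j * d j = c i * d i

/-- The properties of the critical exponents `c` of a complete intersection projective monomial
curve with weights `d`, where `d p` is the largest weight. -/
structure IsCritical (d : Fin n → ℕ) (p : Fin n) (c : Fin n → ℕ) : Prop where
  two_le : ∀ i, i ≠ p → 2 ≤ c i
  exists_rel : ∀ i, i ≠ p → ∃ M, CritRel d c i M
  min : ∀ i, i ≠ p → ∀ e, 0 < e → ∀ M : Fin n → ℕ, M i = 0 → ∑ j, M j ≤ e →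
    ∑ j, M j * d j = e * d i → c i ≤ e
  avoid : ∀ T : Finset (Fin n), T.Nonempty → p ∉ T →
    ∃ i ∈ T, ∀ M, CritRel d c i M → ∀ j ∈ T, M j = 0
  -- Here `a`, `b`, `g` are exponents of `y`; the strict inequalities say that neither monomial is a
  -- pure power.
  move : ∀ (α β : Fin n → ℕ) (a b : ℕ), ∑ j, α j + a = ∑ j, β j + b →
    ∑ j, α j * d j = ∑ j, β j * d j → α ≠ β → (∀ i, α i < ∑ j, α j + a) →
    (∀ i, β i < ∑ j, β j + b) → a < ∑ j, α j + a → b < ∑ j, β j + b →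
    ∃ (i : Fin n) (γ : Fin n → ℕ) (g : ℕ), i ≠ p ∧ (∀ j, γ j ≤ α j) ∧ g ≤ a ∧ ∑ j, γ j + g = c i ∧
      ∑ j, γ j * d j = c i * d i ∧ ∑ j, γ j + g < ∑ j, α j + a
  lattice : ∀ M : Fin n → Fin n → ℕ, (∀ i, i ≠ p → CritRel d c i (M i)) →
    ∀ v : Fin n → ℤ, ∑ j, v j * d j = 0 → ∃ l : Fin n → ℤ, ∀ j,
      v j = ∑ i, if i = p then 0 else l i * ((if j = i then (c i : ℤ) else 0) - M i j)

/-- The monomial `x ^ M y ^ a`. -/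
def toExp (M : Fin n → ℕ) (a : ℕ) : Option (Fin n) →₀ ℕ :=
  Finsupp.equivFunOnFinite.symm fun o => o.elim a M

@[simp]
theorem toExp_none (M : Fin n → ℕ) (a : ℕ) : toExp M a none = a := rfl

@[simp]
theorem toExp_some (M : Fin n → ℕ) (a : ℕ) (i : Fin n) : toExp M a (some i) = M i := rfl

theorem eq_toExp (α : Option (Fin n) →₀ ℕ) : α = toExp (fun i => α (some i)) (α none) := by
  ext (_ | i) <;> rfl

/-- The weights of the variables, where `y` has weight zero. -/
def optWt (d : Fin n → ℕ) (o : Option (Fin n)) : ℕ := o.elim 0 d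

theorem sameDeg_toExp_iff {d : Fin n → ℕ} {M N : Fin n → ℕ} {a b : ℕ} :
    SameDeg (optWt d) (toExp M a) (toExp N b) ↔
      ∑ j, M j + a = ∑ j, N j + b ∧ ∑ j, M j * d j = ∑ j, N j * d j := by
  rw [sameDeg_iff, Fintype.sum_option, Fintype.sum_option, Fintype.sum_option, Fintype.sum_option]
  simp [optWt, add_comm]

theorem sameDeg_single_toExp_iff {d : Fin n → ℕ} {i : Fin n} {c : ℕ} {N : Fin n → ℕ} {b : ℕ} :
    SameDeg (optWt d) (Finsupp.single (some i) c) (toExp N b) ↔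
      ∑ j, N j + b = c ∧ ∑ j, N j * d j = c * d i := by
  rw [sameDeg_iff, sum_single, sum_single_mul, Fintype.sum_option, Fintype.sum_option]
  simp [optWt, add_comm, eq_comm]

theorem isCurve_optWt {d : Fin n → ℕ} {p : Fin n} (hpos : ∀ i, 0 < d i)
    (hinj : Function.Injective d) (hp : ∀ i, d i ≤ d p) :
    IsCurve (optWt d) none (some p) where
  inj := by
    rintro (_ | i) (_ | j) h
    · rfl
    · exact absurd h (hpos j).ne
    · exact absurd h (hpos i).ne'
    · exact congrArg some (hinj h)
  zero := rfl
  ne := (hpos p).ne'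
  le := by
    rintro (_ | i)
    · exact Nat.zero_le _
    · exact hp i

theorem exists_isCritical {k : Type*} [Field k] {d : Fin n → ℕ} {p : Fin n} (hpos : ∀ i, 0 < d i)
    (hinj : Function.Injective d) (hp : ∀ i, d i ≤ d p) (hCI : HasCIGenerators k (optWt d)) :
    ∃ c, IsCritical d p c := by
  have h := isCurve_optWt hpos hinj hp
  have hspec : ∀ i, i ≠ p → 0 < crit (optWt d) (some i) ∧ ∃ M,
      CritRel d (fun i => crit (optWt d) (some i)) i M := by
    intro i hi
    obtain ⟨h1, M, hM, hM'⟩ := crit_spec h (i := some i) (by simp) (by simpa using hi)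
    refine ⟨h1, fun j => M (some j), hM, ?_, ?_⟩
    · rw [eq_toExp M, sameDeg_single_toExp_iff] at hM'
      omega
    · rw [eq_toExp M, sameDeg_single_toExp_iff] at hM'
      exact hM'.2
  have hcrit : ∀ i M, i ≠ p → CritRel d (fun i => crit (optWt d) (some i)) i M →
      SameDeg (optWt d) (Finsupp.single (some i) (crit (optWt d) (some i)))
        (toExp M (crit (optWt d) (some i) - ∑ j, M j)) ∧
      toExp M (crit (optWt d) (some i) - ∑ j, M j) ≠
        Finsupp.single (some i) (crit (optWt d) (some i)) := by
    intro i M hi hM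
    constructor
    · rw [sameDeg_single_toExp_iff]
      refine ⟨?_, hM.wt⟩
      have : ∑ j, M j ≤ crit (optWt d) (some i) := hM.sum_le
      omega
    · intro h1
      have h2 := DFunLike.congr_fun h1 (some i)
      simp only [toExp_some, hM.self, Finsupp.single_eq_same] at h2
      have := (hspec i hi).1
      omega
  have hmin : ∀ i, ∀ e, 0 < e → ∀ M : Fin n → ℕ, M i = 0 → ∑ j, M j ≤ e →
      ∑ j, M j * d j = e * d i → crit (optWt d) (some i) ≤ e := by
    intro i e he M hM hle hwt
    refine crit_le he (M := toExp M (e - ∑ j, M j)) (by simpa using hM) ?_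
    rw [sameDeg_single_toExp_iff]
    exact ⟨by omega, hwt⟩
  refine ⟨fun i => crit (optWt d) (some i), ?_, fun i hi => (hspec i hi).2, fun i _ => hmin i,
    ?_, ?_, ?_⟩
  · intro i hi
    obtain ⟨h1, M, hM1, hM2, hM3⟩ := hspec i hi
    -- Exponent one would put `x_i` in the degree of a single other variable, or of `y`, against
    -- distinct positive weights.
    by_contra h2
    have h3 : crit (optWt d) (some i) = 1 := by omega
    simp only [h3, one_mul] at hM2 hM3
    have h4 : ∃ j, M j ≠ 0 := by
      by_contra h5
      push Not at h5
      simp only [h5, zero_mul, Finset.sum_const_zero] at hM3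
      exact (hpos i).ne hM3
    obtain ⟨j, hj⟩ := h4
    have h5 : ∀ l, l ≠ j → M l = 0 := by
      intro l hl
      have h6 := Finset.add_le_sum (f := M) (s := Finset.univ) (fun _ _ => Nat.zero_le _)
        (Finset.mem_univ j) (Finset.mem_univ l) hl.symm
      omega
    rw [Finset.sum_eq_single j (fun l _ hl => h5 l hl) (by simp)] at hM2
    rw [Finset.sum_eq_single j (fun l _ hl => by rw [h5 l hl, zero_mul]) (by simp)] at hM3
    have h6 : M j = 1 := by omega
    rw [h6, one_mul] at hM3
    have := hinj hM3
    subst this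
    exact hj hM1
  · intro T hT hpT
    classical
    obtain ⟨o, ho, hav⟩ := exists_mem_forall_avoid h hCI (T.map Function.Embedding.some)
      (by simpa using hT) (by
        intro o ho
        obtain ⟨i, hi, rfl⟩ := Finset.mem_map.1 ho
        refine ⟨by simp, ?_⟩
        rintro h1
        simp only [Function.Embedding.some_apply, Option.some.injEq] at h1
        exact hpT (h1 ▸ hi))
    obtain ⟨i, hi, rfl⟩ := Finset.mem_map.1 ho
    refine ⟨i, hi, fun M hM j hj => ?_⟩
    obtain ⟨h1, h2⟩ := hcrit i M (fun h => hpT (h ▸ hi)) hM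
    exact hav _ h1 h2 (some j) (Finset.mem_map_of_mem _ hj)
  · intro α β a b h1 h2 hne hα hβ ha hb
    have hns : ∀ (α : Fin n → ℕ) (a : ℕ), (∀ i, α i < ∑ j, α j + a) → a < ∑ j, α j + a →
        ∀ (o : Option (Fin n)) (e : ℕ), toExp α a ≠ Finsupp.single o e := by
      intro α a h3 h4 o e h5
      have h6 : ∑ o', toExp α a o' = e := by rw [h5, sum_single]
      rw [Fintype.sum_option] at h6
      have h7 : toExp α a o = e := by rw [h5, Finsupp.single_eq_same]
      rcases o with _ | i
      · simp only [toExp_none, toExp_some] at h6 h7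
        omega
      · simp only [toExp_none, toExp_some] at h6 h7
        have := h3 i
        omega
    obtain ⟨o, γ, hoy, hop, hlt, hγ⟩ := exists_lt_sameDeg_crit h hCI
      (α := toExp α a) (β := toExp β b) (sameDeg_toExp_iff.2 ⟨h1, h2⟩)
      (fun h3 => hne (by
        ext i
        simpa using DFunLike.congr_fun h3 (some i)))
      (hns α a hα ha) (hns β b hβ hb)
    rcases o with _ | i
    · exact absurd rfl hoy
    have hle := hlt.le
    rw [eq_toExp γ, sameDeg_single_toExp_iff] at hγ
    refine ⟨i, fun j => γ (some j), γ none, fun h3 => hop (by rw [h3]), fun j => hle (some j),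
      hle none, hγ.1, hγ.2, ?_⟩
    have h3 : ∑ o, γ o < ∑ o, toExp α a o := by
      obtain ⟨-, o, ho⟩ := Finsupp.lt_def.1 hlt
      exact Finset.sum_lt_sum (fun o _ => hle o) ⟨o, Finset.mem_univ o, ho⟩
    rw [Fintype.sum_option, Fintype.sum_option] at h3
    simp only [toExp_none, toExp_some] at h3
    change ∑ j, γ (some j) + γ none < _
    omega
  · intro M hM v hv
    let M' : Option (Fin n) → Option (Fin n) →₀ ℕ := fun o => o.elim 0 fun i =>
      toExp (M i) (crit (optWt d) (some i) - ∑ j, M i j)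
    have h1 : ∀ o, o ≠ none → o ≠ some p →
        SameDeg (optWt d) (Finsupp.single o (crit (optWt d) o)) (M' o) ∧
          M' o ≠ Finsupp.single o (crit (optWt d) o) := by
      rintro (_ | i) h1 h2
      · exact absurd rfl h1
      · have hi : i ≠ p := fun h3 => h2 (by rw [h3])
        exact hcrit i (M i) hi (hM i hi)
    -- Split `v` into positive and negative parts; suitable powers of `y` equalize the total
    -- degrees.
    let α : Fin n → ℕ := fun j => (v j).toNat
    let β : Fin n → ℕ := fun j => (-v j).toNat
    have h2 : ∀ j, v j = α j - β j := fun j => (Int.toNat_sub_toNat_neg (v j)).symm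
    have h3 : SameDeg (optWt d) (toExp α (∑ j, β j)) (toExp β (∑ j, α j)) := by
      rw [sameDeg_toExp_iff]
      refine ⟨add_comm _ _, ?_⟩
      simp only [h2, sub_mul, Finset.sum_sub_distrib, sub_eq_zero] at hv
      exact_mod_cast hv
    have h4 := sub_mem_span_critVec h hCI M' h1 h3
    rw [Submodule.mem_span_range_iff_exists_fun] at h4
    obtain ⟨l, hl⟩ := h4
    refine ⟨fun i => if hi : i ≠ p then l ⟨some i, Option.some_ne_none _, by simpa using hi⟩ else 0,
      fun j => ?_⟩
    have h5 := congrFun hl (some j)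
    simp only [toExp_some, ← h2] at h5
    rw [← h5, Finset.sum_apply]
    have h6 : ∑ i : {o : Option (Fin n) // o ≠ none ∧ o ≠ some p},
        (l i • critVec (optWt d) i.1 (M' i.1)) (some j) =
        ∑ i : {i : Fin n // i ≠ p}, l ⟨some i.1, Option.some_ne_none _, by simpa using i.2⟩ *
          ((if j = i.1 then (crit (optWt d) (some i.1) : ℤ) else 0) - M i.1 j) := by
      refine (Fintype.sum_bijective
        (fun i : {i : Fin n // i ≠ p} => (⟨some i.1, Option.some_ne_none _, by simpa using i.2⟩ :
          {o : Option (Fin n) // o ≠ none ∧ o ≠ some p})) ?_ _ _ ?_).symm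
      · constructor
        · rintro ⟨i, hi⟩ ⟨j, hj⟩ hij
          simpa using hij
        · rintro ⟨_ | i, h7, h8⟩
          · exact absurd rfl h7
          · exact ⟨⟨i, fun h9 => h8 (by rw [h9])⟩, rfl⟩
      · rintro ⟨i, hi⟩
        simp only [Pi.smul_apply, smul_eq_mul, critVec, Finsupp.single_apply, M', Option.elim,
          toExp_some, Option.some.injEq]
        congr 2
        by_cases hij : j = i
        · simp [hij]
        · simp [hij, Ne.symm hij]
    rw [h6, Finset.sum_ite, Finset.sum_const_zero, zero_add]
    rw [← Finset.sum_subtype_eq_sum_filter, Finset.subtype_univ]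
    refine Finset.sum_congr rfl fun i _ => ?_
    change _ = (if hi : i.1 ≠ p then
      l ⟨some i.1, Option.some_ne_none _, by simpa using hi⟩ else 0) * _
    rw [dif_pos i.2]

end ToricCI

end

/-! ### Transfer between `toricIdeal` of `star` and the kernel for the curve. -/

noncomputable section

namespace ToricCI

open MvPolynomial

section Bridge

variable {k : Type*} [Field k] {m : ℕ}

theorem toricIdeal_eq_monoKer (B : Finset (Fin m → ℕ)) :
    toricIdeal k B = monoKer k (fun b : B => Finsupp.equivFunOnFinite.symm b.1) := by
  have h : (fun b : B => ∏ j : Fin m, (X j : MvPolynomial (Fin m) k) ^ b.1 j) =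
      fun b : B => monomial (Finsupp.equivFunOnFinite.symm b.1) 1 := by
    funext b
    rw [monomial_eq, C_1, one_mul, Finsupp.prod_fintype _ _ (by simp)]
    rfl
  rw [toricIdeal, h]

theorem comap_rename_toricIdeal {τ : Type*} (B : Finset (Fin m → ℕ)) (e : τ → B) :
    (toricIdeal k B).comap (rename e) =
      monoKer k (fun o => Finsupp.equivFunOnFinite.symm (e o).1) := by
  rw [toricIdeal_eq_monoKer]
  ext f
  rw [Ideal.mem_comap, RingHom.mem_ker, RingHom.mem_ker, aeval_rename]
  rfl

variable {n : ℕ} {d : Fin n → ℕ} {p : Fin n}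

theorem sup_image_eq (hp : ∀ i, d i ≤ d p) : (Finset.univ.image d).sup id = d p := by
  refine le_antisymm (Finset.sup_le fun x hx => ?_) ?_
  · obtain ⟨i, -, rfl⟩ := Finset.mem_image.1 hx
    exact hp i
  · exact Finset.le_sup (f := id) (Finset.mem_image_of_mem d (Finset.mem_univ p))

/-- The vector of the projective monomial curve of `d` indexed by `o`. -/
def optVec (d : Fin n → ℕ) (D : ℕ) (o : Option (Fin n)) : Fin 2 → ℕ := ![optWt d o, D - optWt d o]

theorem optVec_mem_star (hp : ∀ i, d i ≤ d p) (o : Option (Fin n)) :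
    optVec d (d p) o ∈ star (Finset.univ.image d) := by
  rw [star, sup_image_eq hp, Finset.mem_insert]
  rcases o with _ | i
  · exact Or.inl rfl
  · exact Or.inr (Finset.mem_image.2 ⟨d i, Finset.mem_image_of_mem d (Finset.mem_univ i), rfl⟩)

theorem exists_equiv_star (hpos : ∀ i, 0 < d i) (hinj : Function.Injective d)
    (hp : ∀ i, d i ≤ d p) :
    ∃ e : Option (Fin n) ≃ star (Finset.univ.image d), ∀ o, (e o).1 = optVec d (d p) o := by
  refine ⟨Equiv.ofBijective (fun o => ⟨optVec d (d p) o, optVec_mem_star hp o⟩) ⟨?_, ?_⟩,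
    fun o => rfl⟩
  · intro o o' h
    have h1 := congrFun (Subtype.ext_iff.1 h) 0
    exact (isCurve_optWt hpos hinj hp).inj h1
  · rintro ⟨v, hv⟩
    have hv' := hv
    rw [star, sup_image_eq hp, Finset.mem_insert] at hv'
    rcases hv' with rfl | h
    · exact ⟨none, rfl⟩
    · obtain ⟨a, ha, rfl⟩ := Finset.mem_image.1 h
      obtain ⟨i, -, rfl⟩ := Finset.mem_image.1 ha
      exact ⟨some i, rfl⟩

/-- The gradings `(a, D - a)` and `(1, a)` determine each other: the two coordinates of the former
add up to `D` times the number of factors. -/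
theorem monoKer_optVec (hp : ∀ i, d i ≤ d p) (hpos : 0 < d p) :
    monoKer k (fun o => Finsupp.equivFunOnFinite.symm (optVec d (d p) o)) =
      monoKer k (curveDeg (optWt d)) := by
  have hle : ∀ o, optWt d o ≤ d p := by
    rintro (_ | i)
    · exact Nat.zero_le _
    · exact hp i
  have h0 : ∀ α : Option (Fin n) →₀ ℕ,
      expDeg (fun o => Finsupp.equivFunOnFinite.symm (optVec d (d p) o)) α 0 =
        ∑ o, α o * optWt d o := by
    intro α
    rw [Finsupp.linearCombination_apply, Finsupp.sum_fintype _ _ (by simp),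
      Finsupp.finsetSum_apply]
    rfl
  have h1 : ∀ α : Option (Fin n) →₀ ℕ,
      expDeg (fun o => Finsupp.equivFunOnFinite.symm (optVec d (d p) o)) α 1 +
        ∑ o, α o * optWt d o = (∑ o, α o) * d p := by
    intro α
    rw [Finsupp.linearCombination_apply, Finsupp.sum_fintype _ _ (by simp),
      Finsupp.finsetSum_apply, ← Finset.sum_add_distrib, Finset.sum_mul]
    refine Finset.sum_congr rfl fun o _ => ?_
    change α o * (d p - optWt d o) + α o * optWt d o = _
    rw [← mul_add, Nat.sub_add_cancel (hle o)]
  have key : ∀ α β : Option (Fin n) →₀ ℕ,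
      expDeg (fun o => Finsupp.equivFunOnFinite.symm (optVec d (d p) o)) α =
        expDeg (fun o => Finsupp.equivFunOnFinite.symm (optVec d (d p) o)) β ↔
      expDeg (curveDeg (optWt d)) α = expDeg (curveDeg (optWt d)) β := by
    intro α β
    rw [expDeg_curveDeg_eq_iff, Finsupp.ext_iff, Fin.forall_fin_two, h0, h0]
    have ha := h1 α
    have hb := h1 β
    constructor
    · rintro ⟨h2, h3⟩
      rw [h3, h2, hb] at ha
      exact ⟨(Nat.eq_of_mul_eq_mul_right hpos ha).symm, h2⟩
    · rintro ⟨h2, h3⟩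
      refine ⟨h3, ?_⟩
      rw [h2, h3] at ha
      omega
  exact le_antisymm (monoKer_le_monoKer _ _ fun α β => (key α β).1)
    (monoKer_le_monoKer _ _ fun α β => (key α β).2)

theorem exists_ringEquiv_map_toricIdeal (hpos : ∀ i, 0 < d i) (hinj : Function.Injective d)
    (hp : ∀ i, d i ≤ d p) :
    ∃ e : MvPolynomial (Option (Fin n)) k ≃+* MvPolynomial (star (Finset.univ.image d)) k,
      (monoKer k (curveDeg (optWt d))).map e = toricIdeal k (star (Finset.univ.image d)) := by
  obtain ⟨e, he⟩ := exists_equiv_star hpos hinj hp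
  refine ⟨(renameEquiv k e).toRingEquiv, ?_⟩
  have h1 := comap_rename_toricIdeal (k := k) (star (Finset.univ.image d)) e
  simp only [he] at h1
  rw [monoKer_optVec hp (hpos p)] at h1
  rw [← h1]
  exact Ideal.map_comap_of_surjective _ (renameEquiv k e).surjective _

theorem height_toricIdeal (hpos : ∀ i, 0 < d i) (hinj : Function.Injective d)
    (hp : ∀ i, d i ≤ d p) :
    (toricIdeal k (star (Finset.univ.image d))).height + 1 = n := by
  obtain ⟨e, he⟩ := exists_ringEquiv_map_toricIdeal (k := k) hpos hinj hp
  rw [← he, RingEquiv.height_map]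
  have h := isCurve_optWt hpos hinj hp
  have h1 := height_monoKer_curveDeg_le (k := k) (optWt d) none (some p) h.zero h.ne
  have h2 := le_height_monoKer_curveDeg (k := k) (optWt d) none (some p) h.zero h.ne h.le
  rw [Fintype.card_option, Fintype.card_fin] at h1 h2
  have h3 : (monoKer k (curveDeg (optWt d))).height ≠ ⊤ := Ideal.height_ne_top_of_isPrime
  lift (monoKer k (curveDeg (optWt d))).height to ℕ using h3 with r
  norm_cast at h1 h2 ⊢
  omega

theorem hasCIGenerators_of_isCompleteIntersection (hpos : ∀ i, 0 < d i)
    (hinj : Function.Injective d) (hp : ∀ i, d i ≤ d p)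
    (hCI : IsCompleteIntersection (toricIdeal k (star (Finset.univ.image d)))) :
    HasCIGenerators k (optWt d) := by
  obtain ⟨e, he⟩ := exists_ringEquiv_map_toricIdeal (k := k) hpos hinj hp
  rw [← he, IsCompleteIntersection, RingEquiv.height_map, Ideal.spanRank_map_eq_of_ringEquiv]
    at hCI
  have hfg : (monoKer k (curveDeg (optWt d))).FG := IsNoetherian.noetherian _
  obtain ⟨s, hs, hspan⟩ := Submodule.FG.exists_span_finset_card_eq_spanFinrank hfg
  refine ⟨s.card, fun i => (s.equivFin.symm i).1, ?_, ?_⟩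
  · have h1 : Set.range (fun i => (s.equivFin.symm i).1) = (s : Set _) := by
      rw [Set.range_comp' Subtype.val, s.equivFin.symm.range_eq_univ]
      simp
    rw [h1]
    exact hspan
  · rw [← hCI, Submodule.FG.spanRank_eq_spanFinrank hfg, hs]
    simp

/-- Only an upper bound on the number of generators is needed; Krull's height theorem supplies the
reverse inequality. -/
theorem isCompleteIntersection_of_generators {R : Type*} [CommRing R] [IsNoetherianRing R]
    {I : Ideal R} (hI : I ≠ ⊤) {S : Finset R} (hS : Ideal.span (S : Set R) = I)
    (hc : (S.card : ℕ∞) ≤ I.height) : IsCompleteIntersection I := by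
  refine le_antisymm (le_trans ?_ hc) (Ideal.height_le_spanRank_toENat I hI)
  rw [Submodule.spanRank_toENat_eq_iInf_finset_card]
  exact iInf_le (fun s : {s : Finset R // Submodule.span R s = I} => (s.1.card : ℕ∞)) ⟨S, hS⟩

end Bridge

end ToricCI

end

/-! ### Four weights, the first three in arithmetic progression: necessity. -/

noncomputable section

namespace ToricCI

/-- Elimination data for the projective monomial curve of `{a, b, D}`: first `b`, then `a`. -/
def ElimData (a b D : ℕ) : Prop :=
  ∃ s t : ℕ, 0 < s ∧ 0 < t ∧ (∃ u, u ≤ s ∧ s * a = u * D) ∧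
    (∃ u v, u + v ≤ t ∧ t * b = u * a + v * D) ∧
    (∀ x z : ℤ, x * a = z * D → (s : ℤ) ∣ x) ∧
    (∀ x y z : ℤ, x * b = y * a + z * D → (t : ℤ) ∣ x)

section Sums

variable {ι M : Type*} [Fintype ι] [DecidableEq ι] [AddCommMonoid M]

theorem sum_eq_four {i j k l : ι} (hu : (Finset.univ : Finset ι) = {i, j, k, l}) (hij : i ≠ j)
    (hik : i ≠ k) (hil : i ≠ l) (hjk : j ≠ k) (hjl : j ≠ l) (hkl : k ≠ l) (g : ι → M) :
    ∑ x, g x = g i + g j + g k + g l := by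
  rw [hu, Finset.sum_insert (by simp [*]), Finset.sum_insert (by simp [*]),
    Finset.sum_insert (by simp [*]), Finset.sum_singleton, add_assoc, add_assoc]

end Sums

variable {n : ℕ} {d c : Fin n → ℕ} {p : Fin n}

/-- The exponent vector of `xᵢ ^ a xⱼ ^ b`. -/
def pairExp (i j : Fin n) (a b : ℕ) : Fin n → ℕ := Pi.single i a + Pi.single j b

theorem sum_pairExp (i j : Fin n) (a b : ℕ) : ∑ l, pairExp i j a b l = a + b := by
  simp [pairExp, Finset.sum_add_distrib]

theorem sum_pairExp_mul (i j : Fin n) (a b : ℕ) :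
    ∑ l, pairExp i j a b l * d l = a * d i + b * d j := by
  simp [pairExp, Finset.sum_add_distrib, add_mul, Pi.single_apply]

theorem critRel_pairExp {i j l : Fin n} {a b : ℕ} (hj : i ≠ j) (hl : i ≠ l) (hle : a + b ≤ c i)
    (h : a * d j + b * d l = c i * d i) : CritRel d c i (pairExp j l a b) where
  self := by simp [pairExp, hj, hl]
  sum_le := by rwa [sum_pairExp]
  wt := by rwa [sum_pairExp_mul]

theorem IsCritical.eq_two (hc : IsCritical d p c) {i j l : Fin n} (hi : i ≠ p) (hj : i ≠ j)
    (hl : i ≠ l) (h : d j + d l = 2 * d i) : c i = 2 := by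
  refine le_antisymm (hc.min i hi 2 (by norm_num) (pairExp j l 1 1) ?_ ?_ ?_) (hc.two_le i hi)
  · simp [pairExp, hj, hl]
  · rw [sum_pairExp]
  · rw [sum_pairExp_mul, one_mul, one_mul, h]

theorem IsCritical.critRel_pair (hc : IsCritical d p c) {i j l : Fin n} (hi : i ≠ p) (hj : i ≠ j)
    (hl : i ≠ l) (h : d j + d l = 2 * d i) : CritRel d c i (pairExp j l 1 1) := by
  have h2 := hc.eq_two hi hj hl h
  exact critRel_pairExp hj hl (by omega) (by rw [h2, one_mul, one_mul, h])

/-- Two interlocking quadrics `xᵢ² = x_l xⱼ` and `xⱼ² = xᵢ x_m` exclude a complete intersection. -/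
theorem IsCritical.false_of_interlocking (hc : IsCritical d p c) {i j l m : Fin n} (hi : i ≠ p)
    (hj : j ≠ p) (hij : i ≠ j) (hil : i ≠ l) (hjm : j ≠ m) (h1 : d l + d j = 2 * d i)
    (h2 : d i + d m = 2 * d j) : False := by
  obtain ⟨x, hx, hav⟩ := hc.avoid {i, j} (by simp) (by simp [hi.symm, hj.symm])
  rw [Finset.mem_insert, Finset.mem_singleton] at hx
  rcases hx with rfl | rfl
  · have := hav _ (hc.critRel_pair hi hil hij h1) j (by simp)
    simp [pairExp] at this
  · have := hav _ (hc.critRel_pair hj hij.symm hjm h2) i (by simp)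
    simp [pairExp] at this

theorem int_gcd_three (a b e : ℕ) : ∃ x y z : ℤ,
    ((Nat.gcd (Nat.gcd a b) e : ℕ) : ℤ) = x * a + y * b + z * e := by
  refine ⟨Nat.gcdA a b * Nat.gcdA (Nat.gcd a b) e, Nat.gcdB a b * Nat.gcdA (Nat.gcd a b) e,
    Nat.gcdB (Nat.gcd a b) e, ?_⟩
  rw [Nat.gcd_eq_gcd_ab (Nat.gcd a b) e, Nat.gcd_eq_gcd_ab a b]
  ring

section LastQuadric

variable {m e f : Fin n}

/-- When `x_m² = M` is the last relation of four, the other three weights are even. -/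
theorem IsCritical.elimData_and_even (hc : IsCritical d p c)
    (hu : (Finset.univ : Finset (Fin n)) = {m, e, f, p}) (hme : m ≠ e) (hmf : m ≠ f) (hmp : m ≠ p)
    (hef : e ≠ f) (hep : e ≠ p) (hfp : f ≠ p) (h2 : c m = 2)
    (hMe : ∀ M, CritRel d c e M → M m = 0 ∧ M f = 0) (hMf : ∀ M, CritRel d c f M → M m = 0) :
    ElimData (d e) (d f) (d p) ∧
      ∀ v : Fin n → ℤ, ∑ j, v j * d j = 0 → (2 : ℤ) ∣ v m := by
  have sN := fun g : Fin n → ℕ => sum_eq_four hu hme hmf hmp hef hep hfp g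
  have sZ := fun g : Fin n → ℤ => sum_eq_four hu hme hmf hmp hef hep hfp g
  choose! M hM using hc.exists_rel
  have hce := hc.two_le e hep
  have hcf := hc.two_le f hfp
  have hEe := hM e hep
  have hFf := hM f hfp
  obtain ⟨e1, e2⟩ := hMe _ hEe
  have f1 := hMf _ hFf
  -- The matrix of critical relations is triangular in the order `m`, `f`, `e`: no other relation
  -- involves `x_m`, and the one of `x_e` does not involve `x_f`. Divisibility of coordinates is
  -- read off row by row.
  have lat : ∀ v : Fin n → ℤ, ∑ j, v j * d j = 0 → ∃ le lf : ℤ, 2 ∣ v m ∧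
      (v m = 0 → v f = c f * lf ∧ (lf = 0 → v e = c e * le)) := by
    intro v hv
    obtain ⟨l, hl⟩ := hc.lattice M hM v hv
    have hm := hl m
    have hf' := hl f
    have he := hl e
    rw [sZ] at hm hf' he
    simp only [hmp, hep, hfp, hme, hmf, hef, hme.symm, hmf.symm, hef.symm, if_true, if_false, h2,
      (hM m hmp).self, hEe.self, hFf.self, e1, e2, f1] at hm hf' he
    push_cast at hm hf' he
    refine ⟨l e, l f, ⟨l m, by linarith⟩, fun h0 => ?_⟩
    have hlm : l m = 0 := by linarith
    rw [hlm] at hf' he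
    refine ⟨by linarith, fun h3 => ?_⟩
    rw [h3] at he
    linarith
  refine ⟨⟨c e, c f, by omega, by omega, ⟨M e p, ?_, ?_⟩, ⟨M f e, M f p, ?_, ?_⟩, ?_, ?_⟩, ?_⟩
  · have := hEe.sum_le
    rw [sN] at this
    omega
  · have := hEe.wt
    rw [sN, hEe.self, e1, e2] at this
    linarith
  · have := hFf.sum_le
    rw [sN] at this
    omega
  · have := hFf.wt
    rw [sN, hFf.self, f1] at this
    linarith
  · intro x z hxz
    let v : Fin n → ℤ := Pi.single e x + Pi.single p (-z)
    have hv : ∑ j, v j * d j = 0 := by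
      rw [sZ]
      simp [v, hme, hmp, hep, hfp, hep.symm, hef.symm]
      linarith
    obtain ⟨le, lf, -, h3⟩ := lat v hv
    obtain ⟨h4, h5⟩ := h3 (by simp [v, hme, hmp])
    have h6 : lf = 0 := by
      have h7 : v f = 0 := by simp [v, hef.symm, hfp]
      rw [h7] at h4
      have h8 : (c f : ℤ) ≠ 0 := by positivity
      exact (mul_eq_zero.1 h4.symm).resolve_left h8
    refine ⟨le, ?_⟩
    rw [← h5 h6]
    simp [v, hep]
  · intro x y z hxyz
    let v : Fin n → ℤ := Pi.single f x + Pi.single e (-y) + Pi.single p (-z)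
    have hv : ∑ j, v j * d j = 0 := by
      rw [sZ]
      simp [v, hme, hmp, hmf, hep, hfp, hef, hfp.symm, hep.symm, hef.symm]
      linarith
    obtain ⟨le, lf, -, h3⟩ := lat v hv
    obtain ⟨h4, -⟩ := h3 (by simp [v, hme, hmp, hmf])
    refine ⟨lf, ?_⟩
    rw [← h4]
    simp [v, hfp, hef.symm]
  · intro v hv
    obtain ⟨-, -, h3, -⟩ := lat v hv
    exact h3

/-- Bézout expresses the gcd `G` of the other three weights by them, which gives a relation whose
coordinate at `m` is `G`. -/
theorem even_of_two_dvd
    (hu : (Finset.univ : Finset (Fin n)) = {m, e, f, p}) (hme : m ≠ e) (hmf : m ≠ f) (hmp : m ≠ p)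
    (hef : e ≠ f) (hep : e ≠ p) (hfp : f ≠ p)
    (h : ∀ v : Fin n → ℤ, ∑ j, v j * d j = 0 → (2 : ℤ) ∣ v m) :
    Even (d e) ∧ Even (d f) ∧ Even (d p) := by
  have sZ := fun g : Fin n → ℤ => sum_eq_four hu hme hmf hmp hef hep hfp g
  obtain ⟨x, y, z, hxyz⟩ := int_gcd_three (d e) (d f) (d p)
  set G := Nat.gcd (Nat.gcd (d e) (d f)) (d p)
  have hG : 2 ∣ G := by
    have h1 := h (Pi.single m (G : ℤ) + Pi.single e (-x * d m) + Pi.single f (-y * d m)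
      + Pi.single p (-z * d m)) (by
      rw [sZ]
      simp [hme, hmf, hmp, hep, hfp, hef, hme.symm, hmf.symm, hmp.symm, hfp.symm, hep.symm,
        hef.symm]
      rw [hxyz]
      ring)
    simp [hme, hmf, hmp] at h1
    exact_mod_cast h1
  have h1 : G ∣ Nat.gcd (d e) (d f) := Nat.gcd_dvd_left _ _
  exact ⟨even_iff_two_dvd.2 (hG.trans (h1.trans (Nat.gcd_dvd_left _ _))),
    even_iff_two_dvd.2 (hG.trans (h1.trans (Nat.gcd_dvd_right _ _))),
    even_iff_two_dvd.2 (hG.trans (Nat.gcd_dvd_right _ _))⟩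

/-- Applying `avoid` to `{e, f}` decides which of these two variables can be eliminated using `x_p`
and `y` alone. -/
theorem IsCritical.elimData_or_elimData (hc : IsCritical d p c)
    (hu : (Finset.univ : Finset (Fin n)) = {m, e, f, p}) (hme : m ≠ e) (hmf : m ≠ f) (hmp : m ≠ p)
    (hef : e ≠ f) (hep : e ≠ p) (hfp : f ≠ p) (h2 : c m = 2)
    (hMe : ∀ M, CritRel d c e M → M m = 0) (hMf : ∀ M, CritRel d c f M → M m = 0) :
    (ElimData (d e) (d f) (d p) ∨ ElimData (d f) (d e) (d p)) ∧
      Even (d e) ∧ Even (d f) ∧ Even (d p) := by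
  obtain ⟨x, hx, hav⟩ := hc.avoid {e, f} (by simp) (by simp [hep.symm, hfp.symm])
  rw [Finset.mem_insert, Finset.mem_singleton] at hx
  rcases hx with rfl | rfl
  · obtain ⟨h3, h4⟩ := hc.elimData_and_even hu hme hmf hmp hef hep hfp h2
      (fun M hM => ⟨hMe M hM, hav M hM f (by simp)⟩) hMf
    exact ⟨Or.inl h3, even_of_two_dvd hu hme hmf hmp hef hep hfp h4⟩
  · have hu' : (Finset.univ : Finset (Fin n)) = {m, x, e, p} := by
      rw [hu]; congr 1; exact Finset.insert_comm _ _ _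
    obtain ⟨h3, h4⟩ := hc.elimData_and_even hu' hmf hme hmp hef.symm hfp hep h2
      (fun M hM => ⟨hMf M hM, hav M hM e (by simp)⟩) hMe
    exact ⟨Or.inr h3, even_of_two_dvd hu hme hmf hmp hef hep hfp h4⟩

end LastQuadric

section Four

variable {d c : Fin 4 → ℕ} {p : Fin 4} {r : ℕ}

/-- In `{0, 1}` the index `1` cannot be the avoiding one, since its quadric `x_1 ^ 2 = x_0 x_2`
contains `x_0`. -/
theorem IsCritical.critRel_zero_avoid_one (hc : IsCritical d p c) (h0 : 0 ≠ p) (h1 : 1 ≠ p)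
    (h012 : d 0 + d 2 = 2 * d 1) (M : Fin 4 → ℕ) (hM : CritRel d c 0 M) : M 1 = 0 := by
  obtain ⟨x, hx, hav⟩ := hc.avoid {0, 1} (by simp) (by simp [h0.symm, h1.symm])
  rw [Finset.mem_insert, Finset.mem_singleton] at hx
  rcases hx with rfl | rfl
  · exact hav M hM 1 (by simp)
  · have := hav _ (hc.critRel_pair h1 (by decide) (by decide) h012) 0 (by simp)
    simp [pairExp] at this

theorem IsCritical.case_four_arith_of_three (hc : IsCritical d 3 c)
    (h012 : d 0 + d 2 = 2 * d 1) :
    (ElimData (d 0) (d 2) (d 3) ∨ ElimData (d 2) (d 0) (d 3)) ∧ Even (d 0) ∧ Even (d 3) := by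
  have h2 := hc.eq_two (i := 1) (by decide) (by decide) (by decide) h012
  have h3 : ∀ M, CritRel d c 2 M → M 1 = 0 := by
    intro M hM
    obtain ⟨x, hx, hav⟩ := hc.avoid {1, 2} (by simp) (by decide)
    rw [Finset.mem_insert, Finset.mem_singleton] at hx
    rcases hx with rfl | rfl
    · have := hav _ (hc.critRel_pair (by decide) (by decide) (by decide) h012) 2 (by simp)
      simp [pairExp] at this
    · exact hav M hM 1 (by simp)
  obtain ⟨h4, h5, -, h6⟩ := hc.elimData_or_elimData (m := 1) (e := 0) (f := 2) (by decide)
    (by decide) (by decide) (by decide) (by decide) (by decide) (by decide) h2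
    (hc.critRel_zero_avoid_one (by decide) (by decide) h012) h3
  exact ⟨h4, h5, h6⟩

theorem IsCritical.case_four_arith_of_two (hc : IsCritical d 2 c) (hpos : 0 < d 0)
    (h012 : d 0 + d 2 = 2 * d 1) :
    ((ElimData (d 0) (d 3) (d 2) ∨ ElimData (d 3) (d 0) (d 2)) ∧ Even (d 0) ∧ Even (d 3)) ∨
    (Even (d 0 / Nat.gcd (d 0) (d 1)) ∧ ∃ b₁ b₂ b₃ : ℕ,
      Nat.gcd (d 0) (d 1) * d 3 = b₁ * d 0 + b₂ * d 1 + b₃ * d 2 ∧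
      b₁ + b₂ + b₃ ≤ Nat.gcd (d 0) (d 1)) := by
  have h2 := hc.eq_two (i := 1) (by decide) (by decide) (by decide) h012
  have hP := hc.critRel_pair (i := 1) (by decide) (by decide) (by decide) h012
  have hlast : (∀ M, CritRel d c 3 M → M 1 = 0) →
      (ElimData (d 0) (d 3) (d 2) ∨ ElimData (d 3) (d 0) (d 2)) ∧ Even (d 0) ∧ Even (d 3) := by
    intro h3
    obtain ⟨h4, h5, h6, -⟩ := hc.elimData_or_elimData (m := 1) (e := 0) (f := 3) (by decide)
      (by decide) (by decide) (by decide) (by decide) (by decide) (by decide) h2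
      (hc.critRel_zero_avoid_one (by decide) (by decide) h012) h3
    exact ⟨h4, h5, h6⟩
  obtain ⟨x, hx, hav⟩ := hc.avoid {0, 1, 3} (by simp) (by decide)
  simp only [Finset.mem_insert, Finset.mem_singleton] at hx
  rcases hx with rfl | rfl | rfl
  · right
    choose! M hM using hc.exists_rel
    let M' : Fin 4 → Fin 4 → ℕ := Function.update M 1 (pairExp 0 2 1 1)
    have hM' : ∀ i, i ≠ 2 → CritRel d c i (M' i) := by
      intro i hi
      by_cases h3 : i = 1
      · subst h3; simpa [M'] using hP
      · simpa [M', h3] using hM i hi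
    have h01 := hav _ (hM' 0 (by decide)) 1 (by simp)
    have h03 := hav _ (hM' 0 (by decide)) 3 (by simp)
    have h13 : M' 1 3 = 0 := by simp [M', pairExp]
    have h11 := (hM' 1 (by decide)).self
    have h33 := (hM' 3 (by decide)).self
    -- Here `x_0` is related to `x_2` and `y` alone, so the order of elimination is `x_3`, then
    -- `x_1`, then `x_0`.
    have lat : ∀ v : Fin 4 → ℤ, ∑ j, v j * d j = 0 →
        (c 3 : ℤ) ∣ v 3 ∧ (v 3 = 0 → (2 : ℤ) ∣ v 1) := by
      intro v hv
      obtain ⟨l, hl⟩ := hc.lattice M' hM' v hv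
      have l3 := hl 3
      have l1 := hl 1
      rw [Fin.sum_univ_four] at l3 l1
      simp [h01, h03, h13, h11, h33, h2] at l3 l1
      refine ⟨⟨l 3, by linarith⟩, fun h0 => ?_⟩
      have h3 : l 3 = 0 := by
        rw [h0] at l3
        have := hc.two_le 3 (by decide)
        have h8 : (c 3 : ℤ) ≠ 0 := by positivity
        exact (mul_eq_zero.1 l3.symm).resolve_right h8
      rw [h3] at l1
      exact ⟨l 1, by linarith⟩
    set g := Nat.gcd (d 0) (d 1) with hg
    have hgpos : 0 < g := Nat.gcd_pos_of_pos_left _ hpos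
    constructor
    · obtain ⟨a, ha⟩ : g ∣ d 0 := Nat.gcd_dvd_left _ _
      obtain ⟨b, hb⟩ : g ∣ d 1 := Nat.gcd_dvd_right _ _
      have h3 : d 0 / g = a := by rw [ha, Nat.mul_div_cancel_left _ hgpos]
      rw [h3]
      -- The syzygy of `d 0 = g a` and `d 1 = g b` has coordinate `a` at index `1`, which is
      -- therefore even.
      have h4 := (lat ![-(b : ℤ), a, 0, 0] (by
        rw [Fin.sum_univ_four]
        simp [ha, hb]
        ring)).2 (by simp)
      simp at h4
      exact even_iff_two_dvd.2 (by exact_mod_cast h4)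
    -- Bézout gives a relation with last coordinate `g`, so `c 3` divides `g`; the critical relation
    -- of `x_3` is then scaled up by `g / c 3`.
    · have h3 := (lat ![-(d 3 * Nat.gcdA (d 0) (d 1)), -(d 3 * Nat.gcdB (d 0) (d 1)), 0, g] (by
        rw [Fin.sum_univ_four, hg, Nat.gcd_eq_gcd_ab]
        simp
        ring)).1
      simp at h3
      have h4 : c 3 ∣ g := by exact_mod_cast h3
      obtain ⟨t, ht⟩ := h4
      have h5 := (hM' 3 (by decide)).wt
      have h6 := (hM' 3 (by decide)).sum_le
      rw [Fin.sum_univ_four, h33] at h5 h6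
      refine ⟨t * M' 3 0, t * M' 3 1, t * M' 3 2, ?_, ?_⟩
      · rw [ht]
        calc c 3 * t * d 3 = t * (c 3 * d 3) := by ring
          _ = _ := by rw [← h5]; ring
      · rw [ht]
        calc _ = t * (M' 3 0 + M' 3 1 + M' 3 2 + 0) := by ring
          _ ≤ t * c 3 := Nat.mul_le_mul_left _ h6
          _ = _ := by ring
  · have := hav _ hP 0 (by simp)
    simp [pairExp] at this
  · exact Or.inl (hlast fun M hM => hav M hM 1 (by simp))

end Four

end ToricCI

end

/-! ### Excluding `h ≥ 2`. -/

noncomputable section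

namespace ToricCI

variable {n : ℕ} {d c : Fin n → ℕ} {p : Fin n}

theorem eq_pairExp_of_le {i j : Fin n} {a b : ℕ} {γ : Fin n → ℕ}
    (h : ∀ l, γ l ≤ pairExp i j a b l) :
    ∃ a' b', a' ≤ a ∧ b' ≤ b ∧ γ = pairExp i j a' b' := by
  by_cases hij : i = j
  · subst hij
    have hi := h i
    simp [pairExp] at hi
    refine ⟨min (γ i) a, γ i - min (γ i) a, min_le_right _ _, by omega, ?_⟩
    ext l
    by_cases hl : l = i
    · subst hl; simp [pairExp]
    · have := h l
      simp [pairExp, hl] at this ⊢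
      exact this
  · have hi := h i
    have hj := h j
    simp [pairExp, hij, Ne.symm hij] at hi hj
    refine ⟨γ i, γ j, hi, hj, ?_⟩
    ext l
    by_cases hl : l = i
    · subst hl; simp [pairExp, hij]
    · by_cases hl' : l = j
      · subst hl'; simp [pairExp, hl]
      · have := h l
        simp [pairExp, hl, hl'] at this ⊢
        exact this

theorem pairExp_lt {i j : Fin n} {a b e N : ℕ} (ha : 0 < a + e) (hb : 0 < b + e)
    (hea : i = j → 0 < e) (hN : a + b + e = N) (l : Fin n) :
    pairExp i j a b l < N := by
  simp only [pairExp, Pi.add_apply, Pi.single_apply]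
  split_ifs with h1 h2 h2
  · have := hea (h1.symm.trans h2)
    omega
  all_goals omega

section Move

variable {z q u w : Fin n} {h : ℕ}

/-- The relation `x_z ^ h x_q = x_u x_w y ^ (h - 1)` is not minimal on its own: both sides
properly contain a monomial of the degree of a critical power. -/
theorem IsCritical.move_pair (hc : IsCritical d p c) (hh : 2 ≤ h) (hzq : z ≠ q)
    (hzu : z ≠ u) (hzw : z ≠ w) (hrel : h * d z + d q = d u + d w) :
    (∃ i a b, i ≠ p ∧ a ≤ h ∧ b ≤ 1 ∧ a + b = c i ∧ a * d z + b * d q = c i * d i ∧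
      a + b < h + 1) ∧
    (∃ i a b e, i ≠ p ∧ a ≤ 1 ∧ b ≤ 1 ∧ a + b + e = c i ∧ a * d u + b * d w = c i * d i ∧
      a + b + e < h + 1) := by
  have hne : pairExp z q h 1 ≠ pairExp u w 1 1 := by
    intro h1
    have h2 := congrFun h1 z
    simp [pairExp, hzq, hzu, hzw] at h2
    omega
  have hlt1 : ∀ i, pairExp z q h 1 i < ∑ j, pairExp z q h 1 j + 0 := by
    intro i
    rw [sum_pairExp]
    exact pairExp_lt (e := 0) (by omega) (by omega) (fun h => absurd h hzq) rfl i
  have hlt2 : ∀ i, pairExp u w 1 1 i < ∑ j, pairExp u w 1 1 j + (h - 1) := by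
    intro i
    rw [sum_pairExp]
    exact pairExp_lt (e := h - 1) (by omega) (by omega) (by omega) rfl i
  have hs : ∑ j, pairExp z q h 1 j + 0 = ∑ j, pairExp u w 1 1 j + (h - 1) := by
    rw [sum_pairExp, sum_pairExp]; omega
  have hw : ∑ j, pairExp z q h 1 j * d j = ∑ j, pairExp u w 1 1 j * d j := by
    rw [sum_pairExp_mul, sum_pairExp_mul]; linarith
  constructor
  · obtain ⟨i, γ, g, hi, hγ, hg, h1, h2, h3⟩ := hc.move _ _ _ _ hs hw hne hlt1 hlt2
      (by rw [sum_pairExp]; omega) (by rw [sum_pairExp]; omega)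
    obtain ⟨a, b, ha, hb, rfl⟩ := eq_pairExp_of_le hγ
    rw [sum_pairExp] at h1 h3
    rw [sum_pairExp] at h3
    rw [sum_pairExp_mul] at h2
    exact ⟨i, a, b, hi, ha, hb, by omega, h2, by omega⟩
  · obtain ⟨i, γ, g, hi, hγ, hg, h1, h2, h3⟩ := hc.move _ _ _ _ hs.symm hw.symm hne.symm hlt2 hlt1
      (by rw [sum_pairExp]; omega) (by rw [sum_pairExp]; omega)
    obtain ⟨a, b, ha, hb, rfl⟩ := eq_pairExp_of_le hγ
    rw [sum_pairExp] at h1 h3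
    rw [sum_pairExp] at h3
    rw [sum_pairExp_mul] at h2
    exact ⟨i, a, b, g, hi, ha, hb, h1, h2, by omega⟩

/-- A critical relation of `x_z` in degree at most `h` only involves weights at most `h d z`. -/
theorem CritRel.eq_zero_of_lt {M : Fin n → ℕ} (hM : CritRel d c z M) (hcz : c z ≤ h) {j : Fin n}
    (hj : h * d z < d j) : M j = 0 := by
  by_contra h0
  have h1 : M j * d j ≤ ∑ l, M l * d l :=
    Finset.single_le_sum (f := fun l => M l * d l) (fun _ _ => Nat.zero_le _) (Finset.mem_univ j)
  rw [hM.wt] at h1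
  have h2 : 1 * d j ≤ M j * d j := Nat.mul_le_mul_right _ (by omega)
  have h3 : c z * d z ≤ h * d z := Nat.mul_le_mul_right _ hcz
  omega

/-- By `move`, `x_z ^ h x_q = x_u ^ 2 y ^ (h - 1)` has on its left a proper divisor `x_z ^ a x_q ^
b` of critical degree, so `d i` is a weighted mean of `d z` and `d q`. For `i = z` the relation
would need a second weight at most `h * d z`; for `i = u` the gap `d u - d z` exceeds `r`; any other
`d i` is at least `d q`, too large for a mean with `b ≤ 1`. -/
theorem IsCritical.false_of_max_last (hc : IsCritical d p c) (hpos : ∀ i, 0 < d i)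
    (hh : 2 ≤ h) (hzu : z ≠ u) (hzq : z ≠ q) {r : ℕ} (hr : 0 < r)
    (hu : d u = h * d z + r) (hq : d q = d u + r) (hz : z ≠ p)
    (hbig : ∀ i, i ≠ z → h * d z < d i) (hi : ∀ i, i ≠ p → i ≠ z → i ≠ u → d q ≤ d i) : False := by
  obtain ⟨⟨i, a, b, hip, ha, hb, hab, hwt, hlt⟩, -⟩ := hc.move_pair (p := p) hh hzq hzu hzu
    (by omega : h * d z + d q = d u + d u)
  have h2 := hc.two_le i hip
  have hdz := hpos z
  have hzh : 2 * d z ≤ h * d z := Nat.mul_le_mul_right _ hh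
  rw [← hab] at hwt
  by_cases hiz : i = z
  · subst hiz
    have hb0 : b = 0 := by
      have h3 : b * d q = b * d i := by linarith
      rcases Nat.eq_zero_or_pos b with h4 | h4
      · exact h4
      · have := Nat.eq_of_mul_eq_mul_left h4 h3
        omega
    obtain ⟨M, hM⟩ := hc.exists_rel i hip
    have h3 : ∀ j, M j = 0 := by
      intro j
      by_cases hj : j = i
      · rw [hj]; exact hM.self
      · exact hM.eq_zero_of_lt (h := h) (by omega) (hbig j hj)
    have h4 := hM.wt
    simp only [h3, zero_mul, Finset.sum_const_zero] at h4
    have : 0 < c i * d i := Nat.mul_pos (by omega) hdz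
    omega
  · by_cases hiu : i = u
    · subst hiu
      interval_cases b
      · have h3 : a * d z = a * d i := by linarith
        have := Nat.eq_of_mul_eq_mul_left (by omega) h3
        omega
      · have h3 : a * d z + r = a * d i := by nlinarith
        have h4 : a * (h * d z) + a * r = a * d z + r := by rw [h3, hu]; ring
        have h5 : 1 * r ≤ a * r := Nat.mul_le_mul_right _ (by omega)
        have h6 : a * (2 * d z) ≤ a * (h * d z) := Nat.mul_le_mul_left _ hzh
        have h7 : 0 < a * d z := Nat.mul_pos (by omega) hdz
        nlinarith
    · have h3 := hi i hip hiz hiu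
      have h4 : a * d q ≤ a * d i := Nat.mul_le_mul_left _ h3
      have h5 : b * d q ≤ b * d i := Nat.mul_le_mul_left _ h3
      have h6 : a * d z < a * d q := Nat.mul_lt_mul_of_pos_left (by omega) (by omega)
      nlinarith

/-- The arithmetic behind the case where the largest weight is the last one of the arithmetic
sequence. -/
theorem false_of_elimination {d₀ d₁ d₂ d₃ h r c₀ c₃ e a b : ℕ} (h0 : 0 < d₀)
    (hh : 0 < h) (hr : 0 < r) (h1 : d₁ = h * d₀ + r) (h2 : d₂ = d₁ + r)
    (hgcd : ∀ g, g ∣ d₀ → g ∣ d₁ → g ∣ d₂ → g ∣ d₃ → g = 1) (hc₀ : 0 < c₀) (hc₃ : 0 < c₃)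
    (he : c₀ * d₀ = e * d₃)
    (hab : a * d₁ + b * d₂ = c₃ * d₃) (hcase : (a = 1 ∧ b = 0) ∨ (a = 2 ∧ b = 0) ∨
      (a = 0 ∧ b = 1) ∨ (a = 1 ∧ b = 1))
    (H₀ : ∀ x y z t : ℤ, x * d₀ + y * d₁ + z * d₂ + t * d₃ = 0 → (c₀ : ℤ) ∣ x)
    (H₃ : ∀ y z t : ℤ, y * d₁ + z * d₂ + t * d₃ = 0 → (c₃ : ℤ) ∣ t) : False := by
  set q := Nat.gcd d₁ d₂ with hq
  set G := Nat.gcd q d₃ with hG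
  have hGpos : 0 < G := Nat.gcd_pos_of_pos_left _ (Nat.gcd_pos_of_pos_left _ (by omega))
  -- Bézout turns `H₀` into `c₀ ∣ G` and `H₃` into `c₃ ∣ q / G`, so `c₀ * c₃` divides both `d₁` and
  -- `d₂`.
  have hc0G : c₀ ∣ G := by
    obtain ⟨x, y, z, hxyz⟩ := int_gcd_three d₁ d₂ d₃
    have := H₀ G (-x * d₀) (-y * d₀) (-z * d₀) (by rw [hG, hq, hxyz]; ring)
    exact_mod_cast this
  obtain ⟨q', hq'⟩ : G ∣ q := Nat.gcd_dvd_left _ _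
  obtain ⟨t, ht⟩ : G ∣ d₃ := Nat.gcd_dvd_right _ _
  have hc3q : c₃ ∣ q' := by
    have := H₃ (-t * Nat.gcdA d₁ d₂) (-t * Nat.gcdB d₁ d₂) q' (by
      have h3 := Nat.gcd_eq_gcd_ab d₁ d₂
      rw [← hq, hq'] at h3
      rw [ht]
      push_cast at h3 ⊢
      linear_combination (t : ℤ) * h3)
    exact_mod_cast this
  have hkq : c₀ * c₃ ∣ q := by
    rw [hq']
    exact mul_dvd_mul hc0G hc3q
  obtain ⟨D₁, hD₁⟩ : c₀ * c₃ ∣ d₁ := hkq.trans (Nat.gcd_dvd_left _ _)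
  obtain ⟨D₂, hD₂⟩ : c₀ * c₃ ∣ d₂ := hkq.trans (Nat.gcd_dvd_right _ _)
  have hk : 0 < c₀ * c₃ := Nat.mul_pos hc₀ hc₃
  have hhd : 0 < h * d₀ := Nat.mul_pos hh h0
  have hd3 : d₃ = c₀ * (a * D₁ + b * D₂) := by
    apply Nat.eq_of_mul_eq_mul_left hc₃
    rw [← hab, hD₁, hD₂]
    ring
  have hd0 : d₀ = e * (a * D₁ + b * D₂) := by
    apply Nat.eq_of_mul_eq_mul_left hc₀
    rw [he, hd3]
    ring
  have hD12 : D₁ < D₂ := by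
    refine Nat.lt_of_mul_lt_mul_left (a := c₀ * c₃) ?_
    rw [← hD₁, ← hD₂]
    omega
  have hD21 : D₂ < 2 * D₁ := by
    refine Nat.lt_of_mul_lt_mul_left (a := c₀ * c₃) ?_
    calc c₀ * c₃ * D₂ = d₂ := hD₂.symm
      _ < 2 * d₁ := by omega
      _ = _ := by rw [hD₁]; ring
  -- This number divides `d₀` and `d₃`, so it is coprime to `r`. A multiple of `D₁` forces `D₁ = 1`;
  -- `D₂` would divide `2 r`, and `D₁ + D₂` would divide `3 r`. All are too small for `D₁ < D₂ < 2
  -- D₁`.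
  have hm0 : a * D₁ + b * D₂ ∣ d₀ := hd0 ▸ Dvd.intro_left _ rfl
  have hm3 : a * D₁ + b * D₂ ∣ d₃ := hd3 ▸ Dvd.intro_left _ rfl
  have hD1r : ∀ g, g ∣ d₀ → (g ∣ r ↔ g ∣ d₁) := by
    intro g hg
    rw [h1]
    exact (Nat.dvd_add_right (hg.trans (Dvd.intro_left _ rfl))).symm
  have hall : ∀ g, g ∣ d₀ → g ∣ d₃ → g ∣ r → g = 1 := by
    intro g g0 g3 gr
    have g1 := (hD1r g g0).1 gr
    exact hgcd g g0 g1 (h2 ▸ dvd_add g1 gr) g3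
  have hcase1 : D₁ ∣ a * D₁ + b * D₂ → False := by
    intro h3
    have h4 : D₁ ∣ d₁ := hD₁ ▸ Dvd.intro_left _ rfl
    have h5 := hall D₁ (h3.trans hm0) (h3.trans hm3) ((hD1r D₁ (h3.trans hm0)).2 h4)
    omega
  have hsmall : ∀ N, a * D₁ + b * D₂ ∣ N * r → 0 < N → a * D₁ + b * D₂ ≤ N := by
    intro N h3 hN
    have h4 : Nat.Coprime (a * D₁ + b * D₂) r :=
      hall _ ((Nat.gcd_dvd_left _ _).trans hm0) ((Nat.gcd_dvd_left _ _).trans hm3)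
        (Nat.gcd_dvd_right _ _)
    exact Nat.le_of_dvd hN (h4.dvd_of_dvd_mul_right h3)
  rcases hcase with ⟨rfl, rfl⟩ | ⟨rfl, rfl⟩ | ⟨rfl, rfl⟩ | ⟨rfl, rfl⟩
  · exact hcase1 (by simp)
  · exact hcase1 (by simp)
  · have h3 : 0 * D₁ + 1 * D₂ ∣ 2 * r := by
      have h4 : 0 * D₁ + 1 * D₂ ∣ h * d₀ + 2 * r := by
        have : h * d₀ + 2 * r = c₀ * c₃ * D₂ := by omega
        rw [this]
        simp
      exact (Nat.dvd_add_right (hm0.trans (Dvd.intro_left _ rfl))).1 h4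
    have := hsmall 2 h3 (by norm_num)
    omega
  · have h3 : 1 * D₁ + 1 * D₂ ∣ 3 * r := by
      have h4 : 1 * D₁ + 1 * D₂ ∣ 2 * (h * d₀) + 3 * r := by
        have : 2 * (h * d₀) + 3 * r = c₀ * c₃ * (1 * D₁ + 1 * D₂) := by
          rw [mul_add, one_mul, one_mul, ← hD₁, ← hD₂]; omega
        rw [this]
        exact Dvd.intro_left _ rfl
      exact (Nat.dvd_add_right (hm0.trans (Dvd.intro_left _
        (by ring : 2 * h * d₀ = 2 * (h * d₀))))).1 h4
    have := hsmall 3 h3 (by norm_num)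
    omega

end Move

/-- By `move` on `x_0 ^ h x_2 = x_1 ^ 2 y ^ (h - 1)`, the critical degree on the left must belong to
`x_0` and the one on the right to `x_3`. So `x_0 ^ c 0` is a power of `x_3` times one of `y`, and
`x_3 ^ c 3` a power of `x_1` times one of `y`; then `avoid` keeps `x_0` and `x_3` out of the
relation of `x_1`, and `false_of_elimination` applies. -/
theorem IsCritical.false_four {d c : Fin 4 → ℕ} (hc : IsCritical d 2 c) (hpos : ∀ i, 0 < d i)
    (hinj : Function.Injective d) (hgcd : Finset.univ.gcd d = 1) {h r : ℕ} (hh : 2 ≤ h)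
    (hr : 0 < r) (h1 : d 1 = h * d 0 + r) (h2 : d 2 = d 1 + r) (h3 : d 3 < d 2)
    (h30 : d 3 ≠ h * d 0) : False := by
  have hzh : 2 * d 0 ≤ h * d 0 := Nat.mul_le_mul_right _ hh
  have hd0 := hpos 0
  obtain ⟨⟨i, a', b', hip, ha', hb', hab', hwt', hlt'⟩, ⟨j, a, b, e, hjp, ha, hb, hab, hwt, hlt⟩⟩ :=
    hc.move_pair hh (z := 0) (q := 2) (u := 1) (w := 1) (by decide) (by decide) (by decide)
      (by omega)
  have hci := hc.two_le i hip
  have hcj := hc.two_le j hjp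
  have hab0 : 0 < a + b := by
    rcases Nat.eq_zero_or_pos (a + b) with h4 | h4
    · have : a = 0 ∧ b = 0 := by omega
      rw [this.1, this.2] at hwt
      have : 0 < c j * d j := Nat.mul_pos (by omega) (hpos j)
      omega
    · exact h4
  have hj : j = 3 := by
    have hj' : j = 0 ∨ j = 1 ∨ j = 2 ∨ j = 3 := by omega
    rcases hj' with rfl | rfl | rfl | rfl
    · have h4 : c 0 * d 0 ≤ h * d 0 := Nat.mul_le_mul_right _ (by omega)
      have h5 : 1 * d 1 ≤ (a + b) * d 1 := Nat.mul_le_mul_right _ hab0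
      rw [← hwt] at h4
      nlinarith
    -- Here `c 1 = 2`; the hypothesis `h30` excludes the one possible quadric, `x_1 ^ 2 = x_2 x_3`.
    · exfalso
      have h4 : a + b = c 1 := by
        apply Nat.eq_of_mul_eq_mul_right (hpos 1)
        rw [← hwt]; ring
      have h5 : c 1 = 2 := by omega
      obtain ⟨M, hM⟩ := hc.exists_rel 1 (by decide)
      have m1 := hM.self
      have m2 := hM.sum_le
      have m3 := hM.wt
      rw [Fin.sum_univ_four, m1, h5] at m2 m3
      have n31 : d 3 ≠ d 1 := fun h6 => absurd (hinj h6) (by decide)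
      generalize M 0 = x at m2 m3
      generalize M 2 = y at m2 m3
      generalize M 3 = w at m2 m3
      have hx : x ≤ 2 := by omega
      have hy : y ≤ 2 := by omega
      have hw : w ≤ 2 := by omega
      interval_cases x <;> interval_cases y <;> interval_cases w <;> omega
    · exact absurd rfl hjp
    · rfl
  subst hj
  have hi : i = 0 := by
    have hi' : i = 0 ∨ i = 1 ∨ i = 2 ∨ i = 3 := by omega
    rcases hi' with rfl | rfl | rfl | rfl
    · rfl
    · exfalso
      rw [← hab'] at hwt'
      interval_cases b'
      · have h3 : a' * d 0 = a' * d 1 := by linarith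
        have := Nat.eq_of_mul_eq_mul_left (by omega) h3
        omega
      · have h3 : a' * d 0 + r = a' * d 1 := by nlinarith
        have h4 : a' * (h * d 0) + a' * r = a' * d 0 + r := by rw [h3, h1]; ring
        have h5 : 1 * r ≤ a' * r := Nat.mul_le_mul_right _ (by omega)
        have h6 : a' * (2 * d 0) ≤ a' * (h * d 0) := Nat.mul_le_mul_left _ hzh
        have h7 : 0 < a' * d 0 := Nat.mul_pos (by omega) hd0
        nlinarith
    · exact absurd rfl hip
    · exfalso
      rw [← hwt] at hwt'
      have h4 : a' * d 0 ≤ h * d 0 := Nat.mul_le_mul_right _ ha'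
      interval_cases b' <;> interval_cases a <;> interval_cases b <;> try omega
      have h5 : a' * d 0 = h * d 0 := by omega
      have := Nat.eq_of_mul_eq_mul_right hd0 h5
      omega
  subst hi
  have hb0 : b' = 0 := by
    rw [← hab'] at hwt'
    have h3 : b' * d 2 = b' * d 0 := by linarith
    rcases Nat.eq_zero_or_pos b' with h4 | h4
    · exact h4
    · have := Nat.eq_of_mul_eq_mul_left h4 h3
      omega
  have hc0h : c 0 ≤ h := by omega
  choose! M hM using hc.exists_rel
  have hM0 := hM 0 (by decide)
  have m1 : M 0 1 = 0 := hM0.eq_zero_of_lt hc0h (by omega)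
  have m2 : M 0 2 = 0 := hM0.eq_zero_of_lt hc0h (by omega)
  have m0 := hM0.self
  have m3 := hM0.wt
  rw [Fin.sum_univ_four, m0, m1, m2] at m3
  have hP : CritRel d c 3 (pairExp 1 1 a b) :=
    critRel_pairExp (by decide) (by decide) (by omega) hwt
  let M' : Fin 4 → Fin 4 → ℕ := Function.update M 3 (pairExp 1 1 a b)
  have hM' : ∀ i, i ≠ 2 → CritRel d c i (M' i) := by
    intro i hi
    by_cases h4 : i = 3
    · subst h4; simpa [M'] using hP
    · simpa [M', h4] using hM i hi
  have h1av : ∀ j, j = 0 ∨ j = 3 → M' 1 j = 0 := by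
    obtain ⟨x, hx, hav⟩ := hc.avoid {0, 1, 3} (by simp) (by decide)
    simp only [Finset.mem_insert, Finset.mem_singleton] at hx
    rcases hx with rfl | rfl | rfl
    · exfalso
      have := hav _ hM0 3 (by simp)
      rw [this] at m3
      have h5 : 0 < c 0 * d 0 := Nat.mul_pos (by omega) hd0
      omega
    · intro j hj
      exact hav _ (hM' 1 (by decide)) j (by rcases hj with rfl | rfl <;> simp)
    · exfalso
      have := hav _ hP 1 (by simp)
      simp [pairExp] at this
      omega
  have k0 : M' 0 = M 0 := by simp [M']
  have k30 : M' 3 0 = 0 := by simp [M', pairExp]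
  have k33 : M' 3 3 = 0 := by simp [M', pairExp]
  have k10 := h1av 0 (Or.inl rfl)
  have k13 := h1av 3 (Or.inr rfl)
  have lat : ∀ v : Fin 4 → ℤ, ∑ j, v j * d j = 0 →
      (c 0 : ℤ) ∣ v 0 ∧ (v 0 = 0 → (c 3 : ℤ) ∣ v 3) := by
    intro v hv
    obtain ⟨l, hl⟩ := hc.lattice M' hM' v hv
    have l3 := hl 3
    have l0 := hl 0
    rw [Fin.sum_univ_four] at l3 l0
    simp [k0, m0, k30, k33, k10, k13] at l3 l0
    refine ⟨⟨l 0, by linarith⟩, fun h0 => ?_⟩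
    have h3 : l 0 = 0 := by
      rw [h0] at l0
      have h8 : (c 0 : ℤ) ≠ 0 := by positivity
      exact (mul_eq_zero.1 l0.symm).resolve_right h8
    rw [h3] at l3
    exact ⟨l 3, by linarith⟩
  have hg : ∀ g, g ∣ d 0 → g ∣ d 1 → g ∣ d 2 → g ∣ d 3 → g = 1 := by
    intro g g0 g1 g2 g3
    have : g ∣ Finset.univ.gcd d := Finset.dvd_gcd fun i _ => by
      have hi' : i = 0 ∨ i = 1 ∨ i = 2 ∨ i = 3 := by omega
      rcases hi' with rfl | rfl | rfl | rfl <;> assumption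
    rw [hgcd] at this
    exact Nat.dvd_one.1 this
  refine false_of_elimination (c₀ := c 0) (a := a + b) (b := 0) hd0 (by omega) hr h1 h2 hg
      (by omega) (by omega)
    (e := M 0 3) (by omega) (c₃ := c 3) (by linarith) (by omega) ?_ ?_
  · intro x y z t hxyz
    have := (lat ![x, y, z, t] (by rw [Fin.sum_univ_four]; simpa using hxyz)).1
    simpa using this
  · intro y z t hyz
    have := (lat ![0, y, z, t] (by rw [Fin.sum_univ_four]; simpa using hyz)).2 (by simp)
    simpa using this

/-- The pattern is that of `false_four`, applied to `x_0 ^ h x_3 = x_1 x_2 y ^ (h - 1)`, with `x_4`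
in the role of `x_3` and the additional critical quadric `x_2 ^ 2 = x_1 x_3`. -/
theorem IsCritical.false_five {d c : Fin 5 → ℕ} (hc : IsCritical d 3 c) (hpos : ∀ i, 0 < d i)
    (hgcd : Finset.univ.gcd d = 1) {h r : ℕ} (hh : 2 ≤ h)
    (hr : 0 < r) (h1 : d 1 = h * d 0 + r) (h2 : d 2 = d 1 + r) (h3 : d 3 = d 2 + r) : False := by
  have hzh : 2 * d 0 ≤ h * d 0 := Nat.mul_le_mul_right _ hh
  have hd0 := hpos 0
  obtain ⟨⟨i, a', b', hip, ha', hb', hab', hwt', hlt'⟩, ⟨j, a, b, e, hjp, ha, hb, hab, hwt, hlt⟩⟩ :=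
    hc.move_pair hh (z := 0) (q := 3) (u := 1) (w := 2) (by decide) (by decide) (by decide)
      (by omega)
  have hci := hc.two_le i hip
  have hcj := hc.two_le j hjp
  have hP2 := hc.critRel_pair (i := 2) (j := 1) (l := 3) (by decide) (by decide) (by decide)
    (by omega)
  have hc2 := hc.eq_two (i := 2) (j := 1) (l := 3) (by decide) (by decide) (by decide) (by omega)
  have hav12 : ∀ M, CritRel d c 1 M → M 2 = 0 := by
    intro M hM
    obtain ⟨x, hx, hav⟩ := hc.avoid {1, 2} (by simp) (by decide)
    rw [Finset.mem_insert, Finset.mem_singleton] at hx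
    rcases hx with rfl | rfl
    · exact hav M hM 2 (by simp)
    · have := hav _ hP2 1 (by simp)
      simp [pairExp] at this
  have hab0 : 0 < a + b := by
    rcases Nat.eq_zero_or_pos (a + b) with h4 | h4
    · have : a = 0 ∧ b = 0 := by omega
      rw [this.1, this.2] at hwt
      have : 0 < c j * d j := Nat.mul_pos (by omega) (hpos j)
      omega
    · exact h4
  have hj : j = 4 := by
    have hj' : j = 0 ∨ j = 1 ∨ j = 2 ∨ j = 3 ∨ j = 4 := by omega
    rcases hj' with rfl | rfl | rfl | rfl | rfl
    · have h4 : c 0 * d 0 ≤ h * d 0 := Nat.mul_le_mul_right _ (by omega)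
      rw [← hwt] at h4
      interval_cases a <;> interval_cases b <;> omega
    · exfalso
      have h5 : CritRel d c 1 (pairExp 3 2 0 b) → b = 0 := fun hM => by
        simpa [pairExp] using hav12 _ hM
      interval_cases a
      · have := h5 (critRel_pairExp (by decide) (by decide) (by omega) (by linarith))
        omega
      · interval_cases b
        · have : 1 = c 1 := by
            apply Nat.eq_of_mul_eq_mul_right (hpos 1)
            linarith
          omega
        · have := hc.min 1 (by decide) (c 1 - 1) (by omega) (pairExp 3 2 0 1)
            (by simp [pairExp]) (by rw [sum_pairExp]; omega) (by
              rw [sum_pairExp_mul, Nat.sub_mul]; omega)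
          omega
    · exfalso
      rw [hc2] at hwt
      interval_cases a <;> interval_cases b <;> omega
    · exact absurd rfl hjp
    · rfl
  subst hj
  have hP4 : CritRel d c 4 (pairExp 1 2 a b) :=
    critRel_pairExp (by decide) (by decide) (by omega) hwt
  choose! M hM using hc.exists_rel
  -- The exceptional case `d 0 + d 3 = 2 * d 1`, where `x_1 ^ 2 = x_0 x_3` is critical. Then `d 1 =
  -- (2 h - 1) * d 0`, and this relation has coordinate `1` at `x_1`, while the lattice makes that
  -- coordinate even once `l 2` and `l 4` vanish.
  have hspecial : ¬ (c 1 = 2 ∧ r + d 0 = h * d 0) := by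
    rintro ⟨hc1, hrh⟩
    have hP1 := hc.critRel_pair (i := 1) (j := 0) (l := 3) (by decide) (by decide) (by decide)
      (by omega)
    let M' : Fin 5 → Fin 5 → ℕ := Function.update (Function.update (Function.update M
      1 (pairExp 0 3 1 1)) 2 (pairExp 1 3 1 1)) 4 (pairExp 1 2 a b)
    have hM' : ∀ i, i ≠ 3 → CritRel d c i (M' i) := by
      intro i hi
      have hi' : i = 0 ∨ i = 1 ∨ i = 2 ∨ i = 4 := by omega
      rcases hi' with rfl | rfl | rfl | rfl
      · simpa [M'] using hM 0 (by decide)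
      · simpa [M'] using hP1
      · simpa [M'] using hP2
      · simpa [M'] using hP4
    have h0av : ∀ j, j = 1 ∨ j = 2 ∨ j = 4 → M' 0 j = 0 := by
      obtain ⟨x, hx, hav⟩ := hc.avoid {0, 1, 2, 4} (by simp) (by decide)
      simp only [Finset.mem_insert, Finset.mem_singleton] at hx
      rcases hx with rfl | rfl | rfl | rfl
      · intro j hj
        exact hav _ (hM' 0 (by decide)) j (by rcases hj with rfl | rfl | rfl <;> simp)
      · have := hav _ hP1 0 (by simp)
        simp [pairExp] at this
      · have := hav _ hP2 1 (by simp)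
        simp [pairExp] at this
      · have k1 := hav _ hP4 1 (by simp)
        have k2 := hav _ hP4 2 (by simp)
        simp [pairExp] at k1 k2
        omega
    obtain ⟨l, hl⟩ := hc.lattice M' hM' ![-(2 * h - 1 : ℤ), 1, 0, 0, 0] (by
      rw [Fin.sum_univ_five]
      simp
      have : (d 1 : ℤ) = h * d 0 + r := by exact_mod_cast h1
      have h5 : (r : ℤ) + d 0 = h * d 0 := by exact_mod_cast hrh
      linarith)
    have l1 := hl 1
    have l2 := hl 2
    have l4 := hl 4
    rw [Fin.sum_univ_five] at l1 l2 l4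
    simp only [h0av 1 (by simp), h0av 2 (by simp), h0av 4 (by simp)] at l1 l2 l4
    simp [M', pairExp, hc1, hc2] at l1 l2 l4
    have k4 : l 4 = 0 := l4.resolve_right (by
      have := hc.two_le 4 (by decide)
      omega)
    rw [k4] at l1 l2
    omega
  have hi : i = 0 := by
    have hi' : i = 0 ∨ i = 1 ∨ i = 2 ∨ i = 3 ∨ i = 4 := by omega
    rcases hi' with rfl | rfl | rfl | rfl | rfl
    · rfl
    · exfalso
      rw [← hab'] at hwt'
      interval_cases b'
      · have h3 : a' * d 0 = a' * d 1 := by linarith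
        have := Nat.eq_of_mul_eq_mul_left (by omega) h3
        omega
      · have h4 : a' * d 0 + 2 * r = a' * d 1 := by nlinarith
        have h5 : a' * (h * d 0) + a' * r = a' * d 0 + 2 * r := by rw [h4, h1]; ring
        have h6 : a' * (2 * d 0) ≤ a' * (h * d 0) := Nat.mul_le_mul_left _ hzh
        have h7 : 0 < a' * d 0 := Nat.mul_pos (by omega) hd0
        have h8 : a' = 1 := by
          by_contra h9
          have h10 : 2 * r ≤ a' * r := Nat.mul_le_mul_right _ (by omega)
          nlinarith
        rw [h8] at h5 hab'
        exact hspecial ⟨hab'.symm, by omega⟩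
    · exfalso
      rw [hc2] at hwt' hab'
      interval_cases b'
      · have : a' = 2 := by omega
        subst this
        omega
      · have : a' = 1 := by omega
        subst this
        omega
    · exact absurd rfl hip
    · exfalso
      rw [← hwt] at hwt'
      have h4 : a' * d 0 ≤ h * d 0 := Nat.mul_le_mul_right _ ha'
      interval_cases b' <;> interval_cases a <;> interval_cases b <;> try omega
      have h5 : a' * d 0 = h * d 0 := by omega
      have := Nat.eq_of_mul_eq_mul_right hd0 h5
      omega
  subst hi
  have hb0 : b' = 0 := by
    rw [← hab'] at hwt'
    have h3 : b' * d 3 = b' * d 0 := by linarith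
    rcases Nat.eq_zero_or_pos b' with h4 | h4
    · exact h4
    · have := Nat.eq_of_mul_eq_mul_left h4 h3
      omega
  have hc0h : c 0 ≤ h := by omega
  have hM0 := hM 0 (by decide)
  have m1 : M 0 1 = 0 := hM0.eq_zero_of_lt hc0h (by omega)
  have m2 : M 0 2 = 0 := hM0.eq_zero_of_lt hc0h (by omega)
  have m3 : M 0 3 = 0 := hM0.eq_zero_of_lt hc0h (by omega)
  have m0 := hM0.self
  have m4 := hM0.wt
  rw [Fin.sum_univ_five, m0, m1, m2, m3] at m4
  let M' : Fin 5 → Fin 5 → ℕ := Function.update (Function.update M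
    2 (pairExp 1 3 1 1)) 4 (pairExp 1 2 a b)
  have hM' : ∀ i, i ≠ 3 → CritRel d c i (M' i) := by
    intro i hi
    have hi' : i = 0 ∨ i = 1 ∨ i = 2 ∨ i = 4 := by omega
    rcases hi' with rfl | rfl | rfl | rfl
    · simpa [M'] using hM 0 (by decide)
    · simpa [M'] using hM 1 (by decide)
    · simpa [M'] using hP2
    · simpa [M'] using hP4
  have h1av : ∀ j, j = 0 ∨ j = 4 → M' 1 j = 0 := by
    obtain ⟨x, hx, hav⟩ := hc.avoid {0, 1, 2, 4} (by simp) (by decide)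
    simp only [Finset.mem_insert, Finset.mem_singleton] at hx
    rcases hx with rfl | rfl | rfl | rfl
    · exfalso
      have := hav _ hM0 4 (by simp)
      rw [this] at m4
      have h5 : 0 < c 0 * d 0 := Nat.mul_pos (by omega) hd0
      omega
    · intro j hj
      exact hav _ (hM' 1 (by decide)) j (by rcases hj with rfl | rfl <;> simp)
    · have := hav _ hP2 1 (by simp)
      simp [pairExp] at this
    · exfalso
      have k1 := hav _ hP4 1 (by simp)
      have k2 := hav _ hP4 2 (by simp)
      simp [pairExp] at k1 k2
      omega
  have k0 : M' 0 = M 0 := by simp [M']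
  have k20 : M' 2 0 = 0 := by simp [M', pairExp]
  have k24 : M' 2 4 = 0 := by simp [M', pairExp]
  have k40 : M' 4 0 = 0 := by simp [M', pairExp]
  have k44 : M' 4 4 = 0 := by simp [M', pairExp]
  have k10 := h1av 0 (Or.inl rfl)
  have k14 := h1av 4 (Or.inr rfl)
  have lat : ∀ v : Fin 5 → ℤ, ∑ j, v j * d j = 0 →
      (c 0 : ℤ) ∣ v 0 ∧ (v 0 = 0 → (c 4 : ℤ) ∣ v 4) := by
    intro v hv
    obtain ⟨l, hl⟩ := hc.lattice M' hM' v hv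
    have l4 := hl 4
    have l0 := hl 0
    rw [Fin.sum_univ_five] at l4 l0
    simp [k0, m0, k20, k24, k40, k44, k10, k14] at l4 l0
    refine ⟨⟨l 0, by linarith⟩, fun h0 => ?_⟩
    have h3 : l 0 = 0 := by
      rw [h0] at l0
      have h8 : (c 0 : ℤ) ≠ 0 := by positivity
      exact (mul_eq_zero.1 l0.symm).resolve_right h8
    rw [h3] at l4
    exact ⟨l 4, by linarith⟩
  have hg : ∀ g, g ∣ d 0 → g ∣ d 1 → g ∣ d 2 → g ∣ d 4 → g = 1 := by
    intro g g0 g1 g2 g4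
    have g3 : g ∣ d 3 := by
      have h5 : g ∣ d 1 + d 3 := by
        have : d 1 + d 3 = 2 * d 2 := by omega
        rw [this]; exact g2.trans (Dvd.intro_left _ rfl)
      exact (Nat.dvd_add_right g1).1 h5
    have : g ∣ Finset.univ.gcd d := Finset.dvd_gcd fun i _ => by
      have hi' : i = 0 ∨ i = 1 ∨ i = 2 ∨ i = 3 ∨ i = 4 := by omega
      rcases hi' with rfl | rfl | rfl | rfl | rfl <;> assumption
    rw [hgcd] at this
    exact Nat.dvd_one.1 this
  refine false_of_elimination (c₀ := c 0) (a := a) (b := b) hd0 (by omega) hr h1 h2 hg (by omega)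
      (by omega)
    (e := M 0 4) (by omega) (c₃ := c 4) hwt (by omega) ?_ ?_
  · intro x y z t hxyz
    have := (lat ![x, y, z, 0, t] (by rw [Fin.sum_univ_five]; simpa using hxyz)).1
    simpa using this
  · intro y z t hyz
    have := (lat ![0, y, z, 0, t] (by rw [Fin.sum_univ_five]; simpa using hyz)).2 (by simp)
    simpa using this

end ToricCI

end

/-! ### Counting relations through the reduction steps. -/

noncomputable section

namespace ToricCI

open MvPolynomial

section Gen

variable {m : ℕ}

/-- The degree of the monomial `∏ x_v ^ α v`, where `x_v` has degree `v`. -/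
abbrev vdeg : ((Fin m → ℕ) →₀ ℕ) →ₗ[ℕ] (Fin m → ℕ) := Finsupp.linearCombination ℕ id

/-- The monomials in the variables `x_v`, `v ∈ B`. -/
abbrev suppIn (B : Finset (Fin m → ℕ)) : Submodule ℕ ((Fin m → ℕ) →₀ ℕ) :=
  Finsupp.supported ℕ ℕ (B : Set (Fin m → ℕ))

/-- The congruence generated by a set of pairs of monomials. -/
abbrev pairCon (S : Finset (((Fin m → ℕ) →₀ ℕ) × ((Fin m → ℕ) →₀ ℕ))) :
    AddCon ((Fin m → ℕ) →₀ ℕ) := addConGen fun α β => (α, β) ∈ S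

/-- The pairs in `S` are relations between the elements of `B` and generate all of them. -/
structure Generates (B : Finset (Fin m → ℕ))
    (S : Finset (((Fin m → ℕ) →₀ ℕ) × ((Fin m → ℕ) →₀ ℕ))) : Prop where
  left_mem : ∀ s ∈ S, s.1 ∈ suppIn B
  right_mem : ∀ s ∈ S, s.2 ∈ suppIn B
  deg_eq : ∀ s ∈ S, vdeg s.1 = vdeg s.2
  con : ∀ α ∈ suppIn B, ∀ β ∈ suppIn B, vdeg α = vdeg β → pairCon S α β

variable {B : Finset (Fin m → ℕ)} {b : Fin m → ℕ}
  {S S' : Finset (((Fin m → ℕ) →₀ ℕ) × ((Fin m → ℕ) →₀ ℕ))}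

theorem pairCon_mono (h : S ⊆ S') : pairCon S ≤ pairCon S' :=
  AddCon.addConGen_mono fun _ _ hs => h hs

theorem pairCon_of_mem {α β : (Fin m → ℕ) →₀ ℕ} (h : (α, β) ∈ S) : pairCon S α β :=
  AddConGen.Rel.of _ _ h

theorem suppIn_mono {B' : Finset (Fin m → ℕ)} (h : B ⊆ B') : suppIn B ≤ suppIn B' :=
  Finsupp.supported_mono (by exact_mod_cast h)

theorem single_mem_suppIn (hb : b ∈ B) (c : ℕ) : Finsupp.single b c ∈ suppIn B :=
  Finsupp.single_mem_supported ℕ c hb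

theorem erase_mem_suppIn {α : (Fin m → ℕ) →₀ ℕ} (hα : α ∈ suppIn (insert b B)) :
    α.erase b ∈ suppIn B := by
  rw [Finsupp.mem_supported] at hα ⊢
  intro v hv
  rw [Finsupp.support_erase, Finset.coe_erase] at hv
  have := hα hv.1
  rw [Finset.coe_insert] at this
  exact this.resolve_left hv.2

/-- Replacing `c` copies of `b` by `M` reduces the exponent of `b` to its residue modulo `c`. Two
monomials of the same degree have equal residues, which cancel and leave a relation over `B`. -/
theorem con_insert (hS : Generates B S) (hSS : S ⊆ S') {c : ℕ} {M : (Fin m → ℕ) →₀ ℕ}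
    (hM : M ∈ suppIn B) (hdeg : vdeg (Finsupp.single b c) = vdeg M)
    (hcM : pairCon S' (Finsupp.single b c) M)
    (hmod : ∀ α ∈ suppIn (insert b B), ∀ β ∈ suppIn (insert b B), vdeg α = vdeg β →
      α b % c = β b % c) :
    ∀ α ∈ suppIn (insert b B), ∀ β ∈ suppIn (insert b B), vdeg α = vdeg β → pairCon S' α β := by
  have key : ∀ α ∈ suppIn (insert b B), ∃ α' ∈ suppIn B,
      pairCon S' α (Finsupp.single b (α b % c) + α') ∧
      vdeg α = vdeg (Finsupp.single b (α b % c) + α') := by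
    intro α hα
    have h1 : α = Finsupp.single b (α b % c) +
        ((α b / c) • Finsupp.single b c + α.erase b) := by
      rw [← add_assoc, Finsupp.smul_single, smul_eq_mul, ← Finsupp.single_add, mul_comm,
        Nat.mod_add_div, Finsupp.single_add_erase]
    refine ⟨(α b / c) • M + α.erase b, add_mem (Submodule.smul_mem _ _ hM) (erase_mem_suppIn hα),
      ?_, ?_⟩
    · have h2 : pairCon S' (Finsupp.single b (α b % c) +
          ((α b / c) • Finsupp.single b c + α.erase b))
          (Finsupp.single b (α b % c) + ((α b / c) • M + α.erase b)) :=
        AddCon.add _ (AddCon.refl _ _) (AddCon.add _ (AddCon.nsmul _ _ hcM) (AddCon.refl _ _))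
      rwa [← h1] at h2
    · conv_lhs => rw [h1]
      rw [map_add, map_add, map_smul, hdeg, map_add, map_add, map_smul]
  intro α hα β hβ h
  obtain ⟨α', hα', hc, hd⟩ := key α hα
  obtain ⟨β', hβ', hc', hd'⟩ := key β hβ
  have h1 := hmod α hα β hβ h
  rw [h1] at hc hd
  have h2 : vdeg α' = vdeg β' := by
    rw [hd, hd', map_add, map_add] at h
    exact add_left_cancel h
  have h3 := pairCon_mono hSS (hS.con α' hα' β' hβ' h2)
  exact (AddCon.trans _ hc (AddCon.add _ (AddCon.refl _ _) h3)).trans (AddCon.symm _ hc')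

theorem Generates.insert_free (hS : Generates B S)
    (hfree : ∀ α ∈ suppIn (insert b B), ∀ β ∈ suppIn (insert b B), vdeg α = vdeg β → α b = β b) :
    Generates (insert b B) S where
  left_mem s hs := suppIn_mono (Finset.subset_insert _ _) (hS.left_mem s hs)
  right_mem s hs := suppIn_mono (Finset.subset_insert _ _) (hS.right_mem s hs)
  deg_eq := hS.deg_eq
  -- With `c = 0`, `x % 0 = x` turns the congruence into equality of exponents, and `M = 0` makes
  -- the rewriting trivial.
  con := con_insert hS le_rfl (c := 0) (M := 0) (zero_mem _) (by simp)
    (by rw [Finsupp.single_zero]; exact AddCon.refl _ _)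
    fun α hα β hβ h => by rw [hfree α hα β hβ h]

theorem Generates.insert_pair (hS : Generates B S) {c : ℕ} {M : (Fin m → ℕ) →₀ ℕ}
    (hM : M ∈ suppIn B) (hdeg : vdeg (Finsupp.single b c) = vdeg M)
    (hmod : ∀ α ∈ suppIn (insert b B), ∀ β ∈ suppIn (insert b B), vdeg α = vdeg β →
      α b % c = β b % c) :
    ∃ S', S'.card ≤ S.card + 1 ∧ Generates (insert b B) S' := by
  classical
  refine ⟨insert (Finsupp.single b c, M) S, Finset.card_insert_le _ _, ?_, ?_, ?_, ?_⟩
  · intro s hs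
    rcases Finset.mem_insert.1 hs with rfl | hs
    · exact single_mem_suppIn (Finset.mem_insert_self _ _) _
    · exact suppIn_mono (Finset.subset_insert _ _) (hS.left_mem s hs)
  · intro s hs
    rcases Finset.mem_insert.1 hs with rfl | hs
    · exact suppIn_mono (Finset.subset_insert _ _) hM
    · exact suppIn_mono (Finset.subset_insert _ _) (hS.right_mem s hs)
  · intro s hs
    rcases Finset.mem_insert.1 hs with rfl | hs
    · exact hdeg
    · exact hS.deg_eq s hs
  · exact con_insert hS (Finset.subset_insert _ _) hM hdeg
      (pairCon_of_mem (Finset.mem_insert_self _ _)) hmod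

/-- The cast of a vector of natural numbers. -/
def castVec (R : Type*) [CommRing R] (v : Fin m → ℕ) (j : Fin m) : R := (v j : R)

theorem sum_sub_smul_castVec (R : Type*) [CommRing R] {α β : (Fin m → ℕ) →₀ ℕ} (hα : α ∈ suppIn B)
    (hβ : β ∈ suppIn B) (h : vdeg α = vdeg β) :
    ∑ v ∈ B, ((α v : R) - β v) • castVec R v = 0 := by
  have h1 : ∀ α ∈ suppIn B, castVec R (vdeg α) = ∑ v ∈ B, (α v : R) • castVec R v := by
    intro α hα
    have hs : α.support ⊆ B := by rw [Finsupp.mem_supported] at hα; exact_mod_cast hα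
    rw [Finsupp.linearCombination_apply, Finsupp.sum_of_support_subset _ hs _ (by simp)]
    ext j
    simp [castVec, Finset.sum_apply]
  simp only [sub_smul, Finset.sum_sub_distrib]
  rw [← h1 α hα, ← h1 β hβ, h, sub_self]

theorem sub_smul_castVec_mem (R : Type*) [CommRing R] {α β : (Fin m → ℕ) →₀ ℕ}
    (hα : α ∈ suppIn B) (hβ : β ∈ suppIn B) (h : vdeg α = vdeg β) (hb : b ∈ B) :
    ((α b : R) - β b) • castVec R b ∈
      Submodule.span R (castVec R '' ((B.erase b : Finset (Fin m → ℕ)) : Set (Fin m → ℕ))) := by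
  have h1 := sum_sub_smul_castVec R hα hβ h
  rw [← Finset.add_sum_erase _ _ hb, add_eq_zero_iff_eq_neg] at h1
  rw [h1]
  refine neg_mem (Submodule.sum_mem _ fun v hv => Submodule.smul_mem _ _ ?_)
  exact Submodule.subset_span ⟨v, Finset.mem_coe.2 hv, rfl⟩

/-- A common divisor of the coordinates of the other vectors divides the coordinate of
every relation at `b`. -/
theorem dvd_sub_mul_of_vdeg_eq {α β : (Fin m → ℕ) →₀ ℕ} (hα : α ∈ suppIn B) (hβ : β ∈ suppIn B)
    (h : vdeg α = vdeg β) (hb : b ∈ B) (j : Fin m) (G : ℤ) (hG : ∀ v ∈ B.erase b, G ∣ (v j : ℤ)) :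
    G ∣ ((α b : ℤ) - β b) * b j := by
  have h1 := congrFun (sum_sub_smul_castVec ℤ hα hβ h) j
  rw [Finset.sum_apply, ← Finset.add_sum_erase _ _ hb, Pi.zero_apply,
    add_eq_zero_iff_eq_neg] at h1
  have h2 : ((α b : ℤ) - β b) * b j =
      -∑ v ∈ B.erase b, (((α v : ℤ) - β v) • castVec ℤ v) j := h1
  rw [h2, dvd_neg]
  exact Finset.dvd_sum fun v hv => Dvd.dvd.mul_left (hG v hv) _

theorem ratSpan_eq : ratSpan B = Submodule.span ℚ (castVec ℚ '' (B : Set (Fin m → ℕ))) := rfl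

theorem intSpan_eq : intSpan B = Submodule.span ℤ (castVec ℤ '' (B : Set (Fin m → ℕ))) := rfl

theorem castVec_mem_of_mem_natSpan (R : Type*) [CommRing R] {x : Fin m → ℕ} (hx : x ∈ natSpan B) :
    castVec R x ∈ Submodule.span R (castVec R '' (B : Set (Fin m → ℕ))) := by
  rw [natSpan] at hx
  induction hx using Submodule.span_induction with
  | mem x hx => exact Submodule.subset_span ⟨x, hx, rfl⟩
  | zero =>
    have : castVec R (0 : Fin m → ℕ) = 0 := by ext j; simp [castVec]
    rw [this]; exact zero_mem _
  | add x y _ _ hx hy =>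
    have : castVec R (x + y) = castVec R x + castVec R y := by ext j; simp [castVec]
    rw [this]; exact add_mem hx hy
  | smul c x _ hx =>
    have : castVec R (c • x) = (c : R) • castVec R x := by ext j; simp [castVec]
    rw [this]; exact Submodule.smul_mem _ _ hx

/-- The remainder of the difference modulo `c` also multiplies `b` into the integer span of the
others; since `c` is least, it is zero. -/
theorem mod_eq_of_isLeast {c : ℕ} (hb : b ∈ B)
    (hc : IsLeast {c : ℕ | 0 < c ∧ (fun j => (c : ℤ) * (b j : ℤ)) ∈ intSpan (B.erase b)} c)
    {α β : (Fin m → ℕ) →₀ ℕ} (hα : α ∈ suppIn B) (hβ : β ∈ suppIn B) (h : vdeg α = vdeg β) :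
    α b % c = β b % c := by
  obtain ⟨⟨hcpos, hcmem⟩, hcl⟩ := hc
  have h1 := sub_smul_castVec_mem ℤ hα hβ h hb
  rw [← intSpan_eq] at h1
  have h2 : (fun j => (c : ℤ) * (b j : ℤ)) = (c : ℤ) • castVec ℤ b := rfl
  rw [h2] at hcmem
  have hmem : (((α b : ℤ) - β b) % c) • castVec ℤ b ∈ intSpan (B.erase b) := by
    rw [Int.emod_def, sub_smul]
    refine sub_mem h1 ?_
    rw [mul_comm, mul_smul]
    exact Submodule.smul_mem _ _ hcmem
  have hnn : 0 ≤ ((α b : ℤ) - β b) % c := Int.emod_nonneg _ (by positivity)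
  have hlt : ((α b : ℤ) - β b) % c < c := Int.emod_lt_of_pos _ (by exact_mod_cast hcpos)
  obtain ⟨e, he⟩ := Int.eq_ofNat_of_zero_le hnn
  rw [he] at hmem hlt
  have h0 : e = 0 := by
    by_contra hne
    have : c ≤ e := hcl ⟨Nat.pos_of_ne_zero hne, hmem⟩
    omega
  rw [h0] at he
  have h3 : (c : ℤ) ∣ (α b : ℤ) - β b := Int.dvd_of_emod_eq_zero (by simpa using he)
  exact ((Nat.modEq_iff_dvd.2 h3).symm : α b ≡ β b [MOD c])

/-- The relations between the elements of `B` are generated by `#B - rank B` of them. -/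
def HasCIPairs (B : Finset (Fin m → ℕ)) : Prop :=
  ∃ S, Generates B S ∧ S.card + Module.finrank ℚ (ratSpan B) ≤ B.card

theorem exists_mem_suppIn_of_mem_natSpan {x : Fin m → ℕ} (hx : x ∈ natSpan B) :
    ∃ M ∈ suppIn B, vdeg M = x := by
  have h : natSpan B = (suppIn B).map vdeg := by
    rw [natSpan, ← Finsupp.span_image_eq_map_linearCombination, Set.image_id]
  rw [h] at hx
  exact hx

/-- Substituting `c` copies of `b` for the new vector, via `τ`, carries relations back to `B`. They
suffice because both sides of a relation have the same residual exponent of `b` modulo `c`. -/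
theorem Generates.scale {c : ℕ} (hb : b ∈ B) (hcb : c • b ∉ B.erase b)
    (hS : Generates (insert (c • b) (B.erase b)) S)
    (hmod : ∀ α ∈ suppIn B, ∀ β ∈ suppIn B, vdeg α = vdeg β → α b % c = β b % c) :
    ∃ S', S'.card ≤ S.card ∧ Generates B S' := by
  classical
  let τ : ((Fin m → ℕ) →₀ ℕ) →ₗ[ℕ] ((Fin m → ℕ) →₀ ℕ) :=
    Finsupp.linearCombination ℕ fun v => if v = c • b then Finsupp.single b c
      else Finsupp.single v 1
  have hτdeg : ∀ α, vdeg (τ α) = vdeg α := by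
    intro α
    have : vdeg ∘ₗ τ = vdeg (m := m) := by
      ext v : 2
      simp only [τ, LinearMap.comp_apply, Finsupp.lsingle_apply, Finsupp.linearCombination_single,
        one_smul]
      split_ifs with hv <;> simp [hv]
    exact LinearMap.congr_fun this α
  have hτmem : ∀ α ∈ suppIn (insert (c • b) (B.erase b)), τ α ∈ suppIn B := by
    intro α hα
    rw [Finsupp.mem_supported] at hα
    rw [Finsupp.linearCombination_apply]
    refine Submodule.sum_mem _ fun v hv => Submodule.smul_mem _ _ ?_
    have hv' := hα hv
    rw [Finset.coe_insert] at hv'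
    split_ifs with h1
    · exact single_mem_suppIn hb _
    · exact single_mem_suppIn (Finset.mem_of_mem_erase (hv'.resolve_left h1)) _
  have hτid : ∀ α ∈ suppIn (B.erase b), τ α = α := by
    intro α hα
    rw [Finsupp.mem_supported] at hα
    conv_rhs => rw [← Finsupp.sum_single α]
    rw [Finsupp.linearCombination_apply]
    refine Finsupp.sum_congr fun v hv => ?_
    rw [if_neg]
    · simp
    · rintro rfl
      exact hcb (Finset.mem_coe.1 (hα hv))
  have hcon : ∀ α β, pairCon S α β → pairCon (S.image (Prod.map τ τ)) (τ α) (τ β) := by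
    have h1 : pairCon S ≤ (pairCon (S.image (Prod.map τ τ))).comap τ (map_add τ) := by
      refine AddCon.addConGen_le.2 fun α β h => ?_
      exact pairCon_of_mem (Finset.mem_image.2 ⟨(α, β), h, rfl⟩)
    intro α β h
    exact h1 h
  refine ⟨S.image (Prod.map τ τ), Finset.card_image_le, ?_, ?_, ?_, ?_⟩
  · intro s hs
    obtain ⟨t, ht, rfl⟩ := Finset.mem_image.1 hs
    exact hτmem _ (hS.left_mem t ht)
  · intro s hs
    obtain ⟨t, ht, rfl⟩ := Finset.mem_image.1 hs
    exact hτmem _ (hS.right_mem t ht)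
  · intro s hs
    obtain ⟨t, ht, rfl⟩ := Finset.mem_image.1 hs
    change vdeg (τ _) = vdeg (τ _)
    rw [hτdeg, hτdeg, hS.deg_eq t ht]
  · have key : ∀ α ∈ suppIn B, ∃ α' ∈ suppIn (insert (c • b) (B.erase b)),
        α = Finsupp.single b (α b % c) + τ α' := by
      intro α hα
      have h0 : α.erase b ∈ suppIn (B.erase b) :=
        erase_mem_suppIn (by rwa [Finset.insert_erase hb])
      refine ⟨Finsupp.single (c • b) (α b / c) + α.erase b,
        add_mem (single_mem_suppIn (Finset.mem_insert_self _ _) _)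
          (suppIn_mono (Finset.subset_insert _ _) h0), ?_⟩
      rw [map_add, hτid _ h0]
      simp only [τ, Finsupp.linearCombination_single, if_true, Finsupp.smul_single, smul_eq_mul]
      rw [← add_assoc, ← Finsupp.single_add, mul_comm, Nat.mod_add_div, Finsupp.single_add_erase]
    intro α hα β hβ h
    obtain ⟨α', hα', h1⟩ := key α hα
    obtain ⟨β', hβ', h2⟩ := key β hβ
    rw [hmod α hα β hβ h] at h1
    generalize β b % c = ρ at h1 h2
    subst h1 h2
    have h3 : vdeg α' = vdeg β' := by
      rw [map_add, map_add, hτdeg, hτdeg] at h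
      exact add_left_cancel h
    exact AddCon.add _ (AddCon.refl _ _) (hcon _ _ (hS.con α' hα' β' hβ' h3))

/-- A free vector adds one to cardinality and rank and needs no relation; a redundant one adds one
relation. Undoing a scaling costs none, unless `c • b` was already present, when the set had shrunk
and one relation is restored. -/
theorem HasCIPairs.of_step {B' : Finset (Fin m → ℕ)} (hstep : ReductionStep B B')
    (h : HasCIPairs B') : HasCIPairs B := by
  classical
  obtain ⟨S, hS, hcard⟩ := h
  cases hstep with
  | remove_free b hb hfree =>
    refine ⟨S, ?_, ?_⟩
    · rw [← Finset.insert_erase hb]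
      refine hS.insert_free fun α hα β hβ hαβ => ?_
      rw [Finset.insert_erase hb] at hα hβ
      by_contra hne
      have h1 := sub_smul_castVec_mem ℚ hα hβ hαβ hb
      have h2 : ((α b : ℚ) - β b) ≠ 0 := by
        rw [sub_ne_zero]
        exact_mod_cast hne
      have h3 := Submodule.smul_mem _ ((α b : ℚ) - β b)⁻¹ h1
      rw [smul_smul, inv_mul_cancel₀ h2, one_smul] at h3
      exact hfree h3
    · have h1 : ratSpan B ≤ Submodule.span ℚ {castVec ℚ b} ⊔ ratSpan (B.erase b) := by
        rw [ratSpan_eq, ratSpan_eq, ← Submodule.span_union]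
        refine Submodule.span_mono ?_
        rintro _ ⟨v, hv, rfl⟩
        by_cases hvb : v = b
        · left; rw [hvb]; rfl
        · right; exact ⟨v, Finset.mem_coe.2 (Finset.mem_erase.2 ⟨hvb, hv⟩), rfl⟩
      have h2 := (Submodule.finrank_mono h1).trans (Submodule.finrank_add_le_finrank_add_finrank _
          _)
      have h3 : Module.finrank ℚ (Submodule.span ℚ {castVec ℚ b}) ≤ 1 := by
        have := finrank_span_finset_le_card (R := ℚ) ({castVec ℚ b} : Finset (Fin m → ℚ))
        rw [Finset.coe_singleton, Finset.card_singleton] at this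
        exact this
      have h4 := Finset.card_erase_add_one hb
      omega
  | remove_redundant b hb hred =>
    obtain ⟨M, hM, hMb⟩ := exists_mem_suppIn_of_mem_natSpan hred
    obtain ⟨S', hS', hgen⟩ := hS.insert_pair (b := b) (c := 1) hM (by simpa using hMb.symm)
      (fun α _ β _ _ => by rw [Nat.mod_one, Nat.mod_one])
    rw [Finset.insert_erase hb] at hgen
    refine ⟨S', hgen, ?_⟩
    have h1 : ratSpan B ≤ ratSpan (B.erase b) := by
      rw [ratSpan_eq, Submodule.span_le]
      rintro _ ⟨v, hv, rfl⟩
      by_cases hvb : v = b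
      · rw [hvb]; exact castVec_mem_of_mem_natSpan ℚ hred
      · exact Submodule.subset_span ⟨v, Finset.mem_coe.2 (Finset.mem_erase.2 ⟨hvb, hv⟩), rfl⟩
    have h2 := Submodule.finrank_mono h1
    have h4 := Finset.card_erase_add_one hb
    omega
  | scale b hb hQ c hc =>
    have hmod : ∀ α ∈ suppIn B, ∀ β ∈ suppIn B, vdeg α = vdeg β → α b % c = β b % c :=
      fun α hα β hβ h => mod_eq_of_isLeast hb hc hα hβ h
    have h1 : ratSpan B ≤ ratSpan (insert (c • b) (B.erase b)) := by
      rw [ratSpan_eq, Submodule.span_le]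
      rintro _ ⟨v, hv, rfl⟩
      by_cases hvb : v = b
      · rw [hvb]
        have : castVec ℚ b = (c : ℚ)⁻¹ • castVec ℚ (c • b) := by
          have hc0 : (c : ℚ) ≠ 0 := by exact_mod_cast hc.1.1.ne'
          ext j
          simp [castVec, hc0]
        rw [this]
        exact Submodule.smul_mem _ _ (Submodule.subset_span ⟨_, by simp, rfl⟩)
      · exact Submodule.subset_span ⟨v, Finset.mem_coe.2 (Finset.mem_insert_of_mem
          (Finset.mem_erase.2 ⟨hvb, hv⟩)), rfl⟩
    have h2 := Submodule.finrank_mono h1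
    have h4 := Finset.card_erase_add_one hb
    by_cases hcb : c • b ∈ B.erase b
    · rw [Finset.insert_eq_of_mem hcb] at hS hcard h2
      obtain ⟨S', hS', hgen⟩ := hS.insert_pair (b := b) (c := c) (single_mem_suppIn hcb 1)
        (by simp) (by rw [Finset.insert_erase hb]; exact hmod)
      rw [Finset.insert_erase hb] at hgen
      exact ⟨S', hgen, by omega⟩
    · obtain ⟨S', hS', hgen⟩ := hS.scale hb hcb hmod
      rw [Finset.card_insert_of_notMem hcb] at hcard
      exact ⟨S', hgen, by omega⟩

theorem generates_empty : Generates (∅ : Finset (Fin m → ℕ)) ∅ where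
  left_mem := by simp
  right_mem := by simp
  deg_eq := by simp
  con := by
    intro α hα β hβ _
    have h0 : ∀ α ∈ suppIn (∅ : Finset (Fin m → ℕ)), α = 0 := by
      intro α hα
      simpa [Finsupp.mem_supported] using hα
    rw [h0 α hα, h0 β hβ]
    exact AddCon.refl _ _

theorem hasCIPairs_of_isRed_empty (h : IsRed B ∅) : HasCIPairs B := by
  have h0 : ratSpan (∅ : Finset (Fin m → ℕ)) = ⊥ := by rw [ratSpan_eq]; simp
  have h1 := h.1
  induction h1 using Relation.ReflTransGen.head_induction_on with
  | refl => exact ⟨∅, generates_empty, by rw [h0]; simp⟩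
  | head hstep _ ih => exact HasCIPairs.of_step hstep (ih ⟨by assumption, by simp⟩)

theorem exists_finset_span_eq_toricIdeal {k : Type*} [Field k] (hS : Generates B S) :
    ∃ T : Finset (MvPolynomial B k), T.card ≤ S.card ∧
      Ideal.span (T : Set (MvPolynomial B k)) = toricIdeal k B := by
  classical
  let res : ((Fin m → ℕ) →₀ ℕ) → (B →₀ ℕ) := fun α => α.subtypeDomain (· ∈ B)
  have res_add : ∀ α β, res (α + β) = res α + res β := fun α β => Finsupp.subtypeDomain_add
  let u : B → Fin m →₀ ℕ := fun b => Finsupp.equivFunOnFinite.symm b.1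
  let ext' : (B →₀ ℕ) → ((Fin m → ℕ) →₀ ℕ) := fun α => Finsupp.extendDomain α
  have res_ext : ∀ α, res (ext' α) = α := fun α => Finsupp.subtypeDomain_extendDomain α
  have ext_res : ∀ α ∈ suppIn B, ext' (res α) = α := fun α hα =>
    Finsupp.extendDomain_subtypeDomain α fun v hv => Finset.mem_coe.1
        ((Finsupp.mem_supported _ _).1 hα hv)
  have ext_mem : ∀ α, ext' α ∈ suppIn B := by
    intro α
    rw [Finsupp.mem_supported]
    exact Finsupp.support_extendDomain_subset α
  have deg_ext : ∀ α j, vdeg (ext' α) j = expDeg u α j := by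
    intro α j
    simp only [ext', Finsupp.extendDomain_eq_embDomain_subtype]
    rw [Finsupp.linearCombination_embDomain, Finsupp.linearCombination_apply,
      Finsupp.linearCombination_apply, Finsupp.sum_fintype _ _ (by simp),
      Finsupp.sum_fintype _ _ (by simp), Finset.sum_apply, Finsupp.finsetSum_apply]
    rfl
  let bin : ((Fin m → ℕ) →₀ ℕ) × ((Fin m → ℕ) →₀ ℕ) → MvPolynomial B k := fun s =>
    monomial (res s.1) 1 - monomial (res s.2) 1
  refine ⟨S.image bin, Finset.card_image_le, ?_⟩
  rw [toricIdeal_eq_monoKer]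
  refine le_antisymm ?_ ?_
  · rw [Ideal.span_le]
    intro f hf
    obtain ⟨s, hs, rfl⟩ := Finset.mem_image.1 (Finset.mem_coe.1 hf)
    refine (binomial_mem_monoKer_iff u _ _).2 ?_
    ext j
    rw [← deg_ext, ← deg_ext, ext_res _ (hS.left_mem s hs), ext_res _ (hS.right_mem s hs),
      hS.deg_eq s hs]
  · set J := Ideal.span ((S.image bin : Finset (MvPolynomial B k)) : Set (MvPolynomial B k))
    -- Pairs whose binomial lies in `J` form an additive congruence, which therefore contains the
    -- one generated by `S`.
    let K : AddCon ((Fin m → ℕ) →₀ ℕ) :=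
      { r := fun α β => (monomial (res α) 1 - monomial (res β) 1 : MvPolynomial B k) ∈ J
        iseqv :=
          { refl := fun α => by rw [sub_self]; exact zero_mem J
            symm := fun {α β} h => by rw [← neg_sub]; exact neg_mem h
            trans := fun {α β γ} h h' => by
              rw [← sub_add_sub_cancel]; exact add_mem h h' }
        add' := fun {α β γ δ} h h' => by
          have h1 : ∀ α β, (monomial (res (α + β)) 1 : MvPolynomial B k) =
              monomial (res α) 1 * monomial (res β) 1 := by
            intro α β
            rw [res_add, monomial_mul, one_mul]
          have h2 : (monomial (res (α + γ)) 1 - monomial (res (β + δ)) 1 : MvPolynomial B k) =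
              monomial (res γ) 1 * (monomial (res α) 1 - monomial (res β) 1) +
              monomial (res β) 1 * (monomial (res γ) 1 - monomial (res δ) 1) := by
            rw [h1, h1]; ring
          change (monomial (res (α + γ)) 1 - monomial (res (β + δ)) 1 : MvPolynomial B k) ∈ J
          rw [h2]
          exact add_mem (Ideal.mul_mem_left _ _ h) (Ideal.mul_mem_left _ _ h') }
    have hK : pairCon S ≤ K := AddCon.addConGen_le.2 fun α β h =>
      Ideal.subset_span (Finset.mem_coe.2 (Finset.mem_image.2 ⟨(α, β), h, rfl⟩))
    refine monoKer_le_of_forall_binomial u J fun α β h => ?_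
    have h1 : vdeg (ext' α) = vdeg (ext' β) := by
      ext j
      rw [deg_ext, deg_ext, h]
    have h2 : (monomial (res (ext' α)) 1 - monomial (res (ext' β)) 1 : MvPolynomial B k) ∈ J :=
      hK (hS.con _ (ext_mem α) _ (ext_mem β) h1)
    rwa [res_ext, res_ext] at h2

end Gen

end ToricCI

end

/-! ### Gluing criteria, and elimination data imply an empty reduced set. -/

noncomputable section

namespace ToricCI

section Step

variable {m : ℕ} {B : Finset (Fin m → ℕ)} {b : Fin m → ℕ}
  {S : Finset (((Fin m → ℕ) →₀ ℕ) × ((Fin m → ℕ) →₀ ℕ))}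

/-- A scaling step followed by a removal. -/
theorem reflTransGen_erase (hb : b ∈ B) {t : ℕ} (ht : 0 < t) (hmem : t • b ∈ natSpan (B.erase b))
    (hmin : ∀ c : ℕ, 0 < c → castVec ℤ (c • b) ∈ intSpan (B.erase b) → t ≤ c) :
    Relation.ReflTransGen ReductionStep B (B.erase b) := by
  have hZ : ∀ c : ℕ, castVec ℤ (c • b) = fun j => (c : ℤ) * (b j : ℤ) := by
    intro c; ext j; simp [castVec]
  have hQ : castVec ℚ b ∈ ratSpan (B.erase b) := by
    have h1 : castVec ℚ b = (t : ℚ)⁻¹ • castVec ℚ (t • b) := by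
      have : (t : ℚ) ≠ 0 := by exact_mod_cast ht.ne'
      ext j
      simp [castVec, this]
    rw [h1]
    exact Submodule.smul_mem _ _ (castVec_mem_of_mem_natSpan ℚ hmem)
  have hstep : ReductionStep B (insert (t • b) (B.erase b)) := by
    refine .scale B b hb hQ t ⟨⟨ht, ?_⟩, fun c hc => hmin c hc.1 ?_⟩
    · rw [← hZ]; exact castVec_mem_of_mem_natSpan ℤ hmem
    · rw [hZ]; exact hc.2
  -- If the multiple is already present, the scaling step itself removes `b`.
  by_cases hin : t • b ∈ B.erase b
  · rw [Finset.insert_eq_of_mem hin] at hstep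
    exact .single hstep
  · refine .tail (.single hstep) ?_
    have := ReductionStep.remove_redundant (insert (t • b) (B.erase b)) (t • b)
      (Finset.mem_insert_self _ _) (by rwa [Finset.erase_insert hin])
    rwa [Finset.erase_insert hin] at this

theorem Generates.insert_of_dvd (hS : Generates B S) (hbB : b ∉ B) {c : ℕ}
    (hc : c • b ∈ natSpan B) (j : Fin m) (G : ℤ) (hG : ∀ v ∈ B, G ∣ (v j : ℤ))
    (hGc : ∀ x : ℤ, G ∣ x * b j → (c : ℤ) ∣ x) :
    ∃ S', S'.card ≤ S.card + 1 ∧ Generates (insert b B) S' := by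
  obtain ⟨M, hM, hMb⟩ := exists_mem_suppIn_of_mem_natSpan hc
  refine hS.insert_pair (c := c) hM (by rw [hMb]; simp) fun α hα β hβ h => ?_
  have h1 := dvd_sub_mul_of_vdeg_eq hα hβ h (Finset.mem_insert_self _ _) j G
    (by rwa [Finset.erase_insert hbB])
  exact ((Nat.modEq_iff_dvd.2 (hGc _ h1)).symm : α b ≡ β b [MOD c])

/-- The divisibility argument with divisor `0`: the coordinate `j` fixes the exponent of `b`. -/
theorem Generates.insert_of_coord_eq_zero (hS : Generates B S) (j : Fin m)
    (hB : ∀ v ∈ B, v j = 0) (hb : b j ≠ 0) : Generates (insert b B) S := by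
  have hbB : b ∉ B := fun h => hb (hB b h)
  refine hS.insert_free fun α hα β hβ h => ?_
  have h1 := dvd_sub_mul_of_vdeg_eq hα hβ h (Finset.mem_insert_self _ _) j 0
    (by rw [Finset.erase_insert hbB]; intro v hv; simp [hB v hv])
  rw [zero_dvd_iff, mul_eq_zero, or_iff_left (by exact_mod_cast hb), sub_eq_zero] at h1
  exact_mod_cast h1

end Step

/-- The vector of `A⋆` coming from `a`, where `D` is the maximum of `A`. -/
def curveVec (D a : ℕ) : Fin 2 → ℕ := ![a, D - a]

theorem curveVec_inj {D a b : ℕ} : curveVec D a = curveVec D b ↔ a = b := by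
  refine ⟨fun h => ?_, fun h => h ▸ rfl⟩
  simpa [curveVec] using congrFun h 0

theorem star_eq (A : Finset ℕ) {D : ℕ} (h : A.sup id = D) :
    star A = (insert 0 A).image (curveVec D) := by
  rw [star, h, Finset.image_insert]
  rfl

theorem mem_natSpan_of_mem {m : ℕ} {B : Finset (Fin m → ℕ)} {v : Fin m → ℕ} (h : v ∈ B) :
    v ∈ natSpan B := Submodule.subset_span (Finset.mem_coe.2 h)

/-- The slack `c - (p + q + r)` is filled by copies of `(0, D)`, which do not change the first
coordinate. -/
theorem smul_curveVec_mem_natSpan {A : Finset ℕ} {D b c x y z p q r : ℕ} (h0 : 0 ∈ A) (hx : x ∈ A)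
    (hy : y ∈ A) (hz : z ∈ A) (hxD : x ≤ D) (hyD : y ≤ D) (hzD : z ≤ D) (hbD : b ≤ D)
    (h : c * b = p * x + q * y + r * z) (hc : p + q + r ≤ c) :
    c • curveVec D b ∈ natSpan (A.image (curveVec D)) := by
  have hmem : ∀ {x : ℕ}, x ∈ A → curveVec D x ∈ natSpan (A.image (curveVec D)) :=
    fun h => mem_natSpan_of_mem (Finset.mem_image_of_mem _ h)
  have h1 : c • curveVec D b = p • curveVec D x + q • curveVec D y + r • curveVec D z +
      (c - (p + q + r)) • curveVec D 0 := by
    ext j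
    fin_cases j
    · simp [curveVec, h]
    · simp only [curveVec, Fin.mk_one, Fin.isValue, Pi.add_apply, Pi.smul_apply, smul_eq_mul,
        Matrix.cons_val_one, Matrix.cons_val_fin_one, Nat.sub_zero]
      zify [hxD, hyD, hzD, hbD, hc] at h ⊢
      linear_combination -h
  rw [h1]
  exact add_mem (add_mem (add_mem (Submodule.smul_mem _ _ (hmem hx))
      (Submodule.smul_mem _ _ (hmem hy)))
    (Submodule.smul_mem _ _ (hmem hz))) (Submodule.smul_mem _ _ (hmem h0))

/-- The multipliers `t` for `b` and `s` for `a` are minimal already on first coordinates; the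
remaining `(D, 0)` and `(0, D)` are independent and leave as free vectors. -/
theorem reflTransGen_of_elimData {a b D : ℕ} (ha : 0 < a) (hb : 0 < b) (haD : a < D) (hbD : b < D)
    (hab : a ≠ b) (h : ElimData a b D) :
    Relation.ReflTransGen ReductionStep
      (({0, a, b, D} : Finset ℕ).image (curveVec D)) ∅ := by
  obtain ⟨s, t, hs, ht, ⟨u, hus, hu⟩, ⟨u', v', huv, hu'⟩, hmins, hmint⟩ := h
  have hinj : Function.Injective (curveVec D) := fun x y h => curveVec_inj.1 h
  have hcoord : ∀ x y : ℕ, (castVec ℤ (curveVec x y)) 0 = y := fun x y => rfl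
  have herase : ∀ (x : ℕ) (A : Finset ℕ), (A.image (curveVec D)).erase (curveVec D x) =
      (A.erase x).image (curveVec D) := fun x A => (Finset.image_erase hinj _ _).symm
  have hmem : ∀ {x : ℕ} {A : Finset ℕ}, x ∈ A → curveVec D x ∈ A.image (curveVec D) :=
    fun h => Finset.mem_image_of_mem _ h
  have e1 : ({0, a, b, D} : Finset ℕ).erase b = {0, a, D} := by
    ext x; simp only [Finset.mem_erase, Finset.mem_insert, Finset.mem_singleton]; omega
  have e2 : ({0, a, D} : Finset ℕ).erase a = {0, D} := by
    ext x; simp only [Finset.mem_erase, Finset.mem_insert, Finset.mem_singleton]; omega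
  have e3 : ({0, D} : Finset ℕ).erase D = {0} := by
    ext x; simp only [Finset.mem_erase, Finset.mem_insert, Finset.mem_singleton]; omega
  have s1 : Relation.ReflTransGen ReductionStep (({0, a, b, D} : Finset ℕ).image (curveVec D))
      (({0, a, D} : Finset ℕ).image (curveVec D)) := by
    rw [← e1, ← herase]
    refine reflTransGen_erase (hmem (by simp)) ht ?_ ?_
    · rw [herase, e1]
      exact smul_curveVec_mem_natSpan (x := a) (y := D) (z := 0) (p := u') (q := v') (r := 0)
        (by simp) (by simp) (by simp) (by simp) haD.le le_rfl (Nat.zero_le _) hbD.le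
        (by linarith) (by omega)
    · intro c hc hcm
      rw [herase, e1, intSpan_eq, Finset.coe_image, Set.image_image] at hcm
      have h1 : ((fun x : ℕ => castVec ℤ (curveVec D x)) '' (({0, a, D} : Finset ℕ) : Set ℕ)) =
          {castVec ℤ (curveVec D 0), castVec ℤ (curveVec D a), castVec ℤ (curveVec D D)} := by
        simp [Set.image_insert_eq]
      rw [h1, Submodule.mem_span_triple] at hcm
      obtain ⟨x, y, z, h2⟩ := hcm
      have h3 := congrFun h2 0
      simp only [Pi.add_apply, Pi.smul_apply, hcoord, smul_eq_mul] at h3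
      have h4 : castVec ℤ (c • curveVec D b) 0 = (c : ℤ) * b := by simp [castVec, curveVec]
      rw [h4] at h3
      have := hmint c y z (by rw [← h3]; push_cast; ring)
      exact Nat.le_of_dvd hc (by exact_mod_cast this)
  have s2 : Relation.ReflTransGen ReductionStep (({0, a, D} : Finset ℕ).image (curveVec D))
      (({0, D} : Finset ℕ).image (curveVec D)) := by
    rw [← e2, ← herase]
    refine reflTransGen_erase (hmem (by simp)) hs ?_ ?_
    · rw [herase, e2]
      exact smul_curveVec_mem_natSpan (x := D) (y := 0) (z := 0) (p := u) (q := 0) (r := 0)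
        (by simp) (by simp) (by simp) (by simp) le_rfl (Nat.zero_le _) (Nat.zero_le _) haD.le
        (by linarith) (by omega)
    · intro c hc hcm
      rw [herase, e2, intSpan_eq, Finset.coe_image, Set.image_image] at hcm
      have h1 : ((fun x : ℕ => castVec ℤ (curveVec D x)) '' (({0, D} : Finset ℕ) : Set ℕ)) =
          {castVec ℤ (curveVec D 0), castVec ℤ (curveVec D D)} := by
        simp [Set.image_insert_eq]
      rw [h1, Submodule.mem_span_pair] at hcm
      obtain ⟨x, z, h2⟩ := hcm
      have h3 := congrFun h2 0
      simp only [Pi.add_apply, Pi.smul_apply, hcoord, smul_eq_mul] at h3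
      have h4 : castVec ℤ (c • curveVec D a) 0 = (c : ℤ) * a := by simp [castVec, curveVec]
      rw [h4] at h3
      have := hmins c z (by rw [← h3]; push_cast; ring)
      exact Nat.le_of_dvd hc (by exact_mod_cast this)
  have s3 : ReductionStep (({0, D} : Finset ℕ).image (curveVec D))
      (({0} : Finset ℕ).image (curveVec D)) := by
    rw [← e3, ← herase]
    refine .remove_free _ _ (hmem (by simp)) ?_
    rw [herase, e3, Finset.image_singleton, ratSpan_eq, Finset.coe_singleton, Set.image_singleton,
      Submodule.mem_span_singleton]
    rintro ⟨x, hx⟩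
    have h3 := congrFun hx 0
    simp only [castVec, curveVec, Pi.smul_apply, Matrix.cons_val_zero, Nat.cast_zero, smul_zero]
        at h3
    have : D = 0 := by exact_mod_cast h3.symm
    omega
  have s4 : ReductionStep (({0} : Finset ℕ).image (curveVec D)) ∅ := by
    have h1 : (({0} : Finset ℕ).image (curveVec D)).erase (curveVec D 0) = ∅ := by simp
    rw [← h1]
    refine .remove_free _ _ (hmem (by simp)) ?_
    rw [h1, ratSpan_eq, Finset.coe_empty, Set.image_empty, Submodule.span_empty,
      Submodule.mem_bot]
    intro hx
    have h3 := congrFun hx 1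
    simp [curveVec] at h3
    omega
  exact (s1.trans s2).trans ((Relation.ReflTransGen.single s3).trans (.single s4))

theorem isRed_star_empty {A : Finset ℕ} {a b D : ℕ} (hA : ∀ x, x ∈ A ↔ x = a ∨ x = b ∨ x = D)
    (ha : 0 < a) (hb : 0 < b) (haD : a < D) (hbD : b < D)
    (hab : a ≠ b) (h : ElimData a b D ∨ ElimData b a D) : IsRed (star A) ∅ := by
  refine ⟨?_, by simp⟩
  have hsup : A.sup id = D := by
    refine le_antisymm (Finset.sup_le fun x hx => ?_)
      (Finset.le_sup (f := id) ((hA D).2 (Or.inr (Or.inr rfl))))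
    rcases (hA x).1 hx with rfl | rfl | rfl
    exacts [haD.le, hbD.le, le_rfl]
  rw [star_eq A hsup]
  rcases h with h | h
  · have : insert 0 A = {0, a, b, D} := by ext x; simp [hA]
    rw [this]
    exact reflTransGen_of_elimData ha hb haD hbD hab h
  · have : insert 0 A = {0, b, a, D} := by ext x; simp [hA]; tauto
    rw [this]
    exact reflTransGen_of_elimData hb ha hbD haD hab.symm h

end ToricCI

end

/-! ### Sufficiency of the two alternatives. -/

noncomputable section

namespace ToricCI

variable {k : Type*} [Field k]

theorem isCompleteIntersection_of_generates {n : ℕ} {d : Fin n → ℕ} {p : Fin n}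
    (hpos : ∀ i, 0 < d i) (hinj : Function.Injective d) (hp : ∀ i, d i ≤ d p)
    {S : Finset (((Fin 2 → ℕ) →₀ ℕ) × ((Fin 2 → ℕ) →₀ ℕ))}
    (hS : Generates (star (Finset.univ.image d)) S) (hc : S.card + 1 ≤ n) :
    IsCompleteIntersection (toricIdeal k (star (Finset.univ.image d))) := by
  obtain ⟨T, hT, hspan⟩ := exists_finset_span_eq_toricIdeal (k := k) hS
  refine isCompleteIntersection_of_generators (RingHom.ker_ne_top _) hspan ?_
  have h1 := height_toricIdeal (k := k) hpos hinj hp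
  have h2 : ((T.card : ℕ∞)) + 1 ≤ n := by exact_mod_cast (by omega : T.card + 1 ≤ n)
  rw [← h1] at h2
  exact (ENat.add_le_add_iff_right (by simp)).1 h2

/-- The relations between two linearly independent vectors are trivial. -/
theorem generates_axes {D : ℕ} (hD : 0 < D) :
    Generates (({D, 0} : Finset ℕ).image (curveVec D)) ∅ := by
  have h0 : Generates (({0} : Finset ℕ).image (curveVec D)) ∅ := by
    rw [Finset.image_singleton, ← insert_empty_eq]
    exact generates_empty.insert_of_coord_eq_zero 1 (by simp) (by simpa [curveVec] using hD.ne')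
  rw [Finset.image_insert]
  exact h0.insert_of_coord_eq_zero 0 (by simp [curveVec]) (by simpa [curveVec] using hD.ne')

theorem Generates.insert_curveVec {A : Finset ℕ} {D b c x y z p q r : ℕ}
    {S : Finset (((Fin 2 → ℕ) →₀ ℕ) × ((Fin 2 → ℕ) →₀ ℕ))}
    (hS : Generates (A.image (curveVec D)) S) (hbA : b ∉ A)
    (h0 : 0 ∈ A) (hx : x ∈ A)
    (hy : y ∈ A) (hz : z ∈ A) (hA : ∀ a ∈ A, a ≤ D) (hbD : b ≤ D)
    (h : c * b = p * x + q * y + r * z) (hc : p + q + r ≤ c) (G : ℤ) (hG : ∀ v ∈ A, G ∣ (v : ℤ))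
    (hGc : ∀ x : ℤ, G ∣ x * b → (c : ℤ) ∣ x) :
    ∃ S', S'.card ≤ S.card + 1 ∧ Generates ((insert b A).image (curveVec D)) S' := by
  rw [Finset.image_insert]
  refine hS.insert_of_dvd (c := c) ?_ (smul_curveVec_mem_natSpan h0 hx hy hz (hA _ hx) (hA _ hy)
    (hA _ hz) hbD h hc) 0 G ?_ hGc
  · rw [Finset.mem_image]
    rintro ⟨a, ha, hab⟩
    exact hbA (curveVec_inj.1 hab ▸ ha)
  · intro v hv
    obtain ⟨a, ha, rfl⟩ := Finset.mem_image.1 hv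
    exact hG a ha

variable {d : Fin 4 → ℕ}

theorem forall_dvd_of_dvd_four (g : ℕ) (hgcd : Finset.univ.gcd d = 1) (h0 : g ∣ d 0) (h1 : g ∣ d 1)
    (h2 : g ∣ d 2) (h3 : g ∣ d 3) : g = 1 := by
  have : g ∣ Finset.univ.gcd d := Finset.dvd_gcd fun i _ => by fin_cases i <;> assumption
  rwa [hgcd, Nat.dvd_one] at this

/-- The vectors of `d 0`, `d 1`, `d 3` are glued in this order onto `(D, 0)` and `(0, D)` with `D =
d 2`, with multipliers `c + 1`, `2`, `g`. At each stage the weights present have common divisors `d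
2`, `2 * g`, `g` respectively, which force these multipliers. -/
theorem isCompleteIntersection_of_even_div (hpos : ∀ i, 0 < d i) (hinj : Function.Injective d)
    (hgcd : Finset.univ.gcd d = 1) (h01 : d 0 < d 1) (h012 : d 0 + d 2 = 2 * d 1)
    (heven : Even (d 0 / Nat.gcd (d 0) (d 1))) {β₁ β₂ β₃ : ℕ}
    (hβ : Nat.gcd (d 0) (d 1) * d 3 = β₁ * d 0 + β₂ * d 1 + β₃ * d 2)
    (hβs : β₁ + β₂ + β₃ ≤ Nat.gcd (d 0) (d 1)) :
    IsCompleteIntersection (toricIdeal k (star (Finset.univ.image d))) := by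
  have hg0 : 0 < Nat.gcd (d 0) (d 1) := Nat.gcd_pos_of_pos_left _ (hpos 0)
  obtain ⟨f, hf⟩ := heven
  have hd0 : d 0 = Nat.gcd (d 0) (d 1) * (2 * f) := by
    rw [two_mul, ← hf, Nat.mul_div_cancel' (Nat.gcd_dvd_left _ _)]
  obtain ⟨e, hd1⟩ := Nat.gcd_dvd_right (d 0) (d 1)
  have hcop : Nat.Coprime (2 * f) e := by
    have h := Nat.gcd_mul_left (Nat.gcd (d 0) (d 1)) (2 * f) e
    rw [← hd0, ← hd1] at h
    exact Nat.eq_of_mul_eq_mul_left hg0 (by rw [mul_one]; exact h.symm)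
  generalize hg : Nat.gcd (d 0) (d 1) = g at *
  have hfe : 2 * f < e := by
    rw [hd0, hd1] at h01
    exact lt_of_mul_lt_mul_left h01 (Nat.zero_le _)
  -- Now `d 1 = g (f + c + 1)`, whence `d 2 = 2 g (c + 1)` and `(c + 1) * d 0 = f * d 2` with
  -- coprime multipliers.
  obtain ⟨c, rfl⟩ := Nat.exists_eq_add_of_lt (show f < e by omega)
  have hd2 : d 2 = 2 * g * (c + 1) := by rw [hd0, hd1] at h012; nlinarith
  have h12 : d 1 < d 2 := by omega
  have h32 : d 3 ≤ d 2 := by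
    have h1 : g * d 3 ≤ g * d 2 := by
      rw [hβ]
      calc _ ≤ β₁ * d 2 + β₂ * d 2 + β₃ * d 2 := by gcongr; omega
        _ = (β₁ + β₂ + β₃) * d 2 := by ring
        _ ≤ _ := Nat.mul_le_mul_right _ hβs
    exact le_of_mul_le_mul_left h1 hg0
  have hp : ∀ i, d i ≤ d 2 := by
    intro i
    fin_cases i
    exacts [(h01.trans h12).le, h12.le, le_rfl, h32]
  have hn03 : d 3 ≠ d 0 := hinj.ne (by decide)
  have hn13 : d 3 ≠ d 1 := hinj.ne (by decide)
  have hn23 : d 3 ≠ d 2 := hinj.ne (by decide)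
  have hp0 := hpos 0
  have hp3 := hpos 3
  obtain ⟨S₁, hS₁, hgen₁⟩ := (generates_axes (hpos 2)).insert_curveVec (b := d 0) (c := c + 1)
    (x := d 2) (y := 0) (z := 0) (p := f) (q := 0) (r := 0) (G := d 2)
    (by simp; omega) (by simp) (by simp) (by simp) (by simp) (by simp) (hp 0)
    (by rw [hd2, hd0]; ring) (by omega) (by simp) (by
      intro x hx
      rw [hd2, hd0] at hx
      have h1 : ((2 * g : ℕ) : ℤ) * ((c + 1 : ℕ) : ℤ) ∣ ((2 * g : ℕ) : ℤ) * (x * f) := by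
        have e : ((2 * g : ℕ) : ℤ) * (x * f) = x * ((g * (2 * f) : ℕ) : ℤ) := by push_cast; ring
        rw [e]; exact_mod_cast hx
      have h2 := (mul_dvd_mul_iff_left (by exact_mod_cast (by omega : 2 * g ≠ 0))).1 h1
      refine IsCoprime.dvd_of_dvd_mul_right ?_ h2
      rw [Nat.isCoprime_iff_coprime]
      have h3 : Nat.Coprime f (f + c + 1) := hcop.coprime_dvd_left (Dvd.intro_left _ rfl)
      rw [add_assoc, Nat.coprime_self_add_right] at h3
      exact h3.symm)
  obtain ⟨S₂, hS₂, hgen₂⟩ := hgen₁.insert_curveVec (b := d 1) (c := 2)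
    (x := d 0) (y := d 2) (z := 0) (p := 1) (q := 1) (r := 0) (G := (2 * g : ℕ))
    (by simp; omega) (by simp) (by simp) (by simp) (by simp) (by simp [hp]) (hp 1)
    (by omega) (by omega) (by
      intro v hv
      simp only [Finset.mem_insert, Finset.mem_singleton] at hv
      rw [Int.natCast_dvd_natCast]
      rcases hv with rfl | rfl | rfl
      exacts [⟨f, by rw [hd0]; ring⟩, ⟨c + 1, hd2⟩, dvd_zero _]) (by
      intro x hx
      rw [hd1] at hx
      have h1 : (g : ℤ) * 2 ∣ (g : ℤ) * (x * (f + c + 1 : ℕ)) := by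
        have e : (g : ℤ) * (x * (f + c + 1 : ℕ)) = x * ((g * (f + c + 1) : ℕ) : ℤ) := by
          push_cast; ring
        rw [e, mul_comm]; exact_mod_cast hx
      have h2 := (mul_dvd_mul_iff_left (by exact_mod_cast hg0.ne')).1 h1
      refine IsCoprime.dvd_of_dvd_mul_right ?_ h2
      have : IsCoprime ((2 : ℕ) : ℤ) ((f + c + 1 : ℕ) : ℤ) :=
        Nat.isCoprime_iff_coprime.2 (hcop.coprime_dvd_left (Dvd.intro _ rfl))
      exact this)
  obtain ⟨S₃, hS₃, hgen₃⟩ := hgen₂.insert_curveVec (b := d 3) (c := g)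
    (x := d 0) (y := d 1) (z := d 2) (p := β₁) (q := β₂) (r := β₃) (G := g)
    (by simp; omega) (by simp) (by simp) (by simp) (by simp) (by simp [hp]) (hp 3)
    hβ hβs (by
      intro v hv
      simp only [Finset.mem_insert, Finset.mem_singleton] at hv
      rw [Int.natCast_dvd_natCast]
      rcases hv with rfl | rfl | rfl | rfl
      exacts [⟨_, hd1⟩, ⟨_, hd0⟩, ⟨2 * (c + 1), by rw [hd2]; ring⟩, dvd_zero _]) (by
      intro x hx
      refine IsCoprime.dvd_of_dvd_mul_right ?_ hx
      rw [Nat.isCoprime_iff_coprime]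
      refine forall_dvd_of_dvd_four _ hgcd ?_ ?_ ?_ (Nat.gcd_dvd_right _ _) <;>
        refine (Nat.gcd_dvd_left _ _).trans ?_
      exacts [⟨_, hd0⟩, ⟨_, hd1⟩, ⟨2 * (c + 1), by rw [hd2]; ring⟩])
  refine isCompleteIntersection_of_generates hpos hinj hp (S := S₃) ?_
    (by rw [Finset.card_empty] at hS₁; omega)
  rw [star_eq _ (sup_image_eq hp)]
  convert hgen₃ using 2
  ext x
  simp [Fin.exists_fin_succ, eq_comm]
  tauto

theorem two_le_finrank_ratSpan {A : Finset ℕ} {D : ℕ} (hD : D ∈ A) (hpos : 0 < D) (h0 : 0 ∈ A) :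
    2 ≤ Module.finrank ℚ (ratSpan (A.image (curveVec D))) := by
  have hli : LinearIndependent ℚ ![castVec ℚ (curveVec D D), castVec ℚ (curveVec D 0)] := by
    rw [LinearIndependent.pair_iff]
    intro s t h
    have h1 := congrFun h 0
    have h2 := congrFun h 1
    have : (D : ℚ) ≠ 0 := by exact_mod_cast hpos.ne'
    simp [castVec, curveVec, this] at h1 h2
    exact ⟨h1, h2⟩
  have h1 := finrank_span_eq_card hli
  rw [Fintype.card_fin] at h1
  refine h1.ge.trans ?_
  refine Submodule.finrank_mono (Submodule.span_mono ?_)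
  rintro _ ⟨i, rfl⟩
  fin_cases i
  · exact ⟨_, Finset.mem_coe.2 (Finset.mem_image_of_mem _ hD), rfl⟩
  · exact ⟨_, Finset.mem_coe.2 (Finset.mem_image_of_mem _ h0), rfl⟩

/-- The curve of `{d 0, d 2, d 3}` has rank at least two and at most four vectors, hence two
relations suffice. All its weights are even while `d 1` is odd, so the quadric `x_1 ^ 2 = x_0 x_2`
is the only further relation. -/
theorem isCompleteIntersection_of_isRed (hpos : ∀ i, 0 < d i) (hinj : Function.Injective d)
    (hgcd : Finset.univ.gcd d = 1) (h01 : d 0 < d 1) (h012 : d 0 + d 2 = 2 * d 1)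
    (h0 : Even (d 0)) (h3 : Even (d 3)) (hred : IsRed (star {d 0, d 2, d 3}) ∅) :
    IsCompleteIntersection (toricIdeal k (star (Finset.univ.image d))) := by
  obtain ⟨p, hp02, hp⟩ : ∃ p, p ∈ ({d 0, d 2, d 3} : Finset ℕ).preimage d hinj.injOn ∧
      ∀ i, d i ≤ d p := by
    rcases le_total (d 2) (d 3) with h | h
    · refine ⟨3, by simp, fun i => ?_⟩
      fin_cases i <;> simp <;> omega
    · refine ⟨2, by simp, fun i => ?_⟩
      fin_cases i <;> simp <;> omega
  have hpC : d p ∈ ({d 0, d 2, d 3} : Finset ℕ) := Finset.mem_preimage.1 hp02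
  have hsup : ({d 0, d 2, d 3} : Finset ℕ).sup id = d p :=
    le_antisymm (Finset.sup_le (by simp [hp])) (Finset.le_sup (f := id) hpC)
  rw [star_eq _ hsup] at hred
  obtain ⟨S, hS, hcard⟩ := hasCIPairs_of_isRed_empty hred
  have hrank := two_le_finrank_ratSpan (A := insert 0 {d 0, d 2, d 3})
    (Finset.mem_insert_of_mem hpC) (hpos p) (Finset.mem_insert_self _ _)
  have hle : ((insert 0 {d 0, d 2, d 3} : Finset ℕ).image (curveVec (d p))).card ≤ 4 :=
    Finset.card_image_le.trans Finset.card_le_four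
  have hn13 : d 3 ≠ d 1 := hinj.ne (by decide)
  have hp0 := hpos 0
  have h2 : Even (d 2) := by
    have : Even (d 0 + d 2) := by rw [h012]; exact even_two_mul _
    exact (Nat.even_add.1 this).1 h0
  obtain ⟨S', hS', hgen⟩ := hS.insert_curveVec (b := d 1) (c := 2)
    (x := d 0) (y := d 2) (z := 0) (p := 1) (q := 1) (r := 0) (G := (2 : ℕ))
    (by simp; omega) (by simp) (by simp) (by simp) (by simp) (by simp [hp]) (hp 1)
    (by omega) (by omega) (by
      intro v hv
      simp only [Finset.mem_insert, Finset.mem_singleton] at hv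
      rw [Int.natCast_dvd_natCast]
      rcases hv with rfl | rfl | rfl | rfl
      exacts [dvd_zero _, h0.two_dvd, h2.two_dvd, h3.two_dvd]) (by
      intro x hx
      refine IsCoprime.dvd_of_dvd_mul_right ?_ hx
      rw [Nat.isCoprime_iff_coprime]
      exact forall_dvd_of_dvd_four _ hgcd ((Nat.gcd_dvd_left _ _).trans h0.two_dvd)
        (Nat.gcd_dvd_right _ _) ((Nat.gcd_dvd_left _ _).trans h2.two_dvd)
        ((Nat.gcd_dvd_left _ _).trans h3.two_dvd))
  refine isCompleteIntersection_of_generates hpos hinj hp (S := S') ?_ (by omega)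
  rw [star_eq _ (sup_image_eq hp)]
  convert hgen using 2
  ext x
  simp [Fin.exists_fin_succ, eq_comm]
  tauto

end ToricCI

end

/-! ### Assembling the theorem. -/

noncomputable section

namespace ToricCI

theorem exists_of_isGenArithSeq {n : ℕ} (hn : 4 ≤ n) {d : Fin n → ℕ}
    (hgen : IsGenArithSeq (fun i : Fin (n - 1) => d (Fin.castLE (Nat.sub_le n 1) i))) :
    ∃ h r : ℕ, 0 < h ∧ 0 < r ∧ d ⟨1, by omega⟩ = h * d ⟨0, by omega⟩ + r ∧
      ∀ i (hi : i + 1 < n - 1), 0 < i → d ⟨i + 1, by omega⟩ = d ⟨i, by omega⟩ + r := by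
  obtain ⟨h, hh, r, hr, hd⟩ := hgen
  refine ⟨h, r, hh, hr, ?_, fun i hi h0 => ?_⟩
  · exact hd ⟨0, by omega⟩ ⟨1, by omega⟩ rfl
  · have := hd ⟨i, by omega⟩ ⟨i + 1, hi⟩ rfl
    simp only [Nat.add_eq_zero_iff, one_ne_zero, and_false, if_false, h0.ne'] at this
    exact this

theorem last_ne_of_not_isArithSeq {n : ℕ} (hn : 4 ≤ n) {d : Fin n → ℕ} {h r : ℕ} (hr : 0 < r)
    (h1 : d ⟨1, by omega⟩ = h * d ⟨0, by omega⟩ + r)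
    (hd : ∀ i (hi : i + 1 < n - 1), 0 < i → d ⟨i + 1, by omega⟩ = d ⟨i, by omega⟩ + r)
    (hnot : ¬ IsArithSeq
      (fun i : Fin (n - 1) =>
        if i.val = 0 then d ⟨n - 1, by omega⟩ else d (Fin.castLE (Nat.sub_le n 1) i))) :
    d ⟨n - 1, by omega⟩ ≠ h * d ⟨0, by omega⟩ := by
  intro hlast
  refine hnot ⟨r, hr, ?_⟩
  rintro ⟨i, hi⟩ ⟨_, hj⟩ rfl
  rcases Nat.eq_zero_or_pos i with rfl | h0
  · simpa [hlast] using h1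
  · simp only [Nat.add_eq_zero_iff, one_ne_zero, and_false, if_false, h0.ne']
    exact hd i hj h0

/-- A complete intersection has four generators and its first three form an
arithmetic sequence. -/
theorem eq_four_and_eq_one {k : Type*} [Field k] {n : ℕ} (hn : 4 ≤ n) {d : Fin n → ℕ}
    (hpos : ∀ i, 0 < d i) (hinj : Function.Injective d) (hgcd : Finset.univ.gcd d = 1)
    {h r : ℕ} (hh : 0 < h) (hr : 0 < r)
    (h1 : d ⟨1, by omega⟩ = h * d ⟨0, by omega⟩ + r)
    (hd : ∀ i (hi : i + 1 < n - 1), 0 < i → d ⟨i + 1, by omega⟩ = d ⟨i, by omega⟩ + r)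
    (hlast : d ⟨n - 1, by omega⟩ ≠ h * d ⟨0, by omega⟩)
    (hCI : IsCompleteIntersection (toricIdeal k (star (Finset.univ.image d)))) :
    n = 4 ∧ h = 1 := by
  have hmono : ∀ i (hi : i < n - 1), ∀ j (hj : j ≤ i), 0 < j → d ⟨j, by omega⟩ ≤ d ⟨i, by omega⟩
      := by
    intro i
    induction i with
    | zero => intro _ j hj h0; omega
    | succ i ih =>
      intro hi j hj h0
      rcases hj.eq_or_lt with rfl | hj
      · exact le_rfl
      · have := ih (by omega) j (by omega) h0
        rw [hd i hi (by omega)]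
        omega
  have hd0 : d ⟨0, by omega⟩ ≤ h * d ⟨0, by omega⟩ := Nat.le_mul_of_pos_left _ hh
  have hle : ∀ i (hi : i < n - 1), d ⟨i, by omega⟩ ≤ d ⟨n - 2, by omega⟩ := by
    intro i hi
    rcases Nat.eq_zero_or_pos i with rfl | h0
    · have := hmono (n - 2) (by omega) 1 (by omega) one_pos
      omega
    · exact hmono (n - 2) (by omega) i (by omega) h0
  have hlt₁ : n - 1 < n := by omega
  have hlt₂ : n - 2 < n := by omega
  obtain ⟨p, hp, hpn⟩ : ∃ p : Fin n, (∀ i, d i ≤ d p) ∧ n - 2 ≤ p.val := by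
    rcases le_total (d ⟨n - 1, by omega⟩) (d ⟨n - 2, by omega⟩) with hl | hl
    · refine ⟨⟨n - 2, by omega⟩, fun i => ?_, le_rfl⟩
      rcases (show i.val < n - 1 ∨ i.val = n - 1 by omega) with hi | hi
      · exact hle i hi
      · have : i = ⟨n - 1, by omega⟩ := Fin.ext hi
        rw [this]; exact hl
    · refine ⟨⟨n - 1, by omega⟩, fun i => ?_, by simp; omega⟩
      rcases (show i.val < n - 1 ∨ i.val = n - 1 by omega) with hi | hi
      · exact (hle i hi).trans hl
      · have : i = ⟨n - 1, by omega⟩ := Fin.ext hi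
        rw [this]
  obtain ⟨c, hc⟩ := exists_isCritical hpos hinj hp
    (hasCIGenerators_of_isCompleteIntersection (k := k) hpos hinj hp hCI)
  -- The weights at indices `1` to `4` are in progression and carry two interlocking quadrics; `p`
  -- is at least `4`, so their bases `x_2`, `x_3` are not `x_p`.
  have hn6 : n < 6 := by
    by_contra h6
    have e1 := hd 1 (by omega) (by omega)
    have e2 := hd 2 (by omega) (by omega)
    have e3 := hd 3 (by omega) (by omega)
    refine hc.false_of_interlocking (i := ⟨2, by omega⟩) (j := ⟨3, by omega⟩)
      (l := ⟨1, by omega⟩) (m := ⟨4, by omega⟩) ?_ ?_ ?_ ?_ ?_ ?_ ?_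
    · intro hip; have := congrArg Fin.val hip; dsimp only at this; omega
    · intro hip; have := congrArg Fin.val hip; dsimp only at this; omega
    · simp
    · simp
    · simp
    · simp only [Nat.reduceAdd] at e1 e2 e3; omega
    · simp only [Nat.reduceAdd] at e1 e2 e3; omega
  have hh1 : h = 1 := by
    by_contra hne
    have hh2 : 2 ≤ h := by omega
    have e1 := hd 1 (by omega) (by omega)
    by_cases hpl : p.val = n - 1
    · obtain rfl : p = ⟨n - 1, hlt₁⟩ := Fin.ext hpl
      have hbig : ∀ i (hi : i < n - 1), 0 < i → h * d ⟨0, by omega⟩ < d ⟨i, by omega⟩ := by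
        intro i hi h0
        have := hmono i hi 1 h0 one_pos
        omega
      refine hc.false_of_max_last (z := ⟨0, by omega⟩) (u := ⟨1, by omega⟩) (q := ⟨2, by omega⟩)
        hpos hh2 (by simp) (by simp) hr h1 e1 (by simp; omega) ?_ ?_
      · intro i hi
        have hi0 : 0 < i.val := Nat.pos_of_ne_zero fun h => hi (Fin.ext h)
        rcases (show i.val < n - 1 ∨ i.val = n - 1 by omega) with hin | hin
        · exact hbig i hin hi0
        · have := hbig 1 (by omega) one_pos
          have h2 := hp ⟨1, by omega⟩
          have h3 : i = ⟨n - 1, by omega⟩ := Fin.ext hin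
          rw [h3]; omega
      · intro i hip hi0 hi1
        have a1 : i.val ≠ n - 1 := fun h => hip (Fin.ext h)
        have a2 : i.val ≠ 0 := fun h => hi0 (Fin.ext h)
        have a3 : i.val ≠ 1 := fun h => hi1 (Fin.ext h)
        exact hmono i (by omega) 2 (by omega) two_pos
    · have hpl' : p.val = n - 2 := by omega
      obtain rfl : p = ⟨n - 2, hlt₂⟩ := Fin.ext hpl'
      interval_cases n
      · have h3 := hp 3
        have h3' : d 3 ≠ d 2 := hinj.ne (by decide)
        exact IsCritical.false_four hc hpos hinj hgcd hh2 hr h1 e1 (lt_of_le_of_ne h3 h3') hlast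
      · exact IsCritical.false_five hc hpos hgcd hh2 hr h1 e1 (hd 2 (by omega) two_pos)
  subst hh1
  refine ⟨?_, rfl⟩
  by_contra hn4
  obtain rfl : n = 5 := by omega
  have e1 := hd 1 (by omega) (by omega)
  have e2 := hd 2 (by omega) (by omega)
  refine hc.false_of_interlocking (i := ⟨1, by omega⟩) (j := ⟨2, by omega⟩)
      (l := ⟨0, by omega⟩) (m := ⟨3, by omega⟩) ?_ ?_ ?_ ?_ ?_ ?_ ?_
  · intro hip; have := congrArg Fin.val hip; dsimp only at this; omega
  · intro hip; have := congrArg Fin.val hip; dsimp only at this; omega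
  · simp
  · simp
  · simp
  · simp only [Nat.reduceAdd] at e1 e2; omega
  · simp only [Nat.reduceAdd] at e1 e2; omega

/-- The largest weight is `d 2` or `d 3`. In the latter case only the second alternative arises,
because the critical relations of both `x_0` and `x_2` avoid `x_1`. -/
theorem isCompleteIntersection_iff_of_arith {k : Type*} [Field k] {d : Fin 4 → ℕ}
    (hpos : ∀ i, 0 < d i) (hinj : Function.Injective d) (hgcd : Finset.univ.gcd d = 1)
    (h01 : d 0 < d 1) (h012 : d 0 + d 2 = 2 * d 1) :
    IsCompleteIntersection (toricIdeal k (star (Finset.univ.image d))) ↔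
      (Even (d 0 / Nat.gcd (d 0) (d 1)) ∧ ∃ β₁ β₂ β₃ : ℕ,
          Nat.gcd (d 0) (d 1) * d 3 = β₁ * d 0 + β₂ * d 1 + β₃ * d 2 ∧
          β₁ + β₂ + β₃ ≤ Nat.gcd (d 0) (d 1)) ∨
        (Even (d 0) ∧ Even (d 3) ∧ IsRed (star {d 0, d 2, d 3}) ∅) := by
  constructor
  · intro hCI
    have hn03 : d 0 ≠ d 3 := hinj.ne (by decide)
    have hn23 : d 2 ≠ d 3 := hinj.ne (by decide)
    rcases lt_or_gt_of_ne hn23 with h | h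
    · have hp : ∀ i, d i ≤ d 3 := fun i => by fin_cases i <;> simp <;> omega
      obtain ⟨c, hc⟩ := exists_isCritical hpos hinj hp
        (hasCIGenerators_of_isCompleteIntersection (k := k) hpos hinj hp hCI)
      obtain ⟨hE, h0, h3⟩ := hc.case_four_arith_of_three h012
      exact Or.inr ⟨h0, h3, isRed_star_empty (by simp) (hpos 0) (hpos 2) (by omega) h
        (by omega) hE⟩
    · have hp : ∀ i, d i ≤ d 2 := fun i => by fin_cases i <;> simp <;> omega
      obtain ⟨c, hc⟩ := exists_isCritical hpos hinj hp
        (hasCIGenerators_of_isCompleteIntersection (k := k) hpos hinj hp hCI)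
      rcases hc.case_four_arith_of_two (hpos 0) h012 with ⟨hE, h0, h3⟩ | h
      · exact Or.inr ⟨h0, h3, isRed_star_empty (by simp; tauto) (hpos 0) (hpos 3) (by omega) h
          hn03 hE⟩
      · exact Or.inl h
  · rintro (⟨he, β₁, β₂, β₃, hβ, hβs⟩ | ⟨h0, h3, hred⟩)
    · exact isCompleteIntersection_of_even_div hpos hinj hgcd h01 h012 he hβ hβs
    · exact isCompleteIntersection_of_isRed hpos hinj hgcd h01 h012 h0 h3 hred

end ToricCI

end

theorem mainTheorem6 {k : Type*} [Field k] (n : ℕ) (hn : 4 ≤ n) (d : Fin n → ℕ)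
    (hpos : ∀ i, 0 < d i) (hinj : Function.Injective d)
    (hgcd : Finset.univ.gcd d = 1)
    (hgen : ToricCI.IsGenArithSeq
      (fun i : Fin (n - 1) => d (Fin.castLE (Nat.sub_le n 1) i)))
    (hnot : ¬ ToricCI.IsArithSeq
      (fun i : Fin (n - 1) =>
        if i.val = 0 then d ⟨n - 1, by omega⟩ else d (Fin.castLE (Nat.sub_le n 1) i))) :
    ToricCI.IsCompleteIntersection
        (ToricCI.toricIdeal k (ToricCI.star (Finset.univ.image d))) ↔
      n = 4 ∧
      ToricCI.IsArithSeq ![d ⟨0, by omega⟩, d ⟨1, by omega⟩, d ⟨2, by omega⟩] ∧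
      ((Even (d ⟨0, by omega⟩ / Nat.gcd (d ⟨0, by omega⟩) (d ⟨1, by omega⟩)) ∧
          ∃ β₁ β₂ β₃ : ℕ,
            Nat.gcd (d ⟨0, by omega⟩) (d ⟨1, by omega⟩) * d ⟨3, by omega⟩ =
              β₁ * d ⟨0, by omega⟩ + β₂ * d ⟨1, by omega⟩ + β₃ * d ⟨2, by omega⟩ ∧
            β₁ + β₂ + β₃ ≤ Nat.gcd (d ⟨0, by omega⟩) (d ⟨1, by omega⟩)) ∨
        (Even (d ⟨0, by omega⟩) ∧ Even (d ⟨3, by omega⟩) ∧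
          ToricCI.IsRed
            (ToricCI.star {d ⟨0, by omega⟩, d ⟨2, by omega⟩, d ⟨3, by omega⟩}) ∅)) := by
  constructor
  · intro hCI
    obtain ⟨h, r, hh, hr, h1, hd⟩ := ToricCI.exists_of_isGenArithSeq hn hgen
    obtain ⟨rfl, rfl⟩ := ToricCI.eq_four_and_eq_one hn hpos hinj hgcd hh hr h1 hd
      (ToricCI.last_ne_of_not_isArithSeq hn hr h1 hd hnot) hCI
    rw [one_mul] at h1
    have h2 : d 2 = d 1 + r := hd 1 (by omega) one_pos
    have h1' : d 1 = d 0 + r := h1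
    refine ⟨rfl, ⟨r, hr, ?_⟩, ?_⟩
    · intro i j hij
      fin_cases i <;> fin_cases j <;> simp at hij <;> simp
      exacts [h1', h2]
    · exact (ToricCI.isCompleteIntersection_iff_of_arith hpos hinj hgcd (by omega)
        (by omega)).1 hCI
  · rintro ⟨rfl, ⟨r, hr, hA⟩, h⟩
    have h1 : d 1 = d 0 + r := hA 0 1 rfl
    have h2 : d 2 = d 1 + r := hA 1 2 rfl
    exact (ToricCI.isCompleteIntersection_iff_of_arith hpos hinj hgcd (by omega) (by omega)).2 h
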